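/- Let $Q$ be a finite-dimensional smooth manifold (without boundary) and let $R_d=(R^1,R^2)\colon U\to Q\times Q$ be a discretization map: $U\subseteq TQ$ is an open neighbourhood of the zero section (for instance $U=TQ$), $R_d$ is smooth, $R_d(0_q)=(q,q)$ and $T_{0_q}R^2_q-T_{0_q}R^1_q=\mathrm{id}_{T_qQ}$ for all $q\in Q$, where $R^i_q=R^i|_{U\cap T_qQ}$. Notation: - $T^*R_d$ is the map $\zeta\in T^*_vTQ\mapsto \zeta\circ(T_vR_d)^{-1}\in T^*_{R_d(v)}(Q\times Q)$, defined on the set $D$ of those $\zeta$ for which $v\in U$ and $T_vR_d$ is invertible. - $\Lambda_M^\sharp\colon T^*T^*M\to TT^*M$ is the map of the canonical Poisson structure of $T^*M$, locally $dq^i\mapsto-\partial/\partial p_i$, $dp_i\mapsto\partial/\partial q^i$. - $\mathcal I_{TQ}\colon T^*T^*Q\to T^*TQ$ is the canonical antisymplectomorphism $(q,p;\delta q,\delta p)\mapsto(q,\delta p;-\delta q,p)$, and $\alpha_Q\colon T^*TQ\to TT^*Q$ is Tulczyjew's isomorphism $(q,v;p_q,p_v)\mapsto(q,p_v;v,p_q)$,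 in canonical coordinates. - $T^*(Q\times Q)\rightrightarrows T^*Q$ is the cotangent groupoid of the pair groupoid: for covectors $(\gamma,\delta)$ at $(q_0,q_1)$ and $\gamma_q\in T_q^*Q$, $\tilde\alpha(\gamma,\delta)=-\gamma$, $\tilde\beta(\gamma,\delta)=\delta$, $\tilde\epsilon(\gamma_q)=(-\gamma_q,\gamma_q)$, $\tilde\imath(\gamma,\delta)=(-\delta,-\gamma)$, $\tilde m((\gamma,\delta),(-\delta,\mu))=(\gamma,\mu)$. Its Lie algebroid is identified with $T^*T^*Q$ by $\Psi(w)=\Lambda_{Q\times Q}^\sharp(\tilde\beta^*w)\in\ker T\tilde\alpha$, $w\in T_p^*T^*Q$, at $\tilde\epsilon(p)$. The Lie algebroid of a pair groupoid $M\times M\rightrightarrows M$ is identified with $TM$ by $v\mapsto(0,v)$. - $\Phi^*\colon T^*(Q\times Q)\to T^*Q\times T^*Q$ is $\Phi^*(\gamma,\delta)=(-\gamma,\delta)$. - For a Lie groupoid $G\rightrightarrows M$ with source $\alpha$, identity section $\epsilon$ and Lie algebroid $AG=\ker(T\alpha)|_{\epsilon(M)}$, a generalized discretization map is a smooth map $\mathcal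 R$ from an open neighbourhood of the zero section of $AG$ to $G$ with $\mathcal R(0_x)=\epsilon(x)$ and $T_{0_x}\mathcal R_x(a^{\mathtt v})=a+(T_x\epsilon\circ T_{\epsilon(x)}\alpha\circ T_{0_x}\mathcal R_x)(a^{\mathtt v})$ for all $x\in M$, $a\in A_xG$, where $\mathcal R_x=\mathcal R|_{A_xG}$ and $a^{\mathtt v}=\frac{d}{dt}|_{t=0}(ta)$. Then: 1. $\widetilde{\mathcal R}=T^*R_d\circ\mathcal I_{TQ}$, defined on $\mathcal I_{TQ}^{-1}(D)\subseteq T^*T^*Q$, is a generalized discretization map on the cotangent Lie groupoid $T^*(Q\times Q)\rightrightarrows T^*Q$. 2. $R^{T^*}=\Phi^*\circ T^*R_d\circ\alpha_Q^{-1}$, defined on $\alpha_Q(D)\subseteq TT^*Q$, is a discretization map on the manifold $T^*Q$ (equivalently, a generalized discretization map on the pair groupoid $T^*Q\times T^*Q\rightrightarrows T^*Q$), and $\widetilde{\mathcal R}$ is isomorphic to it via $\Lambda_Q^\sharp$ and $\Phi^*$. That is: $\Phi^*$ is an isomorphism of Lie groupoids from $T^*(Q\times Q)\rightrightarrows T^*Q$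 to $T^*Q\times T^*Q\rightrightarrows T^*Q$ over the identity of $T^*Q$; $\Lambda_Q^\sharp\colon T^*T^*Q\to TT^*Q$ is an isomorphism of Lie algebroids over the identity and is the one induced by $\Phi^*$, $T\Phi^*(\Psi(w))=(0,\Lambda_Q^\sharp(w))$; it maps $\mathcal I_{TQ}^{-1}(D)$ onto $\alpha_Q(D)$; and $R^{T^*}\circ\Lambda_Q^\sharp=\Phi^*\circ\widetilde{\mathcal R}$ on $\mathcal I_{TQ}^{-1}(D)$. -/

import Mathlib

open Bundle Manifold ContDiff

noncomputable section

namespace CotangentLift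

/-! ### Cotangent bundles, discretization maps, lifts -/

section Basic

variable {E : Type*} [NormedAddCommGroup E] [NormedSpace ℝ E]
  {H : Type*} [TopologicalSpace H] (I : ModelWithCorners ℝ E H)
  (M : Type*) [TopologicalSpace M] [ChartedSpace H M]

/-- The fibre `T*_x M` of the cotangent bundle, i.e. the dual of the tangent space. -/
abbrev Covector {M : Type*} [TopologicalSpace M] [ChartedSpace H M] (x : M) : Type _ :=
  TangentSpace I x →L[ℝ] ℝ

/-- The cotangent bundle `T*M`, with Mathlib's smooth structure of the bundle of
continuous linear maps from the tangent bundle to the trivial line bundle. -/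
abbrev CotangentBundle : Type _ :=
  TotalSpace (E →L[ℝ] ℝ) (fun x : M => TangentSpace I x →L[ℝ] ℝ)

/-- The model with corners of the manifold `T*M`. -/
abbrev cotModel : ModelWithCorners ℝ (E × (E →L[ℝ] ℝ)) (ModelProd H (E →L[ℝ] ℝ)) :=
  I.prod 𝓘(ℝ, E →L[ℝ] ℝ)

variable {M}

/-- The derivative at `0_q` of the restriction `f_q` to the fibre `T_q M` of `f : TM → M`. As a
vector space, `T_q M` is the model space `E`; when `f(0_q) = q` this is the map
`T_{0_q} f_q : T_q M → T_q M`. -/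
def fibreDeriv [IsManifold I ∞ M] (f : TangentBundle I M → M) (q : M) : E →L[ℝ] E :=
  mfderiv 𝓘(ℝ, E) I (fun u : E => f (⟨q, u⟩ : TangentBundle I M)) 0

/-- `R` is a discretization map `U ⊆ TM → M × M` on the manifold `M`: `U` is an open
neighbourhood of the zero section, `R = (R¹, R²)` is smooth on `U`, `R(0_q) = (q, q)`, and
`T_{0_q} R²_q - T_{0_q} R¹_q = id`, where `Rⁱ_q` is the restriction of `Rⁱ` to `T_q M`. -/
structure IsDiscretizationMap [IsManifold I ∞ M] (U : Set (TangentBundle I M))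
    (R : TangentBundle I M → M × M) : Prop where
  isOpen : IsOpen U
  zero_mem : ∀ q : M, (⟨q, 0⟩ : TangentBundle I M) ∈ U
  smooth : ContMDiffOn I.tangent (I.prod I) ∞ R U
  map_zero : ∀ q : M, R ⟨q, 0⟩ = (q, q)
  deriv_zero : ∀ q : M,
    fibreDeriv I (fun v => (R v).2) q - fibreDeriv I (fun v => (R v).1) q
      = ContinuousLinearMap.id ℝ E

section Lift

variable {E' : Type*} [NormedAddCommGroup E'] [NormedSpace ℝ E']
  {H' : Type*} [TopologicalSpace H'] (J : ModelWithCorners ℝ E' H')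
  {N : Type*} [TopologicalSpace N] [ChartedSpace H' N]

/-- The cotangent lift `T*f : T*M → T*N` of `f : M → N`, which sends `ζ ∈ T*_x M` to
`ζ ∘ (T_x f)⁻¹ ∈ T*_{f x} N`. It is meaningful on `cotangentLiftDomain`. -/
def cotangentLift (f : M → N) (ζ : CotangentBundle I M) : CotangentBundle J N :=
  ⟨f ζ.proj, ζ.2.comp (mfderiv I J f ζ.proj).inverse⟩

/-- The domain of the cotangent lift of a map `f` defined on `U`: the covectors at those
points of `U` at which the tangent map of `f` is invertible. -/
def cotangentLiftDomain (f : M → N) (U : Set M) : Set (CotangentBundle I M) :=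
  {ζ | ζ.proj ∈ U ∧ (mfderiv I J f ζ.proj).IsInvertible}

end Lift

/-! ### The canonical symplectic and Poisson structures of a cotangent bundle

Mathlib's tangent space `TangentSpace I x` is the model space, identified with the geometric
tangent space through the preferred chart at `x`. For the point `p ∈ T*_q M`
of `T*M` this chart is the canonical cotangent chart `(qⁱ, pᵢ)` induced by the preferred chart at
`q`, so that `T_p T*M = E × E*`, the pair `(a, b)` being `aⁱ ∂/∂qⁱ + bᵢ ∂/∂pᵢ`; and similarly for
the tangent bundle. -/

/-- The canonical (Liouville) one-form of `T*M`: `θ_p(X) = p(Tπ X)`. -/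
def liouvilleForm [IsManifold I ∞ M] (p : CotangentBundle I M) : TangentSpace (cotModel I) p →L[ℝ] ℝ :=
  p.2.comp (mfderiv (cotModel I) I (fun p' : CotangentBundle I M => p'.proj) p)

/-- The local representative of a one-form `θ` in the preferred chart at `x`. -/
def oneFormInChart (θ : ∀ y : M, TangentSpace I y →L[ℝ] ℝ) (x : M) (y : E) : E →L[ℝ] ℝ :=
  (θ ((extChartAt I x).symm y)).comp (mfderiv 𝓘(ℝ, E) I (extChartAt I x).symm y)

/-- The exterior derivative of a one-form on a boundaryless manifold, as a bilinear form:
`dθ(X, Y) = X(θ(Y)) - Y(θ(X))` for constant `X`, `Y` in the preferred chart at `x`. -/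
def extDerivOneForm (θ : ∀ y : M, TangentSpace I y →L[ℝ] ℝ) (x : M) :
    TangentSpace I x →L[ℝ] TangentSpace I x →L[ℝ] ℝ :=
  let D : E →L[ℝ] E →L[ℝ] ℝ := fderiv ℝ (oneFormInChart I θ x) (extChartAt I x x)
  D - D.flip

/-- The canonical symplectic form `ω = -dθ` of `T*M` (locally `dqⁱ ∧ dpᵢ`), in the form
`X ↦ i_X ω`. -/
def canonicalSymplectic [IsManifold I ∞ M] (p : CotangentBundle I M) :
    TangentSpace (cotModel I) p →L[ℝ] Covector (cotModel I) p :=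
  -extDerivOneForm (cotModel I) (fun p' : CotangentBundle I M => liouvilleForm I p') p

/-- The map `Λ♯ : T*_p T*M → T_p T*M` of the canonical Poisson structure of `T*M`, i.e. the
inverse of `X ↦ i_X ω` (locally `dqⁱ ↦ -∂/∂pᵢ`, `dpᵢ ↦ ∂/∂qⁱ`). -/
def poissonSharp [IsManifold I ∞ M] (p : CotangentBundle I M) :
    Covector (cotModel I) p →L[ℝ] TangentSpace (cotModel I) p :=
  (canonicalSymplectic I p).inverse

/-! ### Tulczyjew's isomorphism and the canonical antisymplectomorphism -/

/-- Tulczyjew's isomorphism `α : T*TM → TT*M`,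
locally `(q, v; pq, pv) ↦ (q, pv; v, pq)`. -/
def tulczyjew [IsManifold I ∞ M] :
    CotangentBundle I.tangent (TangentBundle I M) ≃
      TangentBundle (cotModel I) (CotangentBundle I M) where
  toFun ζ :=
    let z : E × E →L[ℝ] ℝ := ζ.2
    ⟨⟨ζ.proj.proj, z.comp (ContinuousLinearMap.inr ℝ E E)⟩,
      ((ζ.proj.2, z.comp (ContinuousLinearMap.inl ℝ E E)) : E × (E →L[ℝ] ℝ))⟩
  invFun ξ :=
    let x : E × (E →L[ℝ] ℝ) := ξ.2
    ⟨⟨ξ.proj.proj, x.1⟩, (x.2.coprod ξ.proj.2 : E × E →L[ℝ] ℝ)⟩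
  left_inv := by
    rintro ⟨⟨q, v⟩, z⟩
    refine congrArg (TotalSpace.mk (⟨q, v⟩ : TangentBundle I M)) ?_
    exact ContinuousLinearMap.coprod_comp_inl_inr (z : E × E →L[ℝ] ℝ)
  right_inv := by
    rintro ⟨⟨q, p⟩, x⟩
    have key : ∀ (p p' b b' : E →L[ℝ] ℝ) (a : E), p' = p → b' = b →
        (⟨⟨q, p'⟩, ((a, b') : E × (E →L[ℝ] ℝ))⟩ :
          TangentBundle (cotModel I) (CotangentBundle I M)) =
        ⟨⟨q, p⟩, ((a, b) : E × (E →L[ℝ] ℝ))⟩ := by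
      rintro p _ b _ a rfl rfl
      rfl
    exact key _ _ _ _ _
      (ContinuousLinearMap.coprod_comp_inr (x : E × (E →L[ℝ] ℝ)).2 (p : E →L[ℝ] ℝ))
      (ContinuousLinearMap.coprod_comp_inl (x : E × (E →L[ℝ] ℝ)).2 (p : E →L[ℝ] ℝ))

/-- The canonical antisymplectomorphism `𝓘 : T*T*M → T*TM`,
locally `(q, p; δq, δp) ↦ (q, δp; -δq, p)`. Here `δp`, a linear form on `E*`, is read as a
vector of the finite-dimensional space `E`. -/
def canonicalI [IsManifold I ∞ M] (w : CotangentBundle (cotModel I) (CotangentBundle I M)) :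
    CotangentBundle I.tangent (TangentBundle I M) :=
  let dq : E →L[ℝ] ℝ :=
    (w.2 : E × (E →L[ℝ] ℝ) →L[ℝ] ℝ).comp (ContinuousLinearMap.inl ℝ E (E →L[ℝ] ℝ))
  let dp : E := (NormedSpace.inclusionInDoubleDual ℝ E).inverse
    ((w.2 : E × (E →L[ℝ] ℝ) →L[ℝ] ℝ).comp (ContinuousLinearMap.inr ℝ E (E →L[ℝ] ℝ)))
  ⟨⟨w.proj.proj, dp⟩, ((-dq).coprod w.proj.2 : E × E →L[ℝ] ℝ)⟩

end Basic

/-! ### Lie groupoids and their Lie algebroids -/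

/-- The structure maps of a groupoid `G ⇉ M`: source `α`, target `β`, identity section `ε`,
inversion, and multiplication. Only the products `mul g h` with `β(g) = α(h)` are meaningful. -/
structure GroupoidMaps (G M : Type*) where
  src : G → M
  tgt : G → M
  unit : M → G
  inv : G → G
  mul : G → G → G

/-- The pair groupoid `M × M ⇉ M`. -/
def pairGroupoid (M : Type*) : GroupoidMaps (M × M) M where
  src g := g.1
  tgt g := g.2
  unit x := (x, x)
  inv g := (g.2, g.1)
  mul g h := (g.1, h.2)

section Groupoid

variable {EM : Type*} [NormedAddCommGroup EM] [NormedSpace ℝ EM]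
  {HM : Type*} [TopologicalSpace HM] (IM : ModelWithCorners ℝ EM HM)
  {M : Type*} [TopologicalSpace M] [ChartedSpace HM M] [IsManifold IM ∞ M]
  {EG : Type*} [NormedAddCommGroup EG] [NormedSpace ℝ EG]
  {HG : Type*} [TopologicalSpace HG] (IG : ModelWithCorners ℝ EG HG)
  {G : Type*} [TopologicalSpace G] [ChartedSpace HG G] [IsManifold IG ∞ G]

/-- The structure maps `S` make `G ⇉ M` a Lie groupoid (for finite-dimensional `G` and `M`). -/
structure IsLieGroupoid (S : GroupoidMaps G M) : Prop where
  src_unit : ∀ x, S.src (S.unit x) = x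
  tgt_unit : ∀ x, S.tgt (S.unit x) = x
  src_mul : ∀ g h, S.tgt g = S.src h → S.src (S.mul g h) = S.src g
  tgt_mul : ∀ g h, S.tgt g = S.src h → S.tgt (S.mul g h) = S.tgt h
  mul_assoc : ∀ g h k, S.tgt g = S.src h → S.tgt h = S.src k →
    S.mul (S.mul g h) k = S.mul g (S.mul h k)
  unit_mul : ∀ g, S.mul (S.unit (S.src g)) g = g
  mul_unit : ∀ g, S.mul g (S.unit (S.tgt g)) = g
  src_inv : ∀ g, S.src (S.inv g) = S.tgt g
  tgt_inv : ∀ g, S.tgt (S.inv g) = S.src g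
  inv_mul : ∀ g, S.mul (S.inv g) g = S.unit (S.tgt g)
  mul_inv : ∀ g, S.mul g (S.inv g) = S.unit (S.src g)
  smooth_src : ContMDiff IG IM ∞ S.src
  smooth_tgt : ContMDiff IG IM ∞ S.tgt
  smooth_unit : ContMDiff IM IG ∞ S.unit
  smooth_inv : ContMDiff IG IG ∞ S.inv
  smooth_mul : ContMDiffOn (IG.prod IG) IG ∞ (fun p : G × G => S.mul p.1 p.2)
    {p | S.tgt p.1 = S.src p.2}
  submersion_src : ∀ g, Function.Surjective (mfderiv IG IM S.src g)
  submersion_tgt : ∀ g, Function.Surjective (mfderiv IG IM S.tgt g)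

variable {F : Type*} [NormedAddCommGroup F] [NormedSpace ℝ F]
  {A : M → Type*} [TopologicalSpace (TotalSpace F A)] [∀ x, AddCommGroup (A x)]
  [∀ x, Module ℝ (A x)] [∀ x, TopologicalSpace (A x)] [FiberBundle F A] [VectorBundle ℝ F A]
  [ContMDiffVectorBundle ∞ F A IM]

variable (F) in
/-- The vector bundle `A → M` (with model fibre `F`) is identified through `ι` with the vector bundle
`AG = ker(Tα)|_{ε(M)}` underlying the Lie algebroid of `G ⇉ M`:
`ι x : A_x → T_{ε(x)} G` is injective with image `ker T_{ε(x)} α`, and `ι` is smooth. -/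
structure IsLieAlgebroidModel (S : GroupoidMaps G M)
    (ι : ∀ x, A x →L[ℝ] TangentSpace IG (S.unit x)) : Prop where
  injective : ∀ x, Function.Injective (ι x)
  range_eq : ∀ x, Set.range (ι x) = {v | mfderiv IG IM S.src (S.unit x) v = 0}
  smooth : ContMDiff (IM.prod 𝓘(ℝ, F)) IG.tangent ∞
    (fun a : TotalSpace F A => (⟨S.unit a.proj, ι a.proj a.2⟩ : TangentBundle IG G))

variable (F) in
/-- The vertical lift `(a)^v ∈ T_{0_x} A` of `a ∈ A_x` at the zero vector, `d/dt|_{t=0} (t a)`. -/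
def verticalLift (x : M) (a : A x) :
    TangentSpace (IM.prod 𝓘(ℝ, F)) (⟨x, (0 : ℝ) • a⟩ : TotalSpace F A) :=
  mfderiv 𝓘(ℝ, ℝ) (IM.prod 𝓘(ℝ, F)) (fun t : ℝ => (⟨x, t • a⟩ : TotalSpace F A)) 0 (1 : ℝ)

/-- `R : U ⊆ A → G` is a generalized discretization map on the Lie groupoid `G ⇉ M`, whose Lie
algebroid is identified with `A` through `ι`: `U` is an open neighbourhood of the zero section,
`R` is smooth on `U`, `R(0_x) = ε(x)`, and
`T_{0_x} R (a^v) = a + (T_x ε ∘ T_{ε(x)} α ∘ T_{0_x} R)(a^v)` for `a ∈ A_x`. -/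
structure IsGeneralizedDiscretizationMap (S : GroupoidMaps G M)
    (ι : ∀ x, A x →L[ℝ] TangentSpace IG (S.unit x))
    (U : Set (TotalSpace F A)) (R : TotalSpace F A → G) : Prop where
  lieGroupoid : IsLieGroupoid IM IG S
  lieAlgebroid : IsLieAlgebroidModel IM IG F S ι
  isOpen : IsOpen U
  zero_mem : ∀ x : M, (⟨x, 0⟩ : TotalSpace F A) ∈ U
  smooth : ContMDiffOn (IM.prod 𝓘(ℝ, F)) IG ∞ R U
  map_zero : ∀ x : M, R ⟨x, 0⟩ = S.unit x
  deriv_zero : ∀ (x : M) (a : A x),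
    let TRa : TangentSpace IG (S.unit x) :=
      mfderiv (IM.prod 𝓘(ℝ, F)) IG R (⟨x, 0⟩ : TotalSpace F A) (verticalLift IM F x a)
    TRa = ι x a + mfderiv IM IG S.unit x (mfderiv IG IM S.src (S.unit x) TRa)

/-- `V` is the left-invariant vector field on `G` of the section `X` of `A ≅ AG`:
`V(g) = T_{ε(β(g))} L_g (X(β(g)))`, where `L_g h = g h` is the left translation on the
`α`-fibre of `β(g)`, and its tangent map is computed along curves in that fibre. -/
def IsLeftInvariantField (S : GroupoidMaps G M)
    (ι : ∀ x, A x →L[ℝ] TangentSpace IG (S.unit x))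
    (X : ∀ x, A x) (V : ∀ g : G, TangentSpace IG g) : Prop :=
  ∀ (g : G) (c : ℝ → G), ContMDiffAt 𝓘(ℝ, ℝ) IG ∞ c 0 →
    (∀ᶠ t in nhds (0 : ℝ), S.src (c t) = S.tgt g) → c 0 = S.unit (S.tgt g) →
    (mfderiv 𝓘(ℝ, ℝ) IG c 0 (1 : ℝ) : EG) = ι (S.tgt g) (X (S.tgt g)) →
    (mfderiv 𝓘(ℝ, ℝ) IG (fun t => S.mul g (c t)) 0 (1 : ℝ) : EG) = V g

/-- `Z = ⟦X, Y⟧` for the Lie algebroid bracket of `A ≅ AG`: the left-invariant vector field of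
`Z` is the Lie bracket of those of `X` and `Y`. -/
def IsAlgebroidBracket (S : GroupoidMaps G M)
    (ι : ∀ x, A x →L[ℝ] TangentSpace IG (S.unit x)) (X Y Z : ∀ x, A x) : Prop :=
  ∀ V W : ∀ g : G, TangentSpace IG g,
    IsLeftInvariantField IG S ι X V → IsLeftInvariantField IG S ι Y W →
    IsLeftInvariantField IG S ι Z (VectorField.mlieBracket IG V W)

/-! ### Isomorphisms -/

variable {EG' : Type*} [NormedAddCommGroup EG'] [NormedSpace ℝ EG']
  {HG' : Type*} [TopologicalSpace HG'] (IG' : ModelWithCorners ℝ EG' HG')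
  {G' : Type*} [TopologicalSpace G'] [ChartedSpace HG' G'] [IsManifold IG' ∞ G']
  {F' : Type*} [NormedAddCommGroup F'] [NormedSpace ℝ F']
  {A' : M → Type*} [TopologicalSpace (TotalSpace F' A')] [∀ x, AddCommGroup (A' x)]
  [∀ x, Module ℝ (A' x)] [∀ x, TopologicalSpace (A' x)] [FiberBundle F' A']
  [VectorBundle ℝ F' A'] [ContMDiffVectorBundle ∞ F' A' IM]

/-- `Φ` is an isomorphism of Lie groupoids from `G ⇉ M` to `G' ⇉ M` over the identity of `M`. -/
structure IsLieGroupoidIso (S : GroupoidMaps G M) (S' : GroupoidMaps G' M) (Φ : G → G') :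
    Prop where
  diffeo : ∃ d : G ≃ₘ^∞⟮IG, IG'⟯ G', ⇑d = Φ
  src_map : ∀ g, S'.src (Φ g) = S.src g
  tgt_map : ∀ g, S'.tgt (Φ g) = S.tgt g
  unit_map : ∀ x, Φ (S.unit x) = S'.unit x
  inv_map : ∀ g, Φ (S.inv g) = S'.inv (Φ g)
  mul_map : ∀ g h, S.tgt g = S.src h → Φ (S.mul g h) = S'.mul (Φ g) (Φ h)

variable (F F') in
/-- `Θ` is an isomorphism of Lie algebroids over the identity of `M` between the Lie algebroids
`A ≅ AG` and `A' ≅ AG'`: an isomorphism of smooth vector bundles compatible with the anchors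
`ρ = Tβ` and with the brackets of smooth sections. -/
structure IsLieAlgebroidIso (S : GroupoidMaps G M)
    (ι : ∀ x, A x →L[ℝ] TangentSpace IG (S.unit x)) (S' : GroupoidMaps G' M)
    (ι' : ∀ x, A' x →L[ℝ] TangentSpace IG' (S'.unit x)) (Θ : ∀ x, A x →L[ℝ] A' x) : Prop where
  diffeo : ∃ d : TotalSpace F A ≃ₘ^∞⟮IM.prod 𝓘(ℝ, F), IM.prod 𝓘(ℝ, F')⟯ TotalSpace F' A',
    ∀ a, d a = ⟨a.proj, Θ a.proj a.2⟩
  anchor : ∀ (x : M) (a : A x),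
    (mfderiv IG' IM S'.tgt (S'.unit x) (ι' x (Θ x a)) : EM)
      = mfderiv IG IM S.tgt (S.unit x) (ι x a)
  bracket : ∀ X Y Z : ∀ x, A x,
    ContMDiff IM (IM.prod 𝓘(ℝ, F)) ∞ (fun x => (⟨x, X x⟩ : TotalSpace F A)) →
    ContMDiff IM (IM.prod 𝓘(ℝ, F)) ∞ (fun x => (⟨x, Y x⟩ : TotalSpace F A)) →
    ContMDiff IM (IM.prod 𝓘(ℝ, F)) ∞ (fun x => (⟨x, Z x⟩ : TotalSpace F A)) →
    (IsAlgebroidBracket IG S ι X Y Z ↔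
      IsAlgebroidBracket IG' S' ι' (fun x => Θ x (X x)) (fun x => Θ x (Y x)) (fun x => Θ x (Z x)))

/-- The maps `R : U ⊆ A → G` and `R' : U' ⊆ A' → G'` are isomorphic via the Lie groupoid
isomorphism `Φ : G → G'` and the Lie algebroid isomorphism `Θ = AΦ : A → A'` which it induces:
`Θ(U) = U'` and `R' = Φ ∘ R ∘ (AΦ)⁻¹`, i.e. `R' ∘ Θ = Φ ∘ R`. -/
structure IsIsomorphicVia (S : GroupoidMaps G M)
    (ι : ∀ x, A x →L[ℝ] TangentSpace IG (S.unit x))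
    (U : Set (TotalSpace F A)) (R : TotalSpace F A → G)
    (S' : GroupoidMaps G' M) (ι' : ∀ x, A' x →L[ℝ] TangentSpace IG' (S'.unit x))
    (U' : Set (TotalSpace F' A')) (R' : TotalSpace F' A' → G')
    (Φ : G → G') (Θ : ∀ x, A x →L[ℝ] A' x) : Prop where
  groupoidIso : IsLieGroupoidIso IG IG' S S' Φ
  algebroidIso : IsLieAlgebroidIso IM IG F IG' F' S ι S' ι' Θ
  induced : ∀ (x : M) (a : A x),
    (mfderiv IG IG' Φ (S.unit x) (ι x a) : EG') = ι' x (Θ x a)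
  domain : ∀ a : TotalSpace F A, a ∈ U ↔ (⟨a.proj, Θ a.proj a.2⟩ : TotalSpace F' A') ∈ U'
  commutes : ∀ a ∈ U, R' ⟨a.proj, Θ a.proj a.2⟩ = Φ (R a)

end Groupoid

/-! ### The cotangent groupoid of the pair groupoid, and the two lifts -/

section Pair

variable {E : Type*} [NormedAddCommGroup E] [NormedSpace ℝ E]
  {H : Type*} [TopologicalSpace H] (I : ModelWithCorners ℝ E H)
  {Q : Type*} [TopologicalSpace Q] [ChartedSpace H Q] [IsManifold I ∞ Q]

/-- The component `γ ∈ T*_{q₀} Q` of the covector `(γ, δ) ∈ T*_{(q₀, q₁)} (Q × Q)`. -/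
def covFst (P : CotangentBundle (I.prod I) (Q × Q)) : Covector I P.proj.1 :=
  (P.2 : E × E →L[ℝ] ℝ).comp (ContinuousLinearMap.inl ℝ E E)

/-- The component `δ ∈ T*_{q₁} Q` of the covector `(γ, δ) ∈ T*_{(q₀, q₁)} (Q × Q)`. -/
def covSnd (P : CotangentBundle (I.prod I) (Q × Q)) : Covector I P.proj.2 :=
  (P.2 : E × E →L[ℝ] ℝ).comp (ContinuousLinearMap.inr ℝ E E)

/-- The covector `(γ, δ) ∈ T*_{(q₀, q₁)} (Q × Q)`. -/
def covPair {q₀ q₁ : Q} (γ : Covector I q₀) (δ : Covector I q₁) :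
    CotangentBundle (I.prod I) (Q × Q) :=
  ⟨(q₀, q₁), ((γ : E →L[ℝ] ℝ).coprod δ : E × E →L[ℝ] ℝ)⟩

variable (Q) in
/-- The cotangent groupoid `T*(Q × Q) ⇉ T*Q` of the pair groupoid `Q × Q ⇉ Q`. -/
def cotangentPairGroupoid :
    GroupoidMaps (CotangentBundle (I.prod I) (Q × Q)) (CotangentBundle I Q) where
  src P := ⟨P.proj.1, -covFst I P⟩
  tgt P := ⟨P.proj.2, covSnd I P⟩
  unit p := covPair I (-p.2) p.2
  inv P := covPair I (-covSnd I P) (-covFst I P)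
  mul P P' := covPair I (covFst I P) (covSnd I P')

/-- The isomorphism `Φ* : T*(Q × Q) → T*Q × T*Q`, `(γ, δ) ↦ (-γ, δ)`. -/
def phiStar (P : CotangentBundle (I.prod I) (Q × Q)) : CotangentBundle I Q × CotangentBundle I Q :=
  (⟨P.proj.1, -covFst I P⟩, ⟨P.proj.2, covSnd I P⟩)

/-- The identification `Ψ : T*_p T*Q → A_p(T*(Q × Q)) ⊆ T_{ε̃(p)} T*(Q × Q)`,
`Ψ(w) = Λ♯(β̃* w)`, of `T*T*Q` with the Lie algebroid of the cotangent groupoid. Here `Λ` is the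
canonical Poisson structure of `T*(Q × Q)` and `β̃` the target map; recall `β̃(ε̃(p)) = p`. -/
def cotangentAlgebroid (p : CotangentBundle I Q) :
    Covector (cotModel I) p →L[ℝ]
      TangentSpace (cotModel (I.prod I)) ((cotangentPairGroupoid I Q).unit p) :=
  (poissonSharp (I.prod I) ((cotangentPairGroupoid I Q).unit p)).comp
    (ContinuousLinearMap.precomp ℝ
      (mfderiv (cotModel (I.prod I)) (cotModel I) (cotangentPairGroupoid I Q).tgt
        ((cotangentPairGroupoid I Q).unit p)))

/-- The identification `T_x M → A_x(M × M) ⊆ T_{(x, x)} (M × M)`, `v ↦ (0, v)`, of `TM` with the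
Lie algebroid of the pair groupoid. -/
def pairAlgebroid (x : Q) :
    TangentSpace I x →L[ℝ] TangentSpace (I.prod I) ((pairGroupoid Q).unit x) :=
  ContinuousLinearMap.inr ℝ E E

/-- `R̃ = T*R ∘ 𝓘 : T*T*Q → T*(Q × Q)`. -/
def groupoidCotangentLift (R : TangentBundle I Q → Q × Q)
    (w : CotangentBundle (cotModel I) (CotangentBundle I Q)) :
    CotangentBundle (I.prod I) (Q × Q) :=
  cotangentLift I.tangent (I.prod I) R (canonicalI I w)

/-- The domain of `R̃` for `R` defined on `U`. -/
def groupoidCotangentLiftDomain (U : Set (TangentBundle I Q)) (R : TangentBundle I Q → Q × Q) :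
    Set (CotangentBundle (cotModel I) (CotangentBundle I Q)) :=
  canonicalI I ⁻¹' cotangentLiftDomain I.tangent (I.prod I) R U

/-- `R^{T*} = Φ* ∘ T*R ∘ α⁻¹ : TT*Q → T*Q × T*Q`. -/
def pairCotangentLift (R : TangentBundle I Q → Q × Q)
    (ξ : TangentBundle (cotModel I) (CotangentBundle I Q)) :
    CotangentBundle I Q × CotangentBundle I Q :=
  phiStar I (cotangentLift I.tangent (I.prod I) R ((tulczyjew I).symm ξ))

/-- The domain of `R^{T*}` for `R` defined on `U`. -/
def pairCotangentLiftDomain (U : Set (TangentBundle I Q)) (R : TangentBundle I Q → Q × Q) :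
    Set (TangentBundle (cotModel I) (CotangentBundle I Q)) :=
  (tulczyjew I).symm ⁻¹' cotangentLiftDomain I.tangent (I.prod I) R U

end Pair

end CotangentLift

end

open CotangentLift

noncomputable section

namespace CotangentLift

set_option linter.unusedSectionVars false

/-! ### Shortcut instances

Instance search on `E × (E →L[ℝ] ℝ)` is slow without these. -/

section Shortcuts

variable (E : Type*) [NormedAddCommGroup E] [NormedSpace ℝ E]

lemma realIsScalarTower : IsScalarTower ℝ ℝ ℝ := IsScalarTower.left ℝ

lemma realSMulCommClass : SMulCommClass ℝ ℝ ℝ := Algebra.to_smulCommClass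

@[reducible] def phaseNormedAddCommGroup : NormedAddCommGroup (E × (E →L[ℝ] ℝ)) :=
  Prod.normedAddCommGroup

@[reducible] def phaseSeminormedAddCommGroup : SeminormedAddCommGroup (E × (E →L[ℝ] ℝ)) :=
  Prod.seminormedAddCommGroup

@[reducible] def phaseNormedSpace : NormedSpace ℝ (E × (E →L[ℝ] ℝ)) := Prod.normedSpace

@[reducible] def phaseTopologicalSpace : TopologicalSpace (E × (E →L[ℝ] ℝ)) :=
  instTopologicalSpaceProd

@[reducible] def phaseModule : Module ℝ (E × (E →L[ℝ] ℝ)) := Prod.instModule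

@[reducible] def phaseAddCommGroup : AddCommGroup (E × (E →L[ℝ] ℝ)) := Prod.instAddCommGroup

@[reducible] def phaseAddCommMonoid : AddCommMonoid (E × (E →L[ℝ] ℝ)) := Prod.instAddCommMonoid

end Shortcuts

attribute [local instance] realIsScalarTower realSMulCommClass phaseNormedAddCommGroup
  phaseSeminormedAddCommGroup phaseNormedSpace phaseTopologicalSpace phaseModule
  phaseAddCommGroup phaseAddCommMonoid

/-! ### Coordinates on tangent and cotangent bundles -/

section Coordinates

variable {E : Type*} [NormedAddCommGroup E] [NormedSpace ℝ E]
  {H : Type*} [TopologicalSpace H] (I : ModelWithCorners ℝ E H)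
  {M : Type*} [TopologicalSpace M] [ChartedSpace H M]

/-- The components of a covector in the preferred chart at its base point. -/
def covec {I : ModelWithCorners ℝ E H} (p : CotangentBundle I M) : E →L[ℝ] ℝ := p.2

/-- The components of a tangent vector in the preferred chart at its base point. -/
def vec {I : ModelWithCorners ℝ E H} (ξ : TangentBundle I M) : E := ξ.2

/-- The transition map from the preferred chart at `x` to the preferred chart at `y`. -/
def transition (x y : M) : E → E := extChartAt I y ∘ (extChartAt I x).symm

variable {I}

lemma transition_extChartAt {x y z : M} (hx : z ∈ (chartAt H x).source) :
    transition I x y (extChartAt I x z) = extChartAt I y z := by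
  simp only [transition, Function.comp_apply]
  rw [(extChartAt I x).left_inv (by rwa [extChartAt_source])]

/-- The coordinates of a point near `z` run through all vectors near the coordinates of `z`. -/
lemma eventually_extChartAt [I.Boundaryless] {x z : M} (hx : z ∈ (chartAt H x).source)
    {P : M → E → Prop} (h : ∀ᶠ y in nhds z, P y (extChartAt I x y)) :
    ∀ᶠ u in nhds (extChartAt I x z), P ((extChartAt I x).symm u) u := by
  have hx' : z ∈ (extChartAt I x).source := by rwa [extChartAt_source]
  have h1 : Filter.Tendsto (extChartAt I x).symm (nhds (extChartAt I x z)) (nhds z) := by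
    have := continuousAt_extChartAt_symm' (I := I) hx'
    rwa [ContinuousAt, (extChartAt I x).left_inv hx'] at this
  have h2 := extChartAt_target_mem_nhds' (I := I) ((extChartAt I x).map_source hx')
  filter_upwards [h1.eventually h, h2] with u hu hu2
  rwa [(extChartAt I x).right_inv hu2] at hu

section

variable [IsManifold I ∞ M]

lemma contDiffAt_transition [I.Boundaryless] {x y z : M} (hx : z ∈ (chartAt H x).source)
    (hy : z ∈ (chartAt H y).source) :
    ContDiffAt ℝ ∞ (transition I x y) (extChartAt I x z) := by
  have := contDiffWithinAt_ext_coord_change (I := I) (n := ∞) y x (y := extChartAt I x z) (by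
    rw [ext_coord_change_source]
    exact ⟨chartAt H x z, ⟨(chartAt H x).map_source hx, by
      simpa [(chartAt H x).left_inv hx] using hy⟩, rfl⟩)
  rwa [I.range_eq_univ, contDiffWithinAt_univ] at this

lemma tangentCoordChange_eq_fderiv [I.Boundaryless] (x y z : M) :
    tangentCoordChange I x y z = fderiv ℝ (transition I x y) (extChartAt I x z) := by
  rw [tangentCoordChange_def, I.range_eq_univ, fderivWithin_univ]; rfl

lemma hasFDerivAt_transition [I.Boundaryless] {x y z : M} (hx : z ∈ (chartAt H x).source)
    (hy : z ∈ (chartAt H y).source) :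
    HasFDerivAt (transition I x y) (tangentCoordChange I x y z) (extChartAt I x z) := by
  rw [tangentCoordChange_eq_fderiv]
  exact ((contDiffAt_transition hx hy).differentiableAt (by simp)).hasFDerivAt

lemma tangentCoordChange_self_eq {x z : M} (h : z ∈ (chartAt H x).source) :
    tangentCoordChange I x x z = ContinuousLinearMap.id ℝ E := by
  ext v
  exact tangentCoordChange_self (by rwa [extChartAt_source])

lemma tangentCoordChange_comp_eq {w x y z : M} (hw : z ∈ (chartAt H w).source)
    (hx : z ∈ (chartAt H x).source) (hy : z ∈ (chartAt H y).source) :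
    (tangentCoordChange I x y z).comp (tangentCoordChange I w x z) =
      tangentCoordChange I w y z := by
  ext v
  exact tangentCoordChange_comp (by simp only [extChartAt_source]; exact ⟨⟨hw, hx⟩, hy⟩)

lemma tangentCoordChange_comp_inv {x y z : M} (hx : z ∈ (chartAt H x).source)
    (hy : z ∈ (chartAt H y).source) :
    (tangentCoordChange I x y z).comp (tangentCoordChange I y x z) =
      ContinuousLinearMap.id ℝ E := by
  rw [tangentCoordChange_comp_eq hy hx hy, tangentCoordChange_self_eq hy]

lemma trivializationAt_tangent_snd (x : M) (ξ : TangentBundle I M) :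
    (trivializationAt E (TangentSpace I) x ξ).2 = tangentCoordChange I ξ.proj x ξ.proj (vec ξ) :=
  rfl

lemma trivializationAt_cotangent_snd (x : M) (p : CotangentBundle I M)
    (h : p.proj ∈ (chartAt H x).source) :
    (trivializationAt (E →L[ℝ] ℝ) (fun x : M => TangentSpace I x →L[ℝ] ℝ) x p).2 =
      (covec p).comp (tangentCoordChange I x p.proj p.proj) := by
  rw [hom_trivializationAt_apply]
  ext v
  simp only [ContinuousLinearMap.inCoordinates, ContinuousLinearMap.comp_apply]
  rw [TangentBundle.symmL_trivializationAt_eq_core h]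
  simp
  rfl

lemma extChartAt_tangent (ξ₀ ξ : TangentBundle I M) :
    extChartAt I.tangent ξ₀ ξ =
      (extChartAt I ξ₀.proj ξ.proj, tangentCoordChange I ξ.proj ξ₀.proj ξ.proj (vec ξ)) :=
  rfl

lemma extChartAt_cotangent (p₀ p : CotangentBundle I M)
    (h : p.proj ∈ (chartAt H p₀.proj).source) :
    extChartAt (cotModel I) p₀ p = (extChartAt I p₀.proj p.proj,
      (covec p).comp (tangentCoordChange I p₀.proj p.proj p.proj)) := by
  rw [← trivializationAt_cotangent_snd p₀.proj p h]
  rfl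

lemma mem_chartAt_cotangent (p₀ p : CotangentBundle I M) :
    p ∈ (chartAt (ModelProd H (E →L[ℝ] ℝ)) p₀).source ↔
      p.proj ∈ (chartAt H p₀.proj).source := by
  simp only [FiberBundle.chartedSpace_chartAt, mfld_simps]
  constructor
  · rintro ⟨h1, h2⟩; exact h2
  · intro h; refine ⟨?_, h⟩
    exact ⟨h, Set.mem_univ _⟩

lemma mem_chartAt_tangent (ξ₀ ξ : TangentBundle I M) :
    ξ ∈ (chartAt (ModelProd H E) ξ₀).source ↔ ξ.proj ∈ (chartAt H ξ₀.proj).source :=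
  TangentBundle.mem_chart_source_iff ..

end

end Coordinates

section Transitions

variable {E : Type*} [NormedAddCommGroup E] [NormedSpace ℝ E]
  {H : Type*} [TopologicalSpace H] {I : ModelWithCorners ℝ E H}
  {M : Type*} [TopologicalSpace M] [ChartedSpace H M] [IsManifold I ∞ M]

variable (I) in
/-- The second derivative at `z` of the transition map between the preferred charts at `x` and
at `y`. -/
def secondCoordChange (x y z : M) : E →L[ℝ] E →L[ℝ] E :=
  fderiv ℝ (fderiv ℝ (transition I x y)) (extChartAt I x z)

lemma eventually_mem_chartAt {x z : M} (hx : z ∈ (chartAt H x).source) :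
    ∀ᶠ y in nhds z, y ∈ (chartAt H x).source :=
  (chartAt H x).open_source.mem_nhds hx

lemma eventually_proj_mem_chartAt_tangent {x : M} {ξ : TangentBundle I M}
    (hx : ξ.proj ∈ (chartAt H x).source) : ∀ᶠ η in nhds ξ, η.proj ∈ (chartAt H x).source :=
  (FiberBundle.continuous_proj E (TangentSpace I : M → Type _)).continuousAt.eventually
    (eventually_mem_chartAt hx)

lemma eventually_proj_mem_chartAt_cotangent {x : M} {p : CotangentBundle I M}
    (hx : p.proj ∈ (chartAt H x).source) : ∀ᶠ η in nhds p, η.proj ∈ (chartAt H x).source :=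
  (FiberBundle.continuous_proj (E →L[ℝ] ℝ) (fun x : M => TangentSpace I x →L[ℝ] ℝ)
    ).continuousAt.eventually (eventually_mem_chartAt hx)

variable [I.Boundaryless]

lemma contDiffAt_fderiv_transition {x y z : M} (hx : z ∈ (chartAt H x).source)
    (hy : z ∈ (chartAt H y).source) :
    ContDiffAt ℝ ∞ (fderiv ℝ (transition I x y)) (extChartAt I x z) :=
  (contDiffAt_transition hx hy).fderiv_right (by simp)

lemma hasFDerivAt_fderiv_transition {x y z : M} (hx : z ∈ (chartAt H x).source)
    (hy : z ∈ (chartAt H y).source) :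
    HasFDerivAt (fderiv ℝ (transition I x y)) (secondCoordChange I x y z) (extChartAt I x z) :=
  ((contDiffAt_fderiv_transition hx hy).differentiableAt (by simp)).hasFDerivAt

lemma secondCoordChange_symm {x y z : M} (hx : z ∈ (chartAt H x).source)
    (hy : z ∈ (chartAt H y).source) (u v : E) :
    secondCoordChange I x y z u v = secondCoordChange I x y z v u :=
  ((contDiffAt_transition hx hy).isSymmSndFDerivAt
    (by rw [minSmoothness_of_isRCLikeNormedField]; exact ENat.LEInfty.out)) u v

lemma transition_tangent_eventuallyEq {ξ₀ ξ η : TangentBundle I M}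
    (h₀ : η.proj ∈ (chartAt H ξ₀.proj).source) (h : η.proj ∈ (chartAt H ξ.proj).source) :
    transition I.tangent ξ₀ ξ =ᶠ[nhds (extChartAt I.tangent ξ₀ η)] fun u : E × E =>
      (transition I ξ₀.proj ξ.proj u.1, fderiv ℝ (transition I ξ₀.proj ξ.proj) u.1 u.2) := by
  have h' : η ∈ (chartAt (ModelProd H E) ξ₀).source := (mem_chartAt_tangent ..).2 h₀
  refine eventually_extChartAt (I := I.tangent) h' (P := fun η u => extChartAt I.tangent ξ η =
    (transition I ξ₀.proj ξ.proj u.1, fderiv ℝ (transition I ξ₀.proj ξ.proj) u.1 u.2)) ?_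
  filter_upwards [eventually_proj_mem_chartAt_tangent h₀, eventually_proj_mem_chartAt_tangent h]
    with ζ h1 h2
  rw [extChartAt_tangent, extChartAt_tangent]
  simp only
  rw [transition_extChartAt h1, ← tangentCoordChange_eq_fderiv,
    ← ContinuousLinearMap.comp_apply, tangentCoordChange_comp_eq (mem_chart_source H ζ.proj) h1 h2]

lemma tangentCoordChange_tangent {ξ₀ ξ η : TangentBundle I M}
    (h₀ : η.proj ∈ (chartAt H ξ₀.proj).source) (h : η.proj ∈ (chartAt H ξ.proj).source)
    (u v : E) :
    tangentCoordChange I.tangent ξ₀ ξ η ((u, v) : E × E) =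
      (tangentCoordChange I ξ₀.proj ξ.proj η.proj u,
        secondCoordChange I ξ₀.proj ξ.proj η.proj u
          (tangentCoordChange I η.proj ξ₀.proj η.proj (vec η)) +
        tangentCoordChange I ξ₀.proj ξ.proj η.proj v) := by
  rw [tangentCoordChange_eq_fderiv, (transition_tangent_eventuallyEq h₀ h).fderiv_eq,
    extChartAt_tangent]
  set u₀ := extChartAt I ξ₀.proj η.proj with hu₀
  set w := tangentCoordChange I η.proj ξ₀.proj η.proj (vec η) with hw
  have e1 := (hasFDerivAt_transition (I := I) h₀ h).comp ((u₀, w) : E × E)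
    (hasFDerivAt_fst (𝕜 := ℝ) (E := E) (F := E))
  have e2 := ((hasFDerivAt_fderiv_transition (I := I) h₀ h).comp ((u₀, w) : E × E)
    (hasFDerivAt_fst (𝕜 := ℝ) (E := E) (F := E))).clm_apply
    (hasFDerivAt_snd (𝕜 := ℝ) (E := E) (F := E) (p := (u₀, w)))
  have e3 := (e1.prodMk e2).fderiv
  have hd : fderiv ℝ (transition I ξ₀.proj ξ.proj) u₀ =
    tangentCoordChange I ξ₀.proj ξ.proj η.proj := (tangentCoordChange_eq_fderiv ..).symm
  simp only [Function.comp_def, hd] at e3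
  rw [e3]
  simp [add_comm]

lemma transition_cotangent_eventuallyEq {p₀ p η : CotangentBundle I M}
    (h₀ : η.proj ∈ (chartAt H p₀.proj).source) (h : η.proj ∈ (chartAt H p.proj).source) :
    transition (cotModel I) p p₀ =ᶠ[nhds (extChartAt (cotModel I) p η)]
      fun u : E × (E →L[ℝ] ℝ) => (transition I p.proj p₀.proj u.1,
        u.2.comp (fderiv ℝ (transition I p₀.proj p.proj) (transition I p.proj p₀.proj u.1))) := by
  have h' : η ∈ (chartAt (ModelProd H (E →L[ℝ] ℝ)) p).source := (mem_chartAt_cotangent ..).2 h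
  refine eventually_extChartAt (I := cotModel I) h' (P := fun η u => extChartAt (cotModel I) p₀ η =
    (transition I p.proj p₀.proj u.1,
      u.2.comp (fderiv ℝ (transition I p₀.proj p.proj) (transition I p.proj p₀.proj u.1)))) ?_
  filter_upwards [eventually_proj_mem_chartAt_cotangent h₀,
    eventually_proj_mem_chartAt_cotangent h] with ζ h1 h2
  rw [extChartAt_cotangent _ _ h1, extChartAt_cotangent _ _ h2]
  simp only
  rw [transition_extChartAt h2, ← tangentCoordChange_eq_fderiv, ContinuousLinearMap.comp_assoc,
    tangentCoordChange_comp_eq h1 h2 (mem_chart_source H ζ.proj)]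

lemma tangentCoordChange_cotangent {p₀ p η : CotangentBundle I M}
    (h₀ : η.proj ∈ (chartAt H p₀.proj).source) (h : η.proj ∈ (chartAt H p.proj).source)
    (a : E) (b : E →L[ℝ] ℝ) :
    tangentCoordChange (cotModel I) p p₀ η ((a, b) : E × (E →L[ℝ] ℝ)) =
      (tangentCoordChange I p.proj p₀.proj η.proj a,
        b.comp (tangentCoordChange I p₀.proj p.proj η.proj) +
        ((covec η).comp (tangentCoordChange I p.proj η.proj η.proj)).comp
          (secondCoordChange I p₀.proj p.proj η.proj
            (tangentCoordChange I p.proj p₀.proj η.proj a))) := by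
  rw [tangentCoordChange_eq_fderiv, (transition_cotangent_eventuallyEq h₀ h).fderiv_eq,
    extChartAt_cotangent _ _ h]
  set u₀ := extChartAt I p.proj η.proj with hu₀
  set w := (covec η).comp (tangentCoordChange I p.proj η.proj η.proj) with hw
  have e0 := hasFDerivAt_fderiv_transition (I := I) h₀ h
  rw [← transition_extChartAt (I := I) (y := p₀.proj) h] at e0
  have e1 := (hasFDerivAt_transition (I := I) h h₀).comp ((u₀, w) : E × (E →L[ℝ] ℝ))
    (hasFDerivAt_fst (𝕜 := ℝ) (E := E) (F := E →L[ℝ] ℝ))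
  have e2 := (hasFDerivAt_snd (𝕜 := ℝ) (E := E) (F := E →L[ℝ] ℝ) (p := (u₀, w))).clm_comp
    (e0.comp ((u₀, w) : E × (E →L[ℝ] ℝ)) e1)
  have e3 := (e1.prodMk e2).fderiv
  have hd : fderiv ℝ (transition I p₀.proj p.proj) (transition I p.proj p₀.proj u₀) =
      tangentCoordChange I p₀.proj p.proj η.proj := by
    rw [hu₀, transition_extChartAt h, tangentCoordChange_eq_fderiv]
  simp only [Function.comp_def, hd] at e3
  rw [e3]
  ext v
  · simp
  · simp [add_comm]

end Transitions

section Tulczyjew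

variable {E : Type*} [NormedAddCommGroup E] [NormedSpace ℝ E]
  {H : Type*} [TopologicalSpace H] {I : ModelWithCorners ℝ E H}
  {M : Type*} [TopologicalSpace M] [ChartedSpace H M] [IsManifold I ∞ M]

lemma proj_tulczyjew_symm (ξ : TangentBundle (cotModel I) (CotangentBundle I M)) :
    ((tulczyjew I).symm ξ).proj = ⟨ξ.proj.proj, (vec ξ).1⟩ := rfl

lemma covec_tulczyjew_symm (ξ : TangentBundle (cotModel I) (CotangentBundle I M)) :
    covec ((tulczyjew I).symm ξ) = ((vec ξ).2.coprod (covec ξ.proj) : E × E →L[ℝ] ℝ) := rfl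

variable [I.Boundaryless]

/-- In the charts induced by one chart of `M`, the inverse of Tulczyjew's isomorphism is
`(q, p; a, b) ↦ (q, a; b, p)`: the fibre coordinates. -/
lemma trivializationAt_tulczyjew_symm_snd (ξ₀ ξ : TangentBundle (cotModel I) (CotangentBundle I M))
    (h : ξ.proj.proj ∈ (chartAt H ξ₀.proj.proj).source) :
    (trivializationAt (E × E →L[ℝ] ℝ)
      (fun x : TangentBundle I M => TangentSpace I.tangent x →L[ℝ] ℝ)
      ((tulczyjew I).symm ξ₀).proj ((tulczyjew I).symm ξ)).2 =
    ((extChartAt (cotModel I).tangent ξ₀ ξ).2.2.coprod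
      (extChartAt (cotModel I).tangent ξ₀ ξ).1.2 : E × E →L[ℝ] ℝ) := by
  have hξ := mem_chart_source H ξ.proj.proj
  rw [trivializationAt_cotangent_snd _ _ ((mem_chartAt_tangent ..).2 h), extChartAt_tangent,
    extChartAt_cotangent _ _ h]
  simp only
  obtain ⟨a, b, hab⟩ : ∃ a b, vec ξ = ((a, b) : E × (E →L[ℝ] ℝ)) := ⟨_, _, rfl⟩
  rw [hab, tangentCoordChange_cotangent h hξ]
  refine ContinuousLinearMap.ext fun ⟨u, v⟩ => ?_
  rw [ContinuousLinearMap.comp_apply]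
  erw [tangentCoordChange_tangent (ξ₀ := ((tulczyjew I).symm ξ₀).proj)
    (ξ := ((tulczyjew I).symm ξ).proj) (η := ((tulczyjew I).symm ξ).proj) h hξ u v]
  rw [covec_tulczyjew_symm]
  have ha : Prod.fst (α := E) (β := E →L[ℝ] ℝ) ξ.2 = a := congrArg Prod.fst hab
  have hb : Prod.snd (α := E) (β := E →L[ℝ] ℝ) ξ.2 = b := congrArg Prod.snd hab
  simp only [proj_tulczyjew_symm, vec, ha, hb, tangentCoordChange_self_eq hξ,
    ContinuousLinearMap.coprod_apply, add_apply,
    ContinuousLinearMap.comp_apply, ContinuousLinearMap.id_apply, map_add,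
    secondCoordChange_symm h hξ u, add_assoc]

theorem contMDiff_tulczyjew_symm :
    ContMDiff (cotModel I).tangent (cotModel I.tangent) ∞
      ((tulczyjew I).symm : TangentBundle (cotModel I) (CotangentBundle I M) → _) := by
  intro ξ₀
  have hX : ContMDiffAt (cotModel I).tangent 𝓘(ℝ, (E × (E →L[ℝ] ℝ)) × (E × (E →L[ℝ] ℝ))) ∞
    (extChartAt (cotModel I).tangent ξ₀) ξ₀ := contMDiffAt_extChartAt
  have hev : ∀ᶠ ξ in nhds ξ₀, ξ.proj.proj ∈ (chartAt H ξ₀.proj.proj).source :=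
    (FiberBundle.continuous_proj _
      (TangentSpace (cotModel I) : CotangentBundle I M → Type _)).continuousAt.eventually
      (eventually_proj_mem_chartAt_cotangent (mem_chart_source H _))
  refine contMDiffAt_totalSpace.2 ⟨contMDiffAt_totalSpace.2 ⟨?_, ?_⟩, ?_⟩
  · exact ((contMDiff_proj (fun x : M => TangentSpace I x →L[ℝ] ℝ)).comp
      (contMDiff_proj (TangentSpace (cotModel I) : CotangentBundle I M → Type _))).contMDiffAt
  · have h1 : ContDiff ℝ ∞ fun x : (E × (E →L[ℝ] ℝ)) × (E × (E →L[ℝ] ℝ)) => x.2.1 := by fun_prop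
    refine (h1.contMDiff.contMDiffAt.comp ξ₀ hX).congr_of_eventuallyEq ?_
    filter_upwards [hev] with ξ h
    simp only [Function.comp_apply]
    rw [extChartAt_tangent]
    obtain ⟨a, b, hab⟩ : ∃ a b, vec ξ = ((a, b) : E × (E →L[ℝ] ℝ)) := ⟨_, _, rfl⟩
    rw [hab, tangentCoordChange_cotangent h (mem_chart_source H _), trivializationAt_tangent_snd,
      proj_tulczyjew_symm, hab]
    rfl
  · have h1 : ContDiff ℝ ∞ fun x : (E × (E →L[ℝ] ℝ)) × (E × (E →L[ℝ] ℝ)) =>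
        x.2.2.comp (ContinuousLinearMap.fst ℝ E E) +
          x.1.2.comp (ContinuousLinearMap.snd ℝ E E) := by fun_prop
    refine (h1.contMDiff.contMDiffAt.comp ξ₀ hX).congr_of_eventuallyEq ?_
    filter_upwards [hev] with ξ h
    rw [trivializationAt_tulczyjew_symm_snd ξ₀ ξ h]
    ext <;> simp

end Tulczyjew

/-! ### The canonical symplectic form in coordinates -/

section ExtDeriv

variable {E : Type*} [NormedAddCommGroup E] [NormedSpace ℝ E]
  {H : Type*} [TopologicalSpace H] {I : ModelWithCorners ℝ E H}
  {M : Type*} [TopologicalSpace M] [ChartedSpace H M] [IsManifold I ∞ M] [I.Boundaryless]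

lemma hasMFDerivAt_extChartAt_symm {x z : M} (h : z ∈ (chartAt H x).source) :
    HasMFDerivAt 𝓘(ℝ, E) I (extChartAt I x).symm (extChartAt I x z)
      (tangentCoordChange I x z z : E →L[ℝ] E) := by
  have hx : z ∈ (extChartAt I x).source := by rwa [extChartAt_source]
  have hz : (extChartAt I x).symm (extChartAt I x z) = z := (extChartAt I x).left_inv hx
  refine ⟨continuousAt_extChartAt_symm' hx, ?_⟩
  have := hasFDerivAt_transition (I := I) h (mem_chart_source H z)
  rw [writtenInExtChartAt, hz]
  exact this.hasFDerivWithinAt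

lemma mfderiv_extChartAt_symm {x z : M} (h : z ∈ (chartAt H x).source) :
    (mfderiv 𝓘(ℝ, E) I (extChartAt I x).symm (extChartAt I x z) : E →L[ℝ] E) =
      tangentCoordChange I x z z :=
  (hasMFDerivAt_extChartAt_symm h).mfderiv

lemma oneFormInChart_extChartAt (θ : ∀ y : M, TangentSpace I y →L[ℝ] ℝ) {x z : M}
    (h : z ∈ (chartAt H x).source) :
    oneFormInChart I θ x (extChartAt I x z) =
      (show E →L[ℝ] ℝ from θ z).comp (tangentCoordChange I x z z) := by
  have hz : (extChartAt I x).symm (extChartAt I x z) = z :=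
    (extChartAt I x).left_inv (by rwa [extChartAt_source])
  rw [oneFormInChart, mfderiv_extChartAt_symm h]
  have key : ∀ y, y = z → (show E →L[ℝ] ℝ from θ y).comp (tangentCoordChange I x z z) =
    (show E →L[ℝ] ℝ from θ z).comp (tangentCoordChange I x z z) := by rintro _ rfl; rfl
  exact key _ hz

/-- Change of coordinates for the exterior derivative of a one-form. -/
lemma extDerivOneForm_eq_of_chart (θ : ∀ y : M, TangentSpace I y →L[ℝ] ℝ) {x y : M}
    (h : x ∈ (chartAt H y).source)
    (hθ : DifferentiableAt ℝ (oneFormInChart I θ y) (extChartAt I y x)) (u v : E) :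
    (extDerivOneForm I θ x : E →L[ℝ] E →L[ℝ] ℝ) u v =
      fderiv ℝ (oneFormInChart I θ y) (extChartAt I y x) (tangentCoordChange I x y x u)
        (tangentCoordChange I x y x v) -
      fderiv ℝ (oneFormInChart I θ y) (extChartAt I y x) (tangentCoordChange I x y x v)
        (tangentCoordChange I x y x u) := by
  have hx := mem_chart_source H x
  have hev : oneFormInChart I θ x =ᶠ[nhds (extChartAt I x x)] fun u =>
      (oneFormInChart I θ y (transition I x y u)).comp (fderiv ℝ (transition I x y) u) := by
    refine eventually_extChartAt hx (P := fun _ u => oneFormInChart I θ x u =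
      (oneFormInChart I θ y (transition I x y u)).comp (fderiv ℝ (transition I x y) u)) ?_
    filter_upwards [eventually_mem_chartAt hx, eventually_mem_chartAt h] with z h1 h2
    rw [transition_extChartAt h1, oneFormInChart_extChartAt _ h1, oneFormInChart_extChartAt _ h2,
      ← tangentCoordChange_eq_fderiv, ContinuousLinearMap.comp_assoc,
      tangentCoordChange_comp_eq h1 h2 (mem_chart_source H z)]
  have e1 := hasFDerivAt_transition (I := I) hx h
  have e2 := hasFDerivAt_fderiv_transition (I := I) hx h
  have e3 := hθ.hasFDerivAt
  rw [← transition_extChartAt (x := x) (I := I) (y := y) hx] at e3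
  have e4 := ((e3.comp _ e1).clm_comp e2).fderiv
  simp only [Function.comp_def] at e4
  have hd : fderiv ℝ (transition I x y) (extChartAt I x x) =
    tangentCoordChange I x y x := (tangentCoordChange_eq_fderiv ..).symm
  change (fderiv ℝ (oneFormInChart I θ x) (extChartAt I x x) -
    (fderiv ℝ (oneFormInChart I θ x) (extChartAt I x x)).flip) u v = _
  rw [hev.fderiv_eq, e4, hd, transition_extChartAt hx]
  simp only [sub_apply, add_apply, ContinuousLinearMap.comp_apply, ContinuousLinearMap.flip_apply,
    ContinuousLinearMap.compL_apply, secondCoordChange_symm hx h v u]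
  abel

end ExtDeriv

lemma hasFDerivAt_of_eventuallyEq {X Y : Type*} [NormedAddCommGroup X] [NormedSpace ℝ X]
    [NormedAddCommGroup Y] [NormedSpace ℝ Y] {f : X → Y} {x : X} (B : X →L[ℝ] Y)
    (h : f =ᶠ[nhds x] B) : HasFDerivAt f B x :=
  B.hasFDerivAt.congr_of_eventuallyEq h

section Symplectic

variable {E : Type*} [NormedAddCommGroup E] [NormedSpace ℝ E]
  {H : Type*} [TopologicalSpace H] {I : ModelWithCorners ℝ E H}
  {M : Type*} [TopologicalSpace M] [ChartedSpace H M] [IsManifold I ∞ M] [I.Boundaryless]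

lemma mfderiv_cotangent_proj (p : CotangentBundle I M) :
    (mfderiv (cotModel I) I (fun p' : CotangentBundle I M => p'.proj) p :
      E × (E →L[ℝ] ℝ) →L[ℝ] E) = ContinuousLinearMap.fst ℝ E (E →L[ℝ] ℝ) := by
  refine HasMFDerivAt.mfderiv ⟨(FiberBundle.continuous_proj (E →L[ℝ] ℝ)
    (fun x : M => TangentSpace I x →L[ℝ] ℝ)).continuousAt, ?_⟩
  have hp : p ∈ (chartAt (ModelProd H (E →L[ℝ] ℝ)) p).source := mem_chart_source _ p
  have hev : writtenInExtChartAt (cotModel I) I p (fun p' : CotangentBundle I M => p'.proj)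
      =ᶠ[nhds (extChartAt (cotModel I) p p)] Prod.fst := by
    refine eventually_extChartAt (I := cotModel I) hp
      (P := fun η u => extChartAt I p.proj η.proj = u.1) (Filter.Eventually.of_forall fun η => ?_)
    rfl
  exact (hasFDerivAt_fst.congr_of_eventuallyEq hev).hasFDerivWithinAt

lemma oneFormInChart_liouvilleForm_eventuallyEq {p₀ p : CotangentBundle I M}
    (h : p.proj ∈ (chartAt H p₀.proj).source) :
    oneFormInChart (cotModel I) (fun p' : CotangentBundle I M => liouvilleForm I p') p₀
      =ᶠ[nhds (extChartAt (cotModel I) p₀ p)]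
    fun u : E × (E →L[ℝ] ℝ) => u.2.comp (ContinuousLinearMap.fst ℝ E (E →L[ℝ] ℝ)) := by
  have hp : p ∈ (chartAt (ModelProd H (E →L[ℝ] ℝ)) p₀).source := (mem_chartAt_cotangent ..).2 h
  refine eventually_extChartAt (I := cotModel I) hp
      (P := fun η u => oneFormInChart (cotModel I)
        (fun p' : CotangentBundle I M => liouvilleForm I p') p₀ u =
        u.2.comp (ContinuousLinearMap.fst ℝ E (E →L[ℝ] ℝ))) ?_
  filter_upwards [eventually_proj_mem_chartAt_cotangent h] with η h1
  rw [oneFormInChart_extChartAt _ ((mem_chartAt_cotangent ..).2 h1), extChartAt_cotangent _ _ h1]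
  refine ContinuousLinearMap.ext fun ⟨a, b⟩ => ?_
  rw [ContinuousLinearMap.comp_apply,
    tangentCoordChange_cotangent (mem_chart_source H η.proj) h1]
  change covec η ((mfderiv (cotModel I) I (fun p' : CotangentBundle I M => p'.proj) η :
      E × (E →L[ℝ] ℝ) →L[ℝ] E) _) = _
  rw [mfderiv_cotangent_proj]
  rfl

variable (E) in
/-- The canonical symplectic form `(a, b), (a', b') ↦ b'(a) - b(a')` of `E × E*`. -/
def modelSymplectic : E × (E →L[ℝ] ℝ) →L[ℝ] E × (E →L[ℝ] ℝ) →L[ℝ] ℝ :=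
  let B : E × (E →L[ℝ] ℝ) →L[ℝ] E × (E →L[ℝ] ℝ) →L[ℝ] ℝ :=
    ((ContinuousLinearMap.compL ℝ (E × (E →L[ℝ] ℝ)) E ℝ).flip
      (ContinuousLinearMap.fst ℝ E (E →L[ℝ] ℝ))).comp (ContinuousLinearMap.snd ℝ E (E →L[ℝ] ℝ))
  B.flip - B

@[simp]
lemma modelSymplectic_apply (x y : E × (E →L[ℝ] ℝ)) :
    modelSymplectic E x y = y.2 x.1 - x.2 y.1 := rfl

/-- The canonical symplectic form at `p` in the preferred chart at `p`. -/
def symplecticAt (p : CotangentBundle I M) : E × (E →L[ℝ] ℝ) →L[ℝ] E × (E →L[ℝ] ℝ) →L[ℝ] ℝ :=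
  canonicalSymplectic I p

set_option synthInstance.maxHeartbeats 200000 in
/-- In the chart induced by a chart of `M`, the canonical symplectic form is `dqⁱ ∧ dpᵢ`. -/
lemma symplecticAt_apply_of_chart {p₀ p : CotangentBundle I M}
    (h : p.proj ∈ (chartAt H p₀.proj).source) (x y : E × (E →L[ℝ] ℝ)) :
    symplecticAt p x y =
      modelSymplectic E (tangentCoordChange (cotModel I) p p₀ p x)
        (tangentCoordChange (cotModel I) p p₀ p y) := by
  have hp : p ∈ (chartAt (ModelProd H (E →L[ℝ] ℝ)) p₀).source := (mem_chartAt_cotangent ..).2 h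
  set B : E × (E →L[ℝ] ℝ) →L[ℝ] E × (E →L[ℝ] ℝ) →L[ℝ] ℝ :=
    ((ContinuousLinearMap.compL ℝ (E × (E →L[ℝ] ℝ)) E ℝ).flip
      (ContinuousLinearMap.fst ℝ E (E →L[ℝ] ℝ))).comp (ContinuousLinearMap.snd ℝ E (E →L[ℝ] ℝ))
    with hB
  have hev := oneFormInChart_liouvilleForm_eventuallyEq h
  have hd : HasFDerivAt (oneFormInChart (cotModel I)
      (fun p' : CotangentBundle I M => liouvilleForm I p') p₀) B (extChartAt (cotModel I) p₀ p) :=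
    hasFDerivAt_of_eventuallyEq (X := E × (E →L[ℝ] ℝ)) (Y := E × (E →L[ℝ] ℝ) →L[ℝ] ℝ) B hev
  have := extDerivOneForm_eq_of_chart (I := cotModel I)
    (fun p' : CotangentBundle I M => liouvilleForm I p') hp hd.differentiableAt x y
  rw [hd.fderiv] at this
  refine (congrArg Neg.neg this).trans ?_
  rw [neg_sub]
  rfl

lemma symplecticAt_eq (p : CotangentBundle I M) :
    symplecticAt p = modelSymplectic E := by
  refine ContinuousLinearMap.ext fun x => ContinuousLinearMap.ext fun y => ?_
  rw [symplecticAt_apply_of_chart (mem_chart_source H p.proj),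
    tangentCoordChange_self_eq (mem_chart_source _ p)]
  rfl

end Symplectic

section ModelSharp

variable (E : Type*) [NormedAddCommGroup E] [NormedSpace ℝ E]

lemma modelSymplectic_injective : Function.Injective (modelSymplectic E) := by
  refine (injective_iff_map_eq_zero _).2 fun x hx => ?_
  have h (y : E × (E →L[ℝ] ℝ)) : y.2 x.1 - x.2 y.1 = 0 := by
    rw [← modelSymplectic_apply, hx]; rfl
  refine Prod.ext ?_ ?_
  · refine SeparatingDual.eq_zero_of_forall_dual_eq_zero (R := ℝ) fun f => ?_
    simpa using h (0, f)
  · refine ContinuousLinearMap.ext fun v => ?_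
    simpa using h (v, 0)

variable [FiniteDimensional ℝ E]

/-- The canonical symplectic form of `E × E*` as an isomorphism onto the dual space. -/
def modelFlat : (E × (E →L[ℝ] ℝ)) ≃L[ℝ] (E × (E →L[ℝ] ℝ) →L[ℝ] ℝ) :=
  (LinearEquiv.ofInjectiveOfFinrankEq (modelSymplectic E).toLinearMap
    (modelSymplectic_injective E) (by
      have h (V : Type _) [NormedAddCommGroup V] [NormedSpace ℝ V] [FiniteDimensional ℝ V] :
          Module.finrank ℝ V = Module.finrank ℝ (V →L[ℝ] ℝ) := by
        rw [← (LinearMap.toContinuousLinearMap (𝕜 := ℝ) (E := V) (F' := ℝ)).finrank_eq]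
        exact (Subspace.dual_finrank_eq (K := ℝ) (V := V)).symm
      exact h _)).toContinuousLinearEquiv

lemma modelFlat_apply (x : E × (E →L[ℝ] ℝ)) : modelFlat E x = modelSymplectic E x := rfl

lemma isInvertible_inclusionInDoubleDual :
    (NormedSpace.inclusionInDoubleDual ℝ E).IsInvertible := by
  have hinj : Function.Injective (NormedSpace.inclusionInDoubleDual ℝ E) := by
    refine (injective_iff_map_eq_zero _).2 fun x hx => ?_
    refine SeparatingDual.eq_zero_of_forall_dual_eq_zero (R := ℝ) fun f => ?_
    rw [← NormedSpace.dual_def, hx]; rfl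
  have h (V : Type _) [NormedAddCommGroup V] [NormedSpace ℝ V] [FiniteDimensional ℝ V] :
      Module.finrank ℝ V = Module.finrank ℝ (V →L[ℝ] ℝ) := by
    rw [← (LinearMap.toContinuousLinearMap (𝕜 := ℝ) (E := V) (F' := ℝ)).finrank_eq]
    exact (Subspace.dual_finrank_eq (K := ℝ) (V := V)).symm
  exact ⟨(LinearEquiv.ofInjectiveOfFinrankEq
    (NormedSpace.inclusionInDoubleDual ℝ E).toLinearMap hinj
    ((h E).trans (h (E →L[ℝ] ℝ)))).toContinuousLinearEquiv, rfl⟩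

lemma inclusionInDoubleDual_inverse_apply (f : (E →L[ℝ] ℝ) →L[ℝ] ℝ) (g : E →L[ℝ] ℝ) :
    g ((NormedSpace.inclusionInDoubleDual ℝ E).inverse f) = f g := by
  rw [← NormedSpace.dual_def, (isInvertible_inclusionInDoubleDual E).self_apply_inverse]

lemma modelFlat_symm_apply (w : E × (E →L[ℝ] ℝ) →L[ℝ] ℝ) :
    (modelFlat E).symm w =
      ((NormedSpace.inclusionInDoubleDual ℝ E).inverse
        (w.comp (ContinuousLinearMap.inr ℝ E (E →L[ℝ] ℝ))),
      -(w.comp (ContinuousLinearMap.inl ℝ E (E →L[ℝ] ℝ)))) := by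
  rw [ContinuousLinearEquiv.symm_apply_eq]
  refine ContinuousLinearMap.ext fun ⟨a, b⟩ => ?_
  rw [modelFlat_apply, modelSymplectic_apply]
  simp only [inclusionInDoubleDual_inverse_apply]
  simp [← map_add]

end ModelSharp

section Sharp

variable {E : Type*} [NormedAddCommGroup E] [NormedSpace ℝ E] [FiniteDimensional ℝ E]
  {H : Type*} [TopologicalSpace H] {I : ModelWithCorners ℝ E H}
  {M : Type*} [TopologicalSpace M] [ChartedSpace H M] [IsManifold I ∞ M] [I.Boundaryless]

/-- The map `Λ♯` at `p` in the preferred chart at `p`. -/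
def sharpAt (p : CotangentBundle I M) : (E × (E →L[ℝ] ℝ) →L[ℝ] ℝ) →L[ℝ] E × (E →L[ℝ] ℝ) :=
  poissonSharp I p

lemma sharpAt_eq (p : CotangentBundle I M) :
    sharpAt p = ((modelFlat E).symm : (E × (E →L[ℝ] ℝ) →L[ℝ] ℝ) →L[ℝ] E × (E →L[ℝ] ℝ)) := by
  change (symplecticAt p).inverse = _
  rw [symplecticAt_eq]
  exact ContinuousLinearMap.inverse_equiv (modelFlat E)

lemma sharpAt_apply (p : CotangentBundle I M) (w : E × (E →L[ℝ] ℝ) →L[ℝ] ℝ) :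
    sharpAt p w = (modelFlat E).symm w := by
  rw [sharpAt_eq]; rfl

lemma symplecticAt_sharpAt (p : CotangentBundle I M) (w : E × (E →L[ℝ] ℝ) →L[ℝ] ℝ) :
    symplecticAt p (sharpAt p w) = w := by
  rw [symplecticAt_eq, sharpAt_apply]
  exact (modelFlat E).apply_symm_apply w

lemma sharpAt_symplecticAt (p : CotangentBundle I M) (x : E × (E →L[ℝ] ℝ)) :
    sharpAt p (symplecticAt p x) = x := by
  rw [symplecticAt_eq, sharpAt_apply]
  exact (modelFlat E).symm_apply_apply x

/-- The map `Λ♯ : T*T*M → TT*M`. -/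
def sharpMap (w : CotangentBundle (cotModel I) (CotangentBundle I M)) :
    TangentBundle (cotModel I) (CotangentBundle I M) :=
  ⟨w.proj, poissonSharp I w.proj w.2⟩

/-- The map `X ↦ i_X ω`, from `TT*M` to `T*T*M`. -/
def flatMap (ξ : TangentBundle (cotModel I) (CotangentBundle I M)) :
    CotangentBundle (cotModel I) (CotangentBundle I M) :=
  ⟨ξ.proj, symplecticAt ξ.proj ξ.2⟩

lemma flatMap_sharpMap (w : CotangentBundle (cotModel I) (CotangentBundle I M)) :
    flatMap (sharpMap w) = w :=
  congrArg (TotalSpace.mk w.proj) (symplecticAt_sharpAt w.proj w.2)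

lemma sharpMap_flatMap (ξ : TangentBundle (cotModel I) (CotangentBundle I M)) :
    sharpMap (flatMap ξ) = ξ :=
  congrArg (TotalSpace.mk ξ.proj) (sharpAt_symplecticAt ξ.proj ξ.2)

/-- The relation `𝓘 = α⁻¹ ∘ Λ♯`. -/
lemma canonicalI_eq (w : CotangentBundle (cotModel I) (CotangentBundle I M)) :
    canonicalI I w = (tulczyjew I).symm (sharpMap w) := by
  have h : sharpAt w.proj (covec w) = _ := (sharpAt_apply _ _).trans (modelFlat_symm_apply E _)
  exact (congrArg (fun x => (tulczyjew I).symm ⟨w.proj, x⟩) h).symm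

lemma trivializationAt_flatMap_snd (ξ₀ ξ : TangentBundle (cotModel I) (CotangentBundle I M))
    (h : ξ.proj.proj ∈ (chartAt H ξ₀.proj.proj).source) :
    (trivializationAt (E × (E →L[ℝ] ℝ) →L[ℝ] ℝ)
      (fun p : CotangentBundle I M => TangentSpace (cotModel I) p →L[ℝ] ℝ)
      ξ₀.proj (flatMap ξ)).2 =
    modelFlat E (trivializationAt (E × (E →L[ℝ] ℝ))
      (TangentSpace (cotModel I) : CotangentBundle I M → Type _) ξ₀.proj ξ).2 := by
  have h' : ξ.proj ∈ (chartAt (ModelProd H (E →L[ℝ] ℝ)) ξ₀.proj).source :=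
    (mem_chartAt_cotangent ..).2 h
  rw [trivializationAt_cotangent_snd _ _ h', trivializationAt_tangent_snd]
  refine ContinuousLinearMap.ext fun y => ?_
  change symplecticAt ξ.proj (vec ξ) _ = modelSymplectic E _ _
  rw [symplecticAt_apply_of_chart h]
  change modelSymplectic E _ (((tangentCoordChange (cotModel I) ξ.proj ξ₀.proj ξ.proj).comp
    (tangentCoordChange (cotModel I) ξ₀.proj ξ.proj ξ.proj)) y) = _
  rw [tangentCoordChange_comp_inv (mem_chart_source _ ξ.proj) h']
  rfl

lemma contMDiff_flatMap :
    ContMDiff (cotModel I).tangent (cotModel (cotModel I)) ∞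
      (flatMap : TangentBundle (cotModel I) (CotangentBundle I M) → _) := by
  intro ξ₀
  have hev : ∀ᶠ ξ in nhds ξ₀, ξ.proj.proj ∈ (chartAt H ξ₀.proj.proj).source :=
    (FiberBundle.continuous_proj _
      (TangentSpace (cotModel I) : CotangentBundle I M → Type _)).continuousAt.eventually
      (eventually_proj_mem_chartAt_cotangent (mem_chart_source H _))
  refine contMDiffAt_totalSpace.2 ⟨(contMDiff_proj _).contMDiffAt, ?_⟩
  refine (((modelFlat E).contDiff.contMDiff.contMDiffAt).comp ξ₀
    (contMDiffAt_totalSpace.1 (contMDiffAt_id (x := ξ₀))).2).congr_of_eventuallyEq ?_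
  filter_upwards [hev] with ξ h
  exact trivializationAt_flatMap_snd ξ₀ ξ h

lemma contMDiff_sharpMap :
    ContMDiff (cotModel (cotModel I)) (cotModel I).tangent ∞
      (sharpMap : CotangentBundle (cotModel I) (CotangentBundle I M) → _) := by
  intro w₀
  have hev : ∀ᶠ w in nhds w₀, w.proj.proj ∈ (chartAt H w₀.proj.proj).source :=
    (FiberBundle.continuous_proj _
      (fun p : CotangentBundle I M => TangentSpace (cotModel I) p →L[ℝ] ℝ)
      ).continuousAt.eventually (eventually_proj_mem_chartAt_cotangent (mem_chart_source H _))
  refine contMDiffAt_totalSpace.2 ⟨(contMDiff_proj _).contMDiffAt, ?_⟩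
  refine (((modelFlat E).symm.contDiff.contMDiff.contMDiffAt).comp w₀
    (contMDiffAt_totalSpace.1 (contMDiffAt_id (x := w₀))).2).congr_of_eventuallyEq ?_
  filter_upwards [hev] with w h
  have := trivializationAt_flatMap_snd (sharpMap w₀) (sharpMap w) h
  rw [flatMap_sharpMap] at this
  exact ((modelFlat E).symm_apply_eq.2 this).symm

variable (I M) in
/-- The diffeomorphism `Λ♯ : T*T*M → TT*M`. -/
def sharpDiffeomorph : CotangentBundle (cotModel I) (CotangentBundle I M)
    ≃ₘ^∞⟮cotModel (cotModel I), (cotModel I).tangent⟯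
      TangentBundle (cotModel I) (CotangentBundle I M) where
  toFun := sharpMap
  invFun := flatMap
  left_inv := flatMap_sharpMap
  right_inv := sharpMap_flatMap
  contMDiff_toFun := contMDiff_sharpMap
  contMDiff_invFun := contMDiff_flatMap

end Sharp

/-! ### The isomorphism `Φ*` -/

section LinearInCharts

variable {E : Type*} [NormedAddCommGroup E] [NormedSpace ℝ E]
  {H : Type*} [TopologicalSpace H] {I : ModelWithCorners ℝ E H}
  {M : Type*} [TopologicalSpace M] [ChartedSpace H M]
  {E' : Type*} [NormedAddCommGroup E'] [NormedSpace ℝ E']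
  {H' : Type*} [TopologicalSpace H'] {I' : ModelWithCorners ℝ E' H'}
  {N : Type*} [TopologicalSpace N] [ChartedSpace H' N] [I.Boundaryless]

/-- A map which is linear in the preferred charts is its own derivative. -/
lemma hasMFDerivAt_of_eventually_extChartAt {f : M → N} {x : M} (B : E →L[ℝ] E')
    (hc : ContinuousAt f x)
    (h : ∀ᶠ y in nhds x, extChartAt I' (f x) (f y) = B (extChartAt I x y)) :
    HasMFDerivAt I I' f x B := by
  refine ⟨hc, ?_⟩
  have := eventually_extChartAt (I := I) (mem_chart_source H x)
    (P := fun y u => extChartAt I' (f x) (f y) = B u) h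
  exact (hasFDerivAt_of_eventuallyEq B this).hasFDerivWithinAt

end LinearInCharts

section PhiStar

variable {E : Type*} [NormedAddCommGroup E] [NormedSpace ℝ E]
  {H : Type*} [TopologicalSpace H] {I : ModelWithCorners ℝ E H}
  {Q : Type*} [TopologicalSpace Q] [ChartedSpace H Q]

variable (I) in
/-- The inverse `(p, p') ↦ (-p, p')` of `Φ*`. -/
def phiStarInv (P : CotangentBundle I Q × CotangentBundle I Q) :
    CotangentBundle (I.prod I) (Q × Q) :=
  covPair I (-P.1.2) P.2.2

lemma phiStarInv_phiStar (P : CotangentBundle (I.prod I) (Q × Q)) :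
    phiStarInv I (phiStar I P) = P := by
  refine congrArg (TotalSpace.mk P.proj) ?_
  change ((-(-((covec P).comp (ContinuousLinearMap.inl ℝ E E)))).coprod
    ((covec P).comp (ContinuousLinearMap.inr ℝ E E))) = covec P
  rw [neg_neg]
  exact ContinuousLinearMap.coprod_comp_inl_inr (covec P)

lemma covec_phiStar_fst (P : CotangentBundle (I.prod I) (Q × Q)) :
    covec (phiStar I P).1 = -((covec P).comp (ContinuousLinearMap.inl ℝ E E)) := rfl

lemma covec_phiStar_snd (P : CotangentBundle (I.prod I) (Q × Q)) :
    covec (phiStar I P).2 = (covec P).comp (ContinuousLinearMap.inr ℝ E E) := rfl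

lemma covec_phiStarInv (P : CotangentBundle I Q × CotangentBundle I Q) :
    covec (phiStarInv I P) = (-covec P.1).coprod (covec P.2) := rfl

lemma covFst_covPair {q₀ q₁ : Q} (γ : Covector I q₀) (δ : Covector I q₁) :
    covFst I (covPair I γ δ) = γ :=
  let γ' : E →L[ℝ] ℝ := γ
  let δ' : E →L[ℝ] ℝ := δ
  ContinuousLinearMap.coprod_comp_inl γ' δ'

lemma covSnd_covPair {q₀ q₁ : Q} (γ : Covector I q₀) (δ : Covector I q₁) :
    covSnd I (covPair I γ δ) = δ :=
  let γ' : E →L[ℝ] ℝ := γ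
  let δ' : E →L[ℝ] ℝ := δ
  ContinuousLinearMap.coprod_comp_inr γ' δ'

lemma phiStar_phiStarInv (P : CotangentBundle I Q × CotangentBundle I Q) :
    phiStar I (phiStarInv I P) = P := by
  refine Prod.ext ?_ ?_
  · refine congrArg (TotalSpace.mk P.1.proj) ?_
    rw [phiStarInv, covFst_covPair]
    exact neg_neg (covec P.1)
  · refine congrArg (TotalSpace.mk P.2.proj) ?_
    exact covSnd_covPair _ _

variable [IsManifold I ∞ Q]

lemma eventually_phiStar_mem (P₀ : CotangentBundle (I.prod I) (Q × Q)) :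
    ∀ᶠ P in nhds P₀, P.proj ∈ (chartAt (ModelProd H H) P₀.proj).source :=
  eventually_proj_mem_chartAt_cotangent (mem_chart_source _ _)

variable [I.Boundaryless]

lemma tangentCoordChange_prod {x y z : Q × Q} (hx : z ∈ (chartAt (ModelProd H H) x).source)
    (hy : z ∈ (chartAt (ModelProd H H) y).source) :
    tangentCoordChange (I.prod I) x y z =
      (tangentCoordChange I x.1 y.1 z.1).prodMap (tangentCoordChange I x.2 y.2 z.2) := by
  rw [prodChartedSpace_chartAt] at hx hy
  have h1 := hasFDerivAt_transition (I := I) hx.1 hy.1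
  have h2 := hasFDerivAt_transition (I := I) hx.2 hy.2
  have h3 : HasFDerivAt (Prod.map (transition I x.1 y.1) (transition I x.2 y.2)) _
    (extChartAt (I.prod I) x z) := HasFDerivAt.prodMap (extChartAt (I.prod I) x z) h1 h2
  rw [tangentCoordChange_eq_fderiv]
  exact h3.fderiv

lemma trivializationAt_cotangent_prod_snd (x : Q × Q) (P : CotangentBundle (I.prod I) (Q × Q))
    (h : P.proj ∈ (chartAt (ModelProd H H) x).source) :
    (trivializationAt (E × E →L[ℝ] ℝ) (fun x : Q × Q => TangentSpace (I.prod I) x →L[ℝ] ℝ) x P).2 =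
      (((covec P).comp (ContinuousLinearMap.inl ℝ E E)).comp
        (tangentCoordChange I x.1 P.proj.1 P.proj.1)).coprod
      (((covec P).comp (ContinuousLinearMap.inr ℝ E E)).comp
        (tangentCoordChange I x.2 P.proj.2 P.proj.2)) := by
  rw [trivializationAt_cotangent_snd x P h, tangentCoordChange_prod h (mem_chart_source _ P.proj)]
  refine ContinuousLinearMap.ext fun ⟨u, v⟩ => ?_
  simp only [ContinuousLinearMap.comp_apply, ContinuousLinearMap.coprod_apply,
    ContinuousLinearMap.coe_prodMap', Prod.map]
  simp only [ContinuousLinearMap.inl_apply, ContinuousLinearMap.inr_apply]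
  rw [← map_add]
  simp

lemma contMDiff_phiStar :
    ContMDiff (cotModel (I.prod I)) ((cotModel I).prod (cotModel I)) ∞
      (phiStar I : CotangentBundle (I.prod I) (Q × Q) → _) := by
  intro P₀
  have hproj : ContMDiffAt (cotModel (I.prod I)) (I.prod I) ∞
      (fun P : CotangentBundle (I.prod I) (Q × Q) => P.proj) P₀ :=
    (contMDiff_proj (fun x : Q × Q => TangentSpace (I.prod I) x →L[ℝ] ℝ)).contMDiffAt
  have hfib := (contMDiffAt_totalSpace.1 (contMDiffAt_id (I := cotModel (I.prod I)) (n := ∞)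
    (x := P₀))).2
  refine ContMDiffAt.prodMk ?_ ?_
  · refine contMDiffAt_totalSpace.2 ⟨contMDiffAt_fst.comp P₀ hproj, ?_⟩
    have h1 : ContDiff ℝ ∞ fun f : E × E →L[ℝ] ℝ => -(f.comp (ContinuousLinearMap.inl ℝ E E)) := by
      fun_prop
    refine (h1.contMDiff.contMDiffAt.comp P₀ hfib).congr_of_eventuallyEq ?_
    filter_upwards [eventually_phiStar_mem P₀] with P h
    have h' := h
    rw [prodChartedSpace_chartAt] at h'
    have e := trivializationAt_cotangent_snd P₀.proj.1 (phiStar I P).1 h'.1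
    rw [covec_phiStar_fst] at e
    refine e.trans ?_
    rw [Function.comp_apply, id_eq, id_eq, trivializationAt_cotangent_prod_snd P₀.proj P h,
      ContinuousLinearMap.coprod_comp_inl]
    rfl
  · refine contMDiffAt_totalSpace.2 ⟨contMDiffAt_snd.comp P₀ hproj, ?_⟩
    have h1 : ContDiff ℝ ∞ fun f : E × E →L[ℝ] ℝ => f.comp (ContinuousLinearMap.inr ℝ E E) := by
      fun_prop
    refine (h1.contMDiff.contMDiffAt.comp P₀ hfib).congr_of_eventuallyEq ?_
    filter_upwards [eventually_phiStar_mem P₀] with P h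
    have h' := h
    rw [prodChartedSpace_chartAt] at h'
    have e := trivializationAt_cotangent_snd P₀.proj.2 (phiStar I P).2 h'.2
    rw [covec_phiStar_snd] at e
    refine e.trans ?_
    rw [Function.comp_apply, id_eq, id_eq, trivializationAt_cotangent_prod_snd P₀.proj P h,
      ContinuousLinearMap.coprod_comp_inr]
    rfl

lemma contMDiff_phiStarInv :
    ContMDiff ((cotModel I).prod (cotModel I)) (cotModel (I.prod I)) ∞
      (phiStarInv I : CotangentBundle I Q × CotangentBundle I Q → _) := by
  intro P₀
  have hp := contMDiff_proj (F := E →L[ℝ] ℝ) (IB := I) (n := ∞) (fun x : Q => TangentSpace I x →L[ℝ] ℝ)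
  have hfib1 := (contMDiffAt_totalSpace.1 (contMDiffAt_fst (I := cotModel I) (J := cotModel I)
    (n := ∞) (p := P₀))).2
  have hfib2 := (contMDiffAt_totalSpace.1 (contMDiffAt_snd (I := cotModel I) (J := cotModel I)
    (n := ∞) (p := P₀))).2
  have hproj := (hp.contMDiffAt.comp P₀ contMDiffAt_fst).prodMk
      (hp.contMDiffAt.comp P₀ (contMDiffAt_snd (I := cotModel I) (J := cotModel I)))
  refine contMDiffAt_totalSpace.2 ⟨hproj, ?_⟩
  have h1 : ContDiff ℝ ∞ fun f : (E →L[ℝ] ℝ) × (E →L[ℝ] ℝ) =>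
      -(f.1.comp (ContinuousLinearMap.fst ℝ E E)) + f.2.comp (ContinuousLinearMap.snd ℝ E E) := by
    fun_prop
  refine (h1.contMDiff.contMDiffAt.comp P₀ (hfib1.prodMk_space hfib2)).congr_of_eventuallyEq ?_
  have e1 := (continuousAt_fst (p := P₀)).eventually
    (eventually_proj_mem_chartAt_cotangent (I := I) (mem_chart_source H P₀.1.proj))
  have e2 := (continuousAt_snd (p := P₀)).eventually
    (eventually_proj_mem_chartAt_cotangent (I := I) (mem_chart_source H P₀.2.proj))
  filter_upwards [e1, e2] with P h1 h2
  have h : (phiStarInv I P).proj ∈ (chartAt (ModelProd H H) (phiStarInv I P₀).proj).source := by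
    rw [prodChartedSpace_chartAt]; exact ⟨h1, h2⟩
  rw [Function.comp_apply, trivializationAt_cotangent_prod_snd _ _ h,
    trivializationAt_cotangent_snd _ _ h1, trivializationAt_cotangent_snd _ _ h2,
    covec_phiStarInv, ContinuousLinearMap.coprod_comp_inl, ContinuousLinearMap.coprod_comp_inr]
  refine ContinuousLinearMap.ext fun ⟨u, v⟩ => ?_
  simp
  rfl

variable (I Q) in
/-- The diffeomorphism `Φ* : T*(Q × Q) → T*Q × T*Q`. -/
def phiStarDiffeomorph : CotangentBundle (I.prod I) (Q × Q)
    ≃ₘ^∞⟮cotModel (I.prod I), (cotModel I).prod (cotModel I)⟯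
      CotangentBundle I Q × CotangentBundle I Q where
  toFun := phiStar I
  invFun := phiStarInv I
  left_inv := phiStarInv_phiStar
  right_inv := phiStar_phiStarInv
  contMDiff_toFun := contMDiff_phiStar
  contMDiff_invFun := contMDiff_phiStarInv

variable (E) in
/-- The map `Φ*` in coordinates. -/
def phiStarModel :
    (E × E) × (E × E →L[ℝ] ℝ) →L[ℝ] (E × (E →L[ℝ] ℝ)) × (E × (E →L[ℝ] ℝ)) :=
  let f := ContinuousLinearMap.fst ℝ (E × E) (E × E →L[ℝ] ℝ)
  let s := ContinuousLinearMap.snd ℝ (E × E) (E × E →L[ℝ] ℝ)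
  (((ContinuousLinearMap.fst ℝ E E).comp f).prod
    (-((ContinuousLinearMap.precomp ℝ (ContinuousLinearMap.inl ℝ E E)).comp s))).prod
  (((ContinuousLinearMap.snd ℝ E E).comp f).prod
    ((ContinuousLinearMap.precomp ℝ (ContinuousLinearMap.inr ℝ E E)).comp s))

@[simp]
lemma phiStarModel_apply (x : (E × E) × (E × E →L[ℝ] ℝ)) :
    phiStarModel E x = ((x.1.1, -(x.2.comp (ContinuousLinearMap.inl ℝ E E))),
      (x.1.2, x.2.comp (ContinuousLinearMap.inr ℝ E E))) := rfl

lemma hasMFDerivAt_phiStar (P : CotangentBundle (I.prod I) (Q × Q)) :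
    HasMFDerivAt (cotModel (I.prod I)) ((cotModel I).prod (cotModel I)) (phiStar I) P
      (phiStarModel E) := by
  refine hasMFDerivAt_of_eventually_extChartAt (I := cotModel (I.prod I)) (phiStarModel E)
    contMDiff_phiStar.continuous.continuousAt ?_
  filter_upwards [eventually_phiStar_mem P] with η h
  have h' := h
  rw [prodChartedSpace_chartAt] at h'
  change (extChartAt (cotModel I) (phiStar I P).1 (phiStar I η).1,
    extChartAt (cotModel I) (phiStar I P).2 (phiStar I η).2) = _
  rw [extChartAt_cotangent _ _ h, extChartAt_cotangent (phiStar I P).1 (phiStar I η).1 h'.1,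
    extChartAt_cotangent (phiStar I P).2 (phiStar I η).2 h'.2,
    tangentCoordChange_prod h (mem_chart_source _ _), covec_phiStar_fst, covec_phiStar_snd,
    phiStarModel_apply]
  refine Prod.ext (Prod.ext rfl ?_) (Prod.ext rfl ?_)
  · refine ContinuousLinearMap.ext fun v => ?_
    simp
    rfl
  · refine ContinuousLinearMap.ext fun v => ?_
    simp
    rfl

end PhiStar

/-! ### Transport along isomorphisms of Lie groupoids -/

section MFDerivCoord

variable {E : Type*} [NormedAddCommGroup E] [NormedSpace ℝ E]
  {H : Type*} [TopologicalSpace H] (I : ModelWithCorners ℝ E H)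
  {M : Type*} [TopologicalSpace M] [ChartedSpace H M]
  {E' : Type*} [NormedAddCommGroup E'] [NormedSpace ℝ E']
  {H' : Type*} [TopologicalSpace H'] (I' : ModelWithCorners ℝ E' H')
  {M' : Type*} [TopologicalSpace M'] [ChartedSpace H' M']
  {E'' : Type*} [NormedAddCommGroup E''] [NormedSpace ℝ E'']
  {H'' : Type*} [TopologicalSpace H''] (I'' : ModelWithCorners ℝ E'' H'')
  {M'' : Type*} [TopologicalSpace M''] [ChartedSpace H'' M'']

/-- The tangent map of `f` at `x`, as a map between the model spaces. -/
def mfderivCoord (f : M → M') (x : M) : E →L[ℝ] E' := mfderiv I I' f x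

lemma mfderivCoord_comp {g : M' → M''} {f : M → M'} {x : M} (hg : MDifferentiableAt I' I'' g (f x))
    (hf : MDifferentiableAt I I' f x) :
    mfderivCoord I I'' (g ∘ f) x = (mfderivCoord I' I'' g (f x)).comp (mfderivCoord I I' f x) :=
  mfderiv_comp x hg hf

lemma mfderivCoord_congr {f g : M → M'} {x : M} (h : f =ᶠ[nhds x] g) :
    mfderivCoord I I' f x = mfderivCoord I I' g x := h.mfderiv_eq

lemma mfderivCoord_prodMk {f : M → M'} {g : M → M''} {x : M} (hf : MDifferentiableAt I I' f x)
    (hg : MDifferentiableAt I I'' g x) :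
    mfderivCoord I (I'.prod I'') (fun y => (f y, g y)) x =
      (mfderivCoord I I' f x).prod (mfderivCoord I I'' g x) :=
  mfderiv_prodMk hf hg

lemma mfderivCoord_id (x : M) : mfderivCoord I I (id : M → M) x = ContinuousLinearMap.id ℝ E :=
  mfderiv_id

lemma mfderivCoord_fst (x : M × M') :
    mfderivCoord (I.prod I') I (Prod.fst : M × M' → M) x = ContinuousLinearMap.fst ℝ E E' :=
  mfderiv_fst

lemma mfderivCoord_snd (x : M × M') :
    mfderivCoord (I.prod I') I' (Prod.snd : M × M' → M') x = ContinuousLinearMap.snd ℝ E E' :=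
  mfderiv_snd

lemma mfderivCoord_const (x : M) (y : M') : mfderivCoord I I' (fun _ : M => y) x = 0 :=
  mfderiv_const

variable {I I'}

lemma mfderivCoord_symm_comp (d : M ≃ₘ^∞⟮I, I'⟯ M') (x : M) :
    (mfderivCoord I' I d.symm (d x)).comp (mfderivCoord I I' d x) =
      ContinuousLinearMap.id ℝ E := by
  rw [← mfderivCoord_comp I I' I (d.symm.contMDiff.mdifferentiable (by simp) _)
    (d.contMDiff.mdifferentiable (by simp) _)]
  have : (d.symm ∘ d : M → M) = id := funext d.symm_apply_apply
  rw [this, mfderivCoord_id]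

lemma mfderivCoord_comp_symm (d : M ≃ₘ^∞⟮I, I'⟯ M') (x : M) :
    (mfderivCoord I I' d x).comp (mfderivCoord I' I d.symm (d x)) =
      ContinuousLinearMap.id ℝ E' := by
  have := mfderivCoord_symm_comp d.symm (d x)
  rwa [d.symm_apply_apply] at this

lemma mfderivCoord_diffeomorph_bijective (d : M ≃ₘ^∞⟮I, I'⟯ M') (x : M) :
    Function.Bijective (mfderivCoord I I' d x) := by
  refine Function.bijective_iff_has_inverse.2 ⟨mfderivCoord I' I d.symm (d x), fun v => ?_,
    fun v => ?_⟩
  · exact DFunLike.congr_fun (mfderivCoord_symm_comp d x) v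
  · exact DFunLike.congr_fun (mfderivCoord_comp_symm d x) v

lemma mfderivCoord_diffeomorph_comp (d : M ≃ₘ^∞⟮I, I'⟯ M') (f : M'' → M) (x : M'') :
    mfderivCoord I'' I' (d ∘ f) x = (mfderivCoord I I' d (f x)).comp (mfderivCoord I'' I f x) := by
  by_cases hf : MDifferentiableAt I'' I f x
  · exact mfderivCoord_comp I'' I I' (d.contMDiff.mdifferentiable (by simp) _) hf
  · have hdf : ¬ MDifferentiableAt I'' I' (d ∘ f) x := fun h => hf <| by
      have h1 := (d.symm.contMDiff.mdifferentiable (by simp) (d (f x))).comp x h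
      have : (d.symm ∘ (d ∘ f)) = f := funext fun y => d.symm_apply_apply (f y)
      rwa [this] at h1
    have h1 : mfderivCoord I'' I f x = 0 := mfderiv_zero_of_not_mdifferentiableAt hf
    have h2 : mfderivCoord I'' I' (d ∘ f) x = 0 := mfderiv_zero_of_not_mdifferentiableAt hdf
    rw [h1, h2, ContinuousLinearMap.comp_zero]

end MFDerivCoord

section Transport

variable {EM : Type*} [NormedAddCommGroup EM] [NormedSpace ℝ EM]
  {HM : Type*} [TopologicalSpace HM] {IM : ModelWithCorners ℝ EM HM}
  {M : Type*} [TopologicalSpace M] [ChartedSpace HM M] [IsManifold IM ∞ M]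
  {EG : Type*} [NormedAddCommGroup EG] [NormedSpace ℝ EG]
  {HG : Type*} [TopologicalSpace HG] {IG : ModelWithCorners ℝ EG HG}
  {G : Type*} [TopologicalSpace G] [ChartedSpace HG G] [IsManifold IG ∞ G]
  {F : Type*} [NormedAddCommGroup F] [NormedSpace ℝ F]
  {A : M → Type*} [TopologicalSpace (TotalSpace F A)] [∀ x, AddCommGroup (A x)]
  [∀ x, Module ℝ (A x)] [∀ x, TopologicalSpace (A x)] [FiberBundle F A] [VectorBundle ℝ F A]
  [ContMDiffVectorBundle ∞ F A IM]
  {EG' : Type*} [NormedAddCommGroup EG'] [NormedSpace ℝ EG']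
  {HG' : Type*} [TopologicalSpace HG'] {IG' : ModelWithCorners ℝ EG' HG'}
  {G' : Type*} [TopologicalSpace G'] [ChartedSpace HG' G'] [IsManifold IG' ∞ G']
  {F' : Type*} [NormedAddCommGroup F'] [NormedSpace ℝ F']
  {A' : M → Type*} [TopologicalSpace (TotalSpace F' A')] [∀ x, AddCommGroup (A' x)]
  [∀ x, Module ℝ (A' x)] [∀ x, TopologicalSpace (A' x)] [FiberBundle F' A']
  [VectorBundle ℝ F' A'] [ContMDiffVectorBundle ∞ F' A' IM]
  {S : GroupoidMaps G M} {S' : GroupoidMaps G' M} {Φ : G → G'}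

namespace IsLieGroupoidIso

omit [IsManifold IM ∞ M] [IsManifold IG ∞ G] [IsManifold IG' ∞ G'] in
/-- A groupoid isomorphic to a Lie groupoid through a diffeomorphism is a Lie groupoid. -/
theorem isLieGroupoid (h : IsLieGroupoidIso IG IG' S S' Φ) (h' : IsLieGroupoid IM IG' S') :
    IsLieGroupoid IM IG S := by
  obtain ⟨⟨d, rfl⟩, hsrc, htgt, hunit, hinv, hmul⟩ := h
  have hinj : Function.Injective d := d.injective
  have hs : S.src = S'.src ∘ d := funext fun g => (hsrc g).symm
  have ht : S.tgt = S'.tgt ∘ d := funext fun g => (htgt g).symm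
  have hu : S.unit = d.symm ∘ S'.unit := funext fun x => by
    simp [← hunit x, d.symm_apply_apply]
  have hi : S.inv = d.symm ∘ S'.inv ∘ d := funext fun x => by
    simp [← hinv x, d.symm_apply_apply]
  have src_unit (x) : S.src (S.unit x) = x := by rw [← hsrc, hunit, h'.src_unit]
  have tgt_unit (x) : S.tgt (S.unit x) = x := by rw [← htgt, hunit, h'.tgt_unit]
  have comp {g k} (e : S.tgt g = S.src k) : S'.tgt (d g) = S'.src (d k) := by rw [htgt, hsrc, e]
  have src_mul (g k) (e : S.tgt g = S.src k) : S.src (S.mul g k) = S.src g := by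
    rw [← hsrc, hmul _ _ e, h'.src_mul _ _ (comp e), hsrc]
  have tgt_mul (g k) (e : S.tgt g = S.src k) : S.tgt (S.mul g k) = S.tgt k := by
    rw [← htgt, hmul _ _ e, h'.tgt_mul _ _ (comp e), htgt]
  have src_inv (g) : S.src (S.inv g) = S.tgt g := by rw [← hsrc, hinv, h'.src_inv, htgt]
  have tgt_inv (g) : S.tgt (S.inv g) = S.src g := by rw [← htgt, hinv, h'.tgt_inv, hsrc]
  refine
    { src_unit := src_unit
      tgt_unit := tgt_unit
      src_mul := src_mul
      tgt_mul := tgt_mul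
      mul_assoc := fun g k l e e' => hinj ?_
      unit_mul := fun g => hinj ?_
      mul_unit := fun g => hinj ?_
      src_inv := src_inv
      tgt_inv := tgt_inv
      inv_mul := fun g => hinj ?_
      mul_inv := fun g => hinj ?_
      smooth_src := hs ▸ h'.smooth_src.comp d.contMDiff
      smooth_tgt := ht ▸ h'.smooth_tgt.comp d.contMDiff
      smooth_unit := hu ▸ d.symm.contMDiff.comp h'.smooth_unit
      smooth_inv := hi ▸ d.symm.contMDiff.comp (h'.smooth_inv.comp d.contMDiff)
      smooth_mul := ?_
      submersion_src := fun g => ?_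
      submersion_tgt := fun g => ?_ }
  · rw [hmul _ _ ((tgt_mul g k e).trans e'), hmul _ _ e, hmul _ _ (e.trans (src_mul k l e').symm),
      hmul _ _ e', h'.mul_assoc _ _ _ (comp e) (comp e')]
  · rw [hmul _ _ (tgt_unit _), hunit, ← hsrc, h'.unit_mul]
  · rw [hmul _ _ (src_unit _).symm, hunit, ← htgt, h'.mul_unit]
  · rw [hmul _ _ (tgt_inv g), hinv, hunit, h'.inv_mul, htgt]
  · rw [hmul _ _ (src_inv g).symm, hinv, hunit, h'.mul_inv, hsrc]
  · have hd : ContMDiff (IG.prod IG) (IG'.prod IG') ∞ (Prod.map d d) :=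
      d.contMDiff.prodMap d.contMDiff
    have h1 := d.symm.contMDiff.comp_contMDiffOn (h'.smooth_mul.comp
      (hd.contMDiffOn (s := {p : G × G | S.tgt p.1 = S.src p.2})) fun p hp => comp hp)
    refine h1.congr fun p hp => ?_
    change S.mul p.1 p.2 = d.symm (S'.mul (d p.1) (d p.2))
    rw [← hmul _ _ hp, d.symm_apply_apply]
  · have h1 := mfderivCoord_comp IG IG' IM (h'.smooth_src.mdifferentiable (by simp) (d g))
      (d.contMDiff.mdifferentiable (by simp) g)
    change Function.Surjective (mfderivCoord IG IM S.src g)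
    rw [hs, h1]
    exact (h'.submersion_src (d g)).comp (mfderivCoord_diffeomorph_bijective d g).surjective
  · have h1 := mfderivCoord_comp IG IG' IM (h'.smooth_tgt.mdifferentiable (by simp) (d g))
      (d.contMDiff.mdifferentiable (by simp) g)
    change Function.Surjective (mfderivCoord IG IM S.tgt g)
    rw [ht, h1]
    exact (h'.submersion_tgt (d g)).comp (mfderivCoord_diffeomorph_bijective d g).surjective

variable {ι : ∀ x, A x →L[ℝ] TangentSpace IG (S.unit x)}
  {ι' : ∀ x, A' x →L[ℝ] TangentSpace IG' (S'.unit x)} {Θ : ∀ x, A x →L[ℝ] A' x}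

/-- A model of the Lie algebroid of a Lie groupoid, transported along an isomorphism. -/
theorem isLieAlgebroidModel (h : IsLieGroupoidIso IG IG' S S' Φ) (hS' : IsLieGroupoid IM IG' S')
    (hι' : IsLieAlgebroidModel IM IG' F' S' ι')
    (hΘ : ContMDiff (IM.prod 𝓘(ℝ, F)) (IM.prod 𝓘(ℝ, F')) ∞
      (fun a : TotalSpace F A => (⟨a.proj, Θ a.proj a.2⟩ : TotalSpace F' A')))
    (hbij : ∀ x, Function.Bijective (Θ x))
    (hind : ∀ (x : M) (a : A x), (mfderiv IG IG' Φ (S.unit x) (ι x a) : EG') = ι' x (Θ x a)) :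
    IsLieAlgebroidModel IM IG F S ι := by
  obtain ⟨⟨d, rfl⟩, hsrc, htgt, hunit, hinv, hmul⟩ := h
  have hind' (x : M) (a : A x) : mfderivCoord IG IG' d (S.unit x) (ι x a) = ι' x (Θ x a) :=
    hind x a
  have hs : S.src = S'.src ∘ d := funext fun g => (hsrc g).symm
  have hTs (x : M) : mfderivCoord IG IM S.src (S.unit x) =
      (mfderivCoord IG' IM S'.src (S'.unit x)).comp (mfderivCoord IG IG' d (S.unit x)) := by
    rw [hs, mfderivCoord_comp IG IG' IM (hS'.smooth_src.mdifferentiable (by simp) _)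
      (d.contMDiff.mdifferentiable (by simp) _), hunit]
  have hTs' (x : M) (v : EG) : mfderivCoord IG IM S.src (S.unit x) v =
      mfderivCoord IG' IM S'.src (S'.unit x) (mfderivCoord IG IG' d (S.unit x) v) := by
    rw [hTs]; rfl
  have hb (x : M) := mfderivCoord_diffeomorph_bijective d (S.unit x)
  refine ⟨fun x a b hab => ?_, fun x => Set.ext fun v => ⟨?_, fun hv => ?_⟩, ?_⟩
  · refine (hbij x).injective (hι'.injective x ?_)
    have : mfderivCoord IG IG' d (S.unit x) (ι x a) = mfderivCoord IG IG' d (S.unit x) (ι x b) :=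
      congrArg (mfderivCoord IG IG' d (S.unit x)) hab
    exact (hind' x a).symm.trans (this.trans (hind' x b))
  · rintro ⟨a, rfl⟩
    refine (hTs' x _).trans ((congrArg (mfderivCoord IG' IM S'.src (S'.unit x))
      (hind' x a)).trans ?_)
    have : ι' x (Θ x a) ∈ Set.range (ι' x) := ⟨_, rfl⟩
    rw [hι'.range_eq x] at this
    exact this
  · have h1 : mfderivCoord IG' IM S'.src (S'.unit x) (mfderivCoord IG IG' d (S.unit x) v) = 0 :=
      (hTs' x v).symm.trans hv
    have h2 : (mfderivCoord IG IG' d (S.unit x) v : TangentSpace IG' (S'.unit x)) ∈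
      Set.range (ι' x) := by rw [hι'.range_eq x]; exact h1
    obtain ⟨a', ha'⟩ := h2
    obtain ⟨a, rfl⟩ := (hbij x).surjective a'
    exact ⟨a, (hb x).injective ((hind' x a).trans ha')⟩
  · have h1 := (d.symm.contMDiff.contMDiff_tangentMap (m := ∞) (by simp)).comp
      (hι'.smooth.comp hΘ)
    refine h1.congr fun a => ?_
    have hu : d.symm (S'.unit a.proj) = S.unit a.proj := by
      rw [← hunit, d.symm_apply_apply]
    have hv : mfderivCoord IG' IG d.symm (S'.unit a.proj) (ι' a.proj (Θ a.proj a.2)) =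
        ι a.proj a.2 := by
      refine (congrArg (mfderivCoord IG' IG d.symm (S'.unit a.proj))
        (hind' a.proj a.2).symm).trans ?_
      rw [← hunit]
      exact DFunLike.congr_fun (mfderivCoord_symm_comp d (S.unit a.proj)) (ι a.proj a.2)
    have key : ∀ (g g' : G) (v v' : EG), g = g' → v = v' →
      (⟨g, v⟩ : TangentBundle IG G) = ⟨g', v'⟩ := by rintro g _ v _ rfl rfl; rfl
    exact key _ _ _ _ hu.symm hv.symm

end IsLieGroupoidIso

end Transport

section Transport

variable {EM : Type*} [NormedAddCommGroup EM] [NormedSpace ℝ EM]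
  {HM : Type*} [TopologicalSpace HM] {IM : ModelWithCorners ℝ EM HM}
  {M : Type*} [TopologicalSpace M] [ChartedSpace HM M] [IsManifold IM ∞ M]
  {EG : Type*} [NormedAddCommGroup EG] [NormedSpace ℝ EG]
  {HG : Type*} [TopologicalSpace HG] {IG : ModelWithCorners ℝ EG HG}
  {G : Type*} [TopologicalSpace G] [ChartedSpace HG G] [IsManifold IG ∞ G]
  {F : Type*} [NormedAddCommGroup F] [NormedSpace ℝ F]
  {A : M → Type*} [TopologicalSpace (TotalSpace F A)] [∀ x, AddCommGroup (A x)]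
  [∀ x, Module ℝ (A x)] [∀ x, TopologicalSpace (A x)] [FiberBundle F A] [VectorBundle ℝ F A]
  [ContMDiffVectorBundle ∞ F A IM]
  {EG' : Type*} [NormedAddCommGroup EG'] [NormedSpace ℝ EG']
  {HG' : Type*} [TopologicalSpace HG'] {IG' : ModelWithCorners ℝ EG' HG'}
  {G' : Type*} [TopologicalSpace G'] [ChartedSpace HG' G'] [IsManifold IG' ∞ G']
  {F' : Type*} [NormedAddCommGroup F'] [NormedSpace ℝ F']
  {A' : M → Type*} [TopologicalSpace (TotalSpace F' A')] [∀ x, AddCommGroup (A' x)]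
  [∀ x, Module ℝ (A' x)] [∀ x, TopologicalSpace (A' x)] [FiberBundle F' A']
  [VectorBundle ℝ F' A'] [ContMDiffVectorBundle ∞ F' A' IM]
  {S : GroupoidMaps G M} {S' : GroupoidMaps G' M} {Φ : G → G'}

omit [IsManifold IM ∞ M] [ContMDiffVectorBundle ∞ F A IM] in
lemma contMDiff_fibre_line (x : M) (a : A x) :
    ContMDiff 𝓘(ℝ, ℝ) (IM.prod 𝓘(ℝ, F)) ∞ (fun t : ℝ => (⟨x, t • a⟩ : TotalSpace F A)) := by
  intro t₀
  refine contMDiffAt_totalSpace.2 ⟨contMDiffAt_const, ?_⟩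
  have hx : x ∈ (trivializationAt F A x).baseSet := mem_baseSet_trivializationAt F A x
  have h1 : ContDiff ℝ ∞ fun t : ℝ => t • (trivializationAt F A x ⟨x, a⟩).2 := by fun_prop
  refine h1.contMDiff.contMDiffAt.congr_of_eventuallyEq (Filter.Eventually.of_forall fun t => ?_)
  exact ((trivializationAt F A x).linear ℝ hx).map_smul t a

variable {ι : ∀ x, A x →L[ℝ] TangentSpace IG (S.unit x)}
  {ι' : ∀ x, A' x →L[ℝ] TangentSpace IG' (S'.unit x)} {Θ : ∀ x, A x →L[ℝ] A' x}

/-- A map isomorphic to a generalized discretization map is a generalized discretization map. -/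
theorem IsIsomorphicVia.isGeneralizedDiscretizationMap {U : Set (TotalSpace F A)}
    {R : TotalSpace F A → G} {U' : Set (TotalSpace F' A')} {R' : TotalSpace F' A' → G'}
    (h : IsIsomorphicVia IM IG IG' S ι U R S' ι' U' R' Φ Θ)
    (h' : IsGeneralizedDiscretizationMap IM IG' S' ι' U' R') :
    IsGeneralizedDiscretizationMap IM IG S ι U R := by
  obtain ⟨e, he⟩ := h.algebroidIso.diffeo
  have he' : ⇑e = fun a : TotalSpace F A => (⟨a.proj, Θ a.proj a.2⟩ : TotalSpace F' A') := funext he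
  have hΘ : ContMDiff (IM.prod 𝓘(ℝ, F)) (IM.prod 𝓘(ℝ, F')) ∞
      (fun a : TotalSpace F A => (⟨a.proj, Θ a.proj a.2⟩ : TotalSpace F' A')) :=
    he' ▸ e.contMDiff
  have hbij (x : M) : Function.Bijective (Θ x) := by
    constructor
    · intro a b hab
      have : e ⟨x, a⟩ = e ⟨x, b⟩ := by rw [he, he]; exact congrArg (TotalSpace.mk x) hab
      exact TotalSpace.mk_injective x (e.injective this)
    · intro b
      obtain ⟨⟨y, a⟩, hya⟩ := e.surjective ⟨x, b⟩
      replace hya : (⟨y, Θ y a⟩ : TotalSpace F' A') = ⟨x, b⟩ := (he ⟨y, a⟩).symm.trans hya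
      obtain rfl : y = x := congrArg TotalSpace.proj hya
      exact ⟨a, TotalSpace.mk_injective y hya⟩
  have hG := h.groupoidIso.isLieGroupoid h'.lieGroupoid
  obtain ⟨d, hd⟩ := h.groupoidIso.diffeo
  have hU : U = e ⁻¹' U' := Set.ext fun a => by rw [Set.mem_preimage, he]; exact h.domain a
  have hUo : IsOpen U := hU ▸ h'.isOpen.preimage e.continuous
  have hR (a) (ha : a ∈ U) : d (R a) = R' (e a) := by
    rw [hd, ← h.commutes a ha, he]
  have hR' (a) (ha : a ∈ U) : R a = d.symm (R' (e a)) := by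
    rw [← hR a ha, d.symm_apply_apply]
  have he0 (x : M) : e ⟨x, 0⟩ = ⟨x, 0⟩ := by rw [he]; simp
  have h0 (x : M) : (⟨x, 0⟩ : TotalSpace F A) ∈ U := by
    rw [hU, Set.mem_preimage, he0]; exact h'.zero_mem x
  have hsm : ContMDiffOn (IM.prod 𝓘(ℝ, F)) IG ∞ R U := by
    refine (d.symm.contMDiff.comp_contMDiffOn (h'.smooth.comp e.contMDiff.contMDiffOn ?_)).congr hR'
    exact hU.subset
  have hmz (x : M) : R ⟨x, 0⟩ = S.unit x := by
    refine d.injective ?_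
    change d (R ⟨x, 0⟩) = d (S.unit x)
    rw [hR _ (h0 x), he0, h'.map_zero, hd, h.groupoidIso.unit_map]
  refine ⟨hG, h.groupoidIso.isLieAlgebroidModel h'.lieGroupoid h'.lieAlgebroid hΘ hbij h.induced,
    hUo, h0, hsm, hmz, fun x a => ?_⟩
  have hunit : d (S.unit x) = S'.unit x := by rw [hd]; exact h.groupoidIso.unit_map x
  set D := mfderivCoord IG IG' d (S.unit x) with hD
  have hDbij := mfderivCoord_diffeomorph_bijective d (S.unit x)
  set v : EM × F := verticalLift IM F x a with hv
  have hlift : mfderivCoord (IM.prod 𝓘(ℝ, F)) (IM.prod 𝓘(ℝ, F')) e ⟨x, 0⟩ v =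
      verticalLift IM F' x (Θ x a) := by
    have h1 := mfderivCoord_comp 𝓘(ℝ, ℝ) (IM.prod 𝓘(ℝ, F)) (IM.prod 𝓘(ℝ, F'))
      (f := fun t : ℝ => (⟨x, t • a⟩ : TotalSpace F A)) (x := (0 : ℝ)) (g := e)
      (e.contMDiff.mdifferentiable (by simp) _)
      ((contMDiff_fibre_line x a).mdifferentiable (by simp) _)
    have h2 : e ∘ (fun t : ℝ => (⟨x, t • a⟩ : TotalSpace F A)) =
        fun t : ℝ => (⟨x, t • Θ x a⟩ : TotalSpace F' A') := by
      funext t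
      simp [he]
    rw [h2, zero_smul] at h1
    exact (DFunLike.congr_fun h1 (1 : ℝ)).symm
  have hRd : MDifferentiableAt (IM.prod 𝓘(ℝ, F)) IG R (⟨x, 0⟩ : TotalSpace F A) :=
    (hsm.contMDiffAt (hUo.mem_nhds (h0 x))).mdifferentiableAt (by simp)
  have hR'd : MDifferentiableAt (IM.prod 𝓘(ℝ, F')) IG' R' (⟨x, 0⟩ : TotalSpace F' A') :=
    (h'.smooth.contMDiffAt (h'.isOpen.mem_nhds (h'.zero_mem x))).mdifferentiableAt (by simp)
  have hTR : D (mfderivCoord (IM.prod 𝓘(ℝ, F)) IG R ⟨x, 0⟩ v) =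
      mfderivCoord (IM.prod 𝓘(ℝ, F')) IG' R' ⟨x, 0⟩ (verticalLift IM F' x (Θ x a)) := by
    have h1 := mfderivCoord_comp (IM.prod 𝓘(ℝ, F)) IG IG'
      (d.contMDiff.mdifferentiable (by simp) (R ⟨x, 0⟩)) hRd
    have h2 := mfderivCoord_comp (IM.prod 𝓘(ℝ, F)) (IM.prod 𝓘(ℝ, F')) IG' (f := e) (g := R')
      (x := ⟨x, 0⟩) (by rw [he0]; exact hR'd) (e.contMDiff.mdifferentiable (by simp) _)
    have h3 : d ∘ R =ᶠ[nhds (⟨x, 0⟩ : TotalSpace F A)] R' ∘ e :=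
      Filter.mem_of_superset (hUo.mem_nhds (h0 x)) hR
    rw [mfderivCoord_congr _ _ h3, h2, hmz, he0] at h1
    rw [← hlift]
    exact (DFunLike.congr_fun h1 v).symm
  have hTs (w : EG) : mfderivCoord IG IM S.src (S.unit x) w =
      mfderivCoord IG' IM S'.src (S'.unit x) (D w) := by
    have hs : S.src = S'.src ∘ d := funext fun g => by
      rw [Function.comp_apply, hd]; exact (h.groupoidIso.src_map g).symm
    rw [hs, mfderivCoord_comp IG IG' IM (h'.lieGroupoid.smooth_src.mdifferentiable (by simp) _)
      (d.contMDiff.mdifferentiable (by simp) _), hunit]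
    rfl
  have hTu (w : EM) : D (mfderivCoord IM IG S.unit x w) = mfderivCoord IM IG' S'.unit x w := by
    have hu : S'.unit = d ∘ S.unit := funext fun y => by
      rw [Function.comp_apply, hd]; exact (h.groupoidIso.unit_map y).symm
    rw [hu, mfderivCoord_comp IM IG IG' (d.contMDiff.mdifferentiable (by simp) _)
      (hG.smooth_unit.mdifferentiable (by simp) _)]
    rfl
  have hι : D (ι x a) = ι' x (Θ x a) := by
    have := h.induced x a
    rw [← hd] at this
    exact this
  set ιa : EG := ι x a with hιa
  set y := mfderivCoord (IM.prod 𝓘(ℝ, F)) IG R ⟨x, 0⟩ v with hy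
  have hfin : (mfderivCoord (IM.prod 𝓘(ℝ, F')) IG' R' ⟨x, 0⟩ (verticalLift IM F' x (Θ x a))) =
      (show EG' from ι' x (Θ x a)) + mfderivCoord IM IG' S'.unit x
        (mfderivCoord IG' IM S'.src (S'.unit x) (mfderivCoord (IM.prod 𝓘(ℝ, F')) IG' R' ⟨x, 0⟩
          (verticalLift IM F' x (Θ x a)))) := h'.deriv_zero x (Θ x a)
  have hgoal : y = ιa + mfderivCoord IM IG S.unit x (mfderivCoord IG IM S.src (S.unit x) y) := by
    refine hDbij.injective ?_
    rw [map_add]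
    change D y = D ιa + D _
    rw [hTu, hTs, hTR, hι]
    exact hfin
  exact hgoal

end Transport

section Transport

variable {EM : Type*} [NormedAddCommGroup EM] [NormedSpace ℝ EM]
  {HM : Type*} [TopologicalSpace HM] {IM : ModelWithCorners ℝ EM HM}
  {M : Type*} [TopologicalSpace M] [ChartedSpace HM M] [IsManifold IM ∞ M]
  {EG : Type*} [NormedAddCommGroup EG] [NormedSpace ℝ EG]
  {HG : Type*} [TopologicalSpace HG] {IG : ModelWithCorners ℝ EG HG}
  {G : Type*} [TopologicalSpace G] [ChartedSpace HG G] [IsManifold IG ∞ G]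
  {F : Type*} [NormedAddCommGroup F] [NormedSpace ℝ F]
  {A : M → Type*} [TopologicalSpace (TotalSpace F A)] [∀ x, AddCommGroup (A x)]
  [∀ x, Module ℝ (A x)] [∀ x, TopologicalSpace (A x)] [FiberBundle F A] [VectorBundle ℝ F A]
  [ContMDiffVectorBundle ∞ F A IM]
  {EG' : Type*} [NormedAddCommGroup EG'] [NormedSpace ℝ EG']
  {HG' : Type*} [TopologicalSpace HG'] {IG' : ModelWithCorners ℝ EG' HG'}
  {G' : Type*} [TopologicalSpace G'] [ChartedSpace HG' G'] [IsManifold IG' ∞ G']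
  {F' : Type*} [NormedAddCommGroup F'] [NormedSpace ℝ F']
  {A' : M → Type*} [TopologicalSpace (TotalSpace F' A')] [∀ x, AddCommGroup (A' x)]
  [∀ x, Module ℝ (A' x)] [∀ x, TopologicalSpace (A' x)] [FiberBundle F' A']
  [VectorBundle ℝ F' A'] [ContMDiffVectorBundle ∞ F' A' IM]
  {S : GroupoidMaps G M} {S' : GroupoidMaps G' M} {Φ : G → G'}


namespace IsLieGroupoidIso

omit [IsManifold IG ∞ G] [IsManifold IG' ∞ G'] in
/-- The inverse of an isomorphism of Lie groupoids. -/
theorem symm {d : G ≃ₘ^∞⟮IG, IG'⟯ G'} (h : IsLieGroupoidIso IG IG' S S' d) :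
    IsLieGroupoidIso IG' IG S' S d.symm where
  diffeo := ⟨d.symm, rfl⟩
  src_map g := by rw [← h.src_map, d.apply_symm_apply]
  tgt_map g := by rw [← h.tgt_map, d.apply_symm_apply]
  unit_map x := by rw [← h.unit_map, d.symm_apply_apply]
  inv_map g := by
    refine d.injective ?_
    change d (d.symm _) = d (S.inv (d.symm g))
    rw [d.apply_symm_apply, h.inv_map, d.apply_symm_apply]
  mul_map g k e := by
    refine d.injective ?_
    change d (d.symm _) = d (S.mul (d.symm g) (d.symm k))
    rw [d.apply_symm_apply, h.mul_map, d.apply_symm_apply, d.apply_symm_apply]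
    rw [← h.src_map, ← h.tgt_map, d.apply_symm_apply, d.apply_symm_apply, e]

variable {ι : ∀ x, A x →L[ℝ] TangentSpace IG (S.unit x)}
  {ι' : ∀ x, A' x →L[ℝ] TangentSpace IG' (S'.unit x)} {Θ : ∀ x, A x →L[ℝ] A' x}

/-- Isomorphisms of Lie groupoids pull back left-invariant vector fields. -/
theorem isLeftInvariantField_of_related {d : G ≃ₘ^∞⟮IG, IG'⟯ G'}
    (h : IsLieGroupoidIso IG IG' S S' d) (hS : IsLieGroupoid IM IG S)
    {X : ∀ x, A x} {X' : ∀ x, A' x} {V : ∀ g : G, TangentSpace IG g}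
    {V' : ∀ g : G', TangentSpace IG' g}
    (hX : ∀ x, mfderivCoord IG IG' d (S.unit x) (ι x (X x)) = ι' x (X' x))
    (hV : ∀ g, mfderivCoord IG IG' d g (V g) = V' (d g))
    (hV' : IsLeftInvariantField IG' S' ι' X' V') : IsLeftInvariantField IG S ι X V := by
  intro g c hc hsrc h0 hder
  have htgt : S'.tgt (d g) = S.tgt g := h.tgt_map g
  have hXt : ∀ x y : M, x = y → (ι' x (X' x) : EG') = ι' y (X' y) := by rintro x _ rfl; rfl
  have key := hV' (d g) (d ∘ c) (d.contMDiff.contMDiffAt.comp 0 hc)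
    (hsrc.mono fun t ht => by rw [htgt, ← ht]; exact h.src_map (c t))
    (by rw [Function.comp_apply, h0, htgt, h.unit_map]) (by
      refine Eq.trans ?_ (hXt _ _ htgt.symm)
      have h1 := DFunLike.congr_fun (mfderivCoord_diffeomorph_comp (I'' := 𝓘(ℝ, ℝ)) d c 0) (1 : ℝ)
      refine h1.trans ?_
      rw [h0, ContinuousLinearMap.comp_apply]
      exact (congrArg (mfderivCoord IG IG' d (S.unit (S.tgt g))) hder).trans (hX _))
  have hmul : (fun t => S'.mul (d g) ((d ∘ c) t)) =ᶠ[nhds (0 : ℝ)]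
      d ∘ fun t => S.mul g (c t) := by
    filter_upwards [hsrc] with t ht
    exact (h.mul_map g (c t) ht.symm).symm
  have h1 := DFunLike.congr_fun ((mfderivCoord_congr 𝓘(ℝ, ℝ) IG' hmul).trans
    (mfderivCoord_diffeomorph_comp (I'' := 𝓘(ℝ, ℝ)) d (fun t => S.mul g (c t)) 0)) (1 : ℝ)
  rw [h0, hS.mul_unit] at h1
  have h2 : mfderivCoord IG IG' d g (mfderivCoord 𝓘(ℝ, ℝ) IG (fun t => S.mul g (c t)) 0 (1 : ℝ)) =
      mfderivCoord IG IG' d g (V g) := h1.symm.trans (key.trans (hV g).symm)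
  exact (mfderivCoord_diffeomorph_bijective d g).injective h2

theorem isLeftInvariantField_iff {d : G ≃ₘ^∞⟮IG, IG'⟯ G'}
    (h : IsLieGroupoidIso IG IG' S S' d) (hS' : IsLieGroupoid IM IG' S')
    {X : ∀ x, A x} {X' : ∀ x, A' x} {V : ∀ g : G, TangentSpace IG g}
    {V' : ∀ g : G', TangentSpace IG' g}
    (hX : ∀ x, mfderivCoord IG IG' d (S.unit x) (ι x (X x)) = ι' x (X' x))
    (hV : ∀ g, mfderivCoord IG IG' d g (V g) = V' (d g)) :
    IsLeftInvariantField IG S ι X V ↔ IsLeftInvariantField IG' S' ι' X' V' := by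
  refine ⟨h.symm.isLeftInvariantField_of_related hS' (fun x => ?_) (fun g => ?_),
    h.isLeftInvariantField_of_related (h.isLieGroupoid hS') hX hV⟩
  · refine (congrArg (mfderivCoord IG' IG d.symm (S'.unit x)) (hX x).symm).trans ?_
    rw [← h.unit_map]
    exact DFunLike.congr_fun (mfderivCoord_symm_comp d (S.unit x)) (ι x (X x))
  · have h2 := hV (d.symm g)
    rw [d.apply_symm_apply] at h2
    refine (congrArg (mfderivCoord IG' IG d.symm g) h2.symm).trans ?_
    have h3 := DFunLike.congr_fun (mfderivCoord_symm_comp d (d.symm g)) (V (d.symm g))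
    rw [d.apply_symm_apply] at h3
    exact h3

omit [IsManifold IG ∞ G] [IsManifold IG' ∞ G'] in
/-- Related vector fields have related Lie brackets. -/
lemma mlieBracket_related [IsManifold IG ∞ G] [IsManifold IG' ∞ G'] [CompleteSpace EG]
    [CompleteSpace EG'] (d : G ≃ₘ^∞⟮IG, IG'⟯ G') {V W : ∀ g : G, TangentSpace IG g}
    {V' W' : ∀ g : G', TangentSpace IG' g}
    (hV : ∀ g, mfderivCoord IG IG' d g (V g) = V' (d g))
    (hW : ∀ g, mfderivCoord IG IG' d g (W g) = W' (d g))
    (hV' : MDifferentiable IG' IG'.tangent fun g => (⟨g, V' g⟩ : TangentBundle IG' G'))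
    (hW' : MDifferentiable IG' IG'.tangent fun g => (⟨g, W' g⟩ : TangentBundle IG' G')) (g : G) :
    mfderivCoord IG IG' d g (VectorField.mlieBracket IG V W g) =
      VectorField.mlieBracket IG' V' W' (d g) := by
  have hinv (g : G) : (mfderivCoord IG IG' d g).IsInvertible :=
    ⟨ContinuousLinearEquiv.equivOfInverse _ (mfderivCoord IG' IG d.symm (d g))
      (fun v => DFunLike.congr_fun (mfderivCoord_symm_comp d g) v)
      (fun v => DFunLike.congr_fun (mfderivCoord_comp_symm d g) v), rfl⟩
  have hpull {V : ∀ g : G, TangentSpace IG g} {V' : ∀ g : G', TangentSpace IG' g}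
      (hV : ∀ g, mfderivCoord IG IG' d g (V g) = V' (d g)) :
      VectorField.mpullback IG IG' d V' = V := by
    funext g
    have : (mfderivCoord IG IG' d g).inverse (mfderivCoord IG IG' d g (V g)) = V g :=
      (hinv g).inverse_apply_self (V g)
    rw [hV] at this
    exact this
  have h2 : minSmoothness ℝ 2 ≤ (∞ : WithTop ℕ∞) := by
    rw [minSmoothness_of_isRCLikeNormedField]; exact ENat.LEInfty.out
  have : IsManifold IG (minSmoothness ℝ 2) G := IsManifold.of_le h2
  have : IsManifold IG' (minSmoothness ℝ 2) G' := IsManifold.of_le h2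
  have key := VectorField.mpullback_mlieBracket (x₀ := g) (hV' (d g)) (hW' (d g))
    (d.contMDiff.contMDiffAt (x := g)) h2
  rw [hpull hV, hpull hW] at key
  refine (congrArg (mfderivCoord IG IG' d g) key.symm).trans ?_
  exact (hinv g).self_apply_inverse (VectorField.mlieBracket IG' V' W' (d g))

/-- Isomorphisms of Lie groupoids respect the brackets of sections of the Lie algebroids. -/
theorem isAlgebroidBracket_iff [CompleteSpace EG] [CompleteSpace EG']
    {d : G ≃ₘ^∞⟮IG, IG'⟯ G'}
    (h : IsLieGroupoidIso IG IG' S S' d) (hS' : IsLieGroupoid IM IG' S')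
    {X Y Z : ∀ x, A x} {X' Y' Z' : ∀ x, A' x}
    (hX : ∀ x, mfderivCoord IG IG' d (S.unit x) (ι x (X x)) = ι' x (X' x))
    (hY : ∀ x, mfderivCoord IG IG' d (S.unit x) (ι x (Y x)) = ι' x (Y' x))
    (hZ : ∀ x, mfderivCoord IG IG' d (S.unit x) (ι x (Z x)) = ι' x (Z' x))
    (hX' : ∀ V', IsLeftInvariantField IG' S' ι' X' V' →
      MDifferentiable IG' IG'.tangent fun g => (⟨g, V' g⟩ : TangentBundle IG' G'))
    (hY' : ∀ V', IsLeftInvariantField IG' S' ι' Y' V' →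
      MDifferentiable IG' IG'.tangent fun g => (⟨g, V' g⟩ : TangentBundle IG' G')) :
    IsAlgebroidBracket IG S ι X Y Z ↔ IsAlgebroidBracket IG' S' ι' X' Y' Z' := by
  constructor
  · intro H V' W' hV' hW'
    let pull (V' : ∀ g : G', TangentSpace IG' g) (g : G) : TangentSpace IG g :=
      mfderivCoord IG' IG d.symm (d g) (V' (d g))
    have hpull (V') (g : G) : mfderivCoord IG IG' d g (pull V' g) = V' (d g) :=
      DFunLike.congr_fun (mfderivCoord_comp_symm d g) (V' (d g))
    exact (h.isLeftInvariantField_iff hS' hZ (mlieBracket_related d (hpull V') (hpull W')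
      (hX' _ hV') (hY' _ hW'))).1 (H _ _
        ((h.isLeftInvariantField_iff hS' hX (hpull V')).2 hV')
        ((h.isLeftInvariantField_iff hS' hY (hpull W')).2 hW'))
  · intro H V W hV hW
    let push (V : ∀ g : G, TangentSpace IG g) (g : G') : TangentSpace IG' g :=
      mfderivCoord IG IG' d (d.symm g) (V (d.symm g))
    have hpush (V : ∀ g : G, TangentSpace IG g) (g : G) :
        mfderivCoord IG IG' d g (V g) = push V (d g) := by
      have : ∀ g', g' = g → mfderivCoord IG IG' d g (V g) = mfderivCoord IG IG' d g' (V g') := by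
        rintro _ rfl; rfl
      exact this _ (d.symm_apply_apply g)
    have hV' := (h.isLeftInvariantField_iff hS' hX (hpush V)).1 hV
    have hW' := (h.isLeftInvariantField_iff hS' hY (hpush W)).1 hW
    exact (h.isLeftInvariantField_iff hS' hZ (mlieBracket_related d (hpush V) (hpush W)
      (hX' _ hV') (hY' _ hW'))).2 (H _ _ hV' hW')

/-- An isomorphism of Lie groupoids induces an isomorphism of Lie algebroids. -/
theorem isLieAlgebroidIso [CompleteSpace EG] [CompleteSpace EG']
    (h : IsLieGroupoidIso IG IG' S S' Φ) (hS' : IsLieGroupoid IM IG' S')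
    (e : TotalSpace F A ≃ₘ^∞⟮IM.prod 𝓘(ℝ, F), IM.prod 𝓘(ℝ, F')⟯ TotalSpace F' A')
    (he : ∀ a, e a = ⟨a.proj, Θ a.proj a.2⟩)
    (hind : ∀ x (a : A x), mfderivCoord IG IG' Φ (S.unit x) (ι x a) = ι' x (Θ x a))
    (hreg : ∀ (X' : ∀ x, A' x) (V' : ∀ g : G', TangentSpace IG' g),
      ContMDiff IM (IM.prod 𝓘(ℝ, F')) ∞ (fun x => (⟨x, X' x⟩ : TotalSpace F' A')) →
      IsLeftInvariantField IG' S' ι' X' V' →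
      MDifferentiable IG' IG'.tangent fun g => (⟨g, V' g⟩ : TangentBundle IG' G')) :
    IsLieAlgebroidIso IM IG F IG' F' S ι S' ι' Θ := by
  obtain ⟨d, rfl⟩ := h.diffeo
  refine ⟨⟨e, he⟩, fun x a => ?_, fun X Y Z hX hY _ => ?_⟩
  · have ht : S.tgt = S'.tgt ∘ d := funext fun g => (h.tgt_map g).symm
    have h1 : mfderivCoord IG IM S.tgt (S.unit x) =
        (mfderivCoord IG' IM S'.tgt (S'.unit x)).comp (mfderivCoord IG IG' d (S.unit x)) := by
      rw [ht, mfderivCoord_comp IG IG' IM (hS'.smooth_tgt.mdifferentiable (by simp) _)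
        (d.contMDiff.mdifferentiable (by simp) _), h.unit_map]
    exact ((DFunLike.congr_fun h1 (ι x a)).trans
      (congrArg (mfderivCoord IG' IM S'.tgt (S'.unit x)) (hind x a))).symm
  · have hsm {X : ∀ x, A x}
        (hX : ContMDiff IM (IM.prod 𝓘(ℝ, F)) ∞ (fun x => (⟨x, X x⟩ : TotalSpace F A))) :
        ContMDiff IM (IM.prod 𝓘(ℝ, F')) ∞ (fun x => (⟨x, Θ x (X x)⟩ : TotalSpace F' A')) :=
      (e.contMDiff.comp hX).congr fun x => (he ⟨x, X x⟩).symm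
    exact h.isAlgebroidBracket_iff hS' (fun x => hind x (X x)) (fun x => hind x (Y x))
      (fun x => hind x (Z x)) (fun V' => hreg _ V' (hsm hX)) (fun V' => hreg _ V' (hsm hY))

end IsLieGroupoidIso

end Transport

/-! ### The pair groupoid -/

section PairGroupoid

variable {E : Type*} [NormedAddCommGroup E] [NormedSpace ℝ E]
  {H : Type*} [TopologicalSpace H] {I : ModelWithCorners ℝ E H}
  {M : Type*} [TopologicalSpace M] [ChartedSpace H M]

/-- The pair groupoid is a Lie groupoid. -/
theorem isLieGroupoid_pairGroupoid [IsManifold I ∞ M] :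
    IsLieGroupoid I (I.prod I) (pairGroupoid M) where
  src_unit _ := rfl
  tgt_unit _ := rfl
  src_mul _ _ _ := rfl
  tgt_mul _ _ _ := rfl
  mul_assoc _ _ _ _ _ := rfl
  unit_mul _ := rfl
  mul_unit _ := rfl
  src_inv _ := rfl
  tgt_inv _ := rfl
  inv_mul _ := rfl
  mul_inv _ := rfl
  smooth_src := contMDiff_fst
  smooth_tgt := contMDiff_snd
  smooth_unit := contMDiff_id.prodMk contMDiff_id
  smooth_inv := contMDiff_snd.prodMk contMDiff_fst
  smooth_mul := ((contMDiff_fst.comp contMDiff_fst).prodMk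
    (contMDiff_snd.comp contMDiff_snd)).contMDiffOn
  submersion_src g := by
    change Function.Surjective (mfderivCoord (I.prod I) I Prod.fst g)
    rw [mfderivCoord_fst]
    exact Prod.fst_surjective
  submersion_tgt g := by
    change Function.Surjective (mfderivCoord (I.prod I) I Prod.snd g)
    rw [mfderivCoord_snd]
    exact Prod.snd_surjective

variable [IsManifold I ∞ M]

/-- The Lie algebroid of the pair groupoid is the tangent bundle. -/
theorem isLieAlgebroidModel_pairGroupoid :
    IsLieAlgebroidModel I (I.prod I) E (pairGroupoid M) (pairAlgebroid I) where
  injective _ a b h := congrArg Prod.snd (show ((0, a) : E × E) = (0, b) from h)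
  range_eq x := by
    refine Set.ext fun v => ?_
    have h : mfderiv (I.prod I) I (pairGroupoid M).src ((pairGroupoid M).unit x) v =
        (show E × E from v).1 :=
      DFunLike.congr_fun (mfderivCoord_fst (I := I) (I' := I) (x, x)) v
    rw [Set.mem_ofPred_eq, h]
    constructor
    · rintro ⟨a, rfl⟩; rfl
    · intro hv
      exact ⟨(show E × E from v).2, Prod.ext hv.symm rfl⟩
  smooth := by
    have h0 : ContMDiff I.tangent I.tangent ∞ fun a : TangentBundle I M =>
        (⟨a.proj, 0⟩ : TangentBundle I M) :=
      (contMDiff_zeroSection ℝ (TangentSpace I : M → Type _)).comp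
        (contMDiff_proj (TangentSpace I : M → Type _))
    exact contMDiff_equivTangentBundleProd_symm.comp (h0.prodMk contMDiff_id)

lemma exists_curve_mfderivCoord_eq [I.Boundaryless] (x : M) (v : E) :
    ∃ γ : ℝ → M, ContMDiffAt 𝓘(ℝ, ℝ) I ∞ γ 0 ∧ γ 0 = x ∧
      mfderivCoord 𝓘(ℝ, ℝ) I γ 0 (1 : ℝ) = v := by
  have h0 : (extChartAt I x).symm (extChartAt I x x + (0 : ℝ) • v) = x := by
    rw [zero_smul, add_zero, extChartAt_to_inv]
  have hline : ContDiff ℝ ∞ fun t : ℝ => extChartAt I x x + t • v := by fun_prop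
  have hsymm : ContMDiffAt 𝓘(ℝ, E) I ∞ (extChartAt I x).symm
      (extChartAt I x x + (0 : ℝ) • v) := by
    rw [zero_smul, add_zero]
    exact (contMDiffOn_extChartAt_symm x).contMDiffAt (extChartAt_target_mem_nhds x)
  refine ⟨(extChartAt I x).symm ∘ fun t : ℝ => extChartAt I x x + t • v,
    hsymm.comp 0 hline.contMDiff.contMDiffAt, h0, ?_⟩
  rw [mfderivCoord_comp 𝓘(ℝ, ℝ) 𝓘(ℝ, E) I (x := (0 : ℝ))
    (f := fun t : ℝ => extChartAt I x x + t • v) (hsymm.mdifferentiableAt (by simp))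
    (hline.contMDiff.mdifferentiable (by simp) _)]
  have h1 : mfderivCoord 𝓘(ℝ, E) I (extChartAt I x).symm (extChartAt I x x + (0 : ℝ) • v) =
      ContinuousLinearMap.id ℝ E := by
    rw [zero_smul, add_zero]
    exact (mfderiv_extChartAt_symm (mem_chart_source H x)).trans
      (tangentCoordChange_self_eq (mem_chart_source H x))
  have h2 : HasDerivAt (fun t : ℝ => extChartAt I x x + t • v) v 0 := by
    simpa using ((hasDerivAt_id (0 : ℝ)).smul_const v).const_add (extChartAt I x x)
  have h3 : mfderivCoord 𝓘(ℝ, ℝ) 𝓘(ℝ, E) (fun t : ℝ => extChartAt I x x + t • v) 0 (1 : ℝ) = v := by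
    rw [mfderivCoord, mfderiv_eq_fderiv]
    exact h2.deriv
  rw [h1, ContinuousLinearMap.comp_apply, h3]
  rfl

/-- Left-invariant vector fields on the pair groupoid. -/
lemma IsLeftInvariantField.apply_pairGroupoid [I.Boundaryless] {X : ∀ x : M, TangentSpace I x}
    {V : ∀ g : M × M, TangentSpace (I.prod I) g}
    (hV : IsLeftInvariantField (I.prod I) (pairGroupoid M) (pairAlgebroid I) X V) (g : M × M) :
    V g = ((0, X g.2) : E × E) := by
  obtain ⟨γ, hγ, h0, hder⟩ := exists_curve_mfderivCoord_eq (I := I) g.2 (X g.2)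
  have hcurve (y : M) : mfderivCoord 𝓘(ℝ, ℝ) (I.prod I) (fun t => (y, γ t)) 0 (1 : ℝ) =
      (0, X g.2) := by
    rw [mfderivCoord_prodMk 𝓘(ℝ, ℝ) I I mdifferentiableAt_const (hγ.mdifferentiableAt (by simp)),
      mfderivCoord_const, ContinuousLinearMap.prod_apply, hder]
    rfl
  have key := hV g (fun t => (g.2, γ t)) (contMDiffAt_const.prodMk hγ)
    (Filter.Eventually.of_forall fun _ => rfl) (Prod.ext rfl h0) (hcurve g.2)
  exact key.symm.trans (hcurve g.1)

lemma IsLeftInvariantField.contMDiff_pairGroupoid [I.Boundaryless] {X : ∀ x : M, TangentSpace I x}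
    {V : ∀ g : M × M, TangentSpace (I.prod I) g}
    (hV : IsLeftInvariantField (I.prod I) (pairGroupoid M) (pairAlgebroid I) X V)
    (hX : ContMDiff I I.tangent ∞ fun x => (⟨x, X x⟩ : TangentBundle I M)) :
    ContMDiff (I.prod I) (I.prod I).tangent ∞ fun g =>
      (⟨g, V g⟩ : TangentBundle (I.prod I) (M × M)) := by
  have h0 : ContMDiff (I.prod I) I.tangent ∞ fun g : M × M =>
      (⟨g.1, 0⟩ : TangentBundle I M) :=
    (contMDiff_zeroSection ℝ (TangentSpace I : M → Type _)).comp contMDiff_fst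
  refine (contMDiff_equivTangentBundleProd_symm.comp
    (h0.prodMk (hX.comp contMDiff_snd))).congr fun g => ?_
  rw [hV.apply_pairGroupoid]
  rfl

/-- A discretization map on `M` is a generalized discretization map on the pair groupoid of
`M`. -/
theorem IsDiscretizationMap.isGeneralizedDiscretizationMap {U : Set (TangentBundle I M)}
    {R : TangentBundle I M → M × M} (h : IsDiscretizationMap I U R) :
    IsGeneralizedDiscretizationMap I (I.prod I) (pairGroupoid M) (pairAlgebroid I) U R := by
  refine ⟨isLieGroupoid_pairGroupoid, isLieAlgebroidModel_pairGroupoid, h.isOpen, h.zero_mem,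
    h.smooth, h.map_zero, fun x a => ?_⟩
  have hR : MDifferentiableAt I.tangent (I.prod I) R ⟨x, 0⟩ :=
    (h.smooth.contMDiffAt (h.isOpen.mem_nhds (h.zero_mem x))).mdifferentiableAt (by simp)
  have hline : MDifferentiableAt 𝓘(ℝ, ℝ) I.tangent
      (fun t : ℝ => (⟨x, t • a⟩ : TangentBundle I M)) 0 :=
    (contMDiff_fibre_line x a).mdifferentiable (by simp) _
  have hfib : MDifferentiableAt 𝓘(ℝ, E) I.tangent (fun u : E => (⟨x, u⟩ : TangentBundle I M)) 0 := by
    have : ContMDiffAt 𝓘(ℝ, E) I.tangent ∞ (fun u : E => (⟨x, u⟩ : TangentBundle I M)) 0 := by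
      refine contMDiffAt_totalSpace.2 ⟨contMDiffAt_const, ?_⟩
      exact (tangentCoordChange I x x x).contDiff.contMDiff.contMDiffAt
    exact this.mdifferentiableAt (by simp)
  have hcomp {f : TangentBundle I M → M} (hf : MDifferentiableAt I.tangent I f ⟨x, 0⟩) :
      mfderivCoord 𝓘(ℝ, ℝ) I (fun t : ℝ => f ⟨x, t • a⟩) 0 (1 : ℝ) = fibreDeriv I f x a := by
    have hl : HasDerivAt (fun t : ℝ => t • (show E from a)) a 0 := by
      have := (hasDerivAt_id (0 : ℝ)).smul_const (show E from a)
      rwa [one_smul] at this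
    have hl' : mfderivCoord 𝓘(ℝ, ℝ) 𝓘(ℝ, E) (fun t : ℝ => t • (show E from a)) 0 (1 : ℝ) = a := by
      rw [mfderivCoord, mfderiv_eq_fderiv]
      exact hl.deriv
    have h1 := mfderivCoord_comp 𝓘(ℝ, ℝ) 𝓘(ℝ, E) I (x := (0 : ℝ))
      (g := fun u : E => f ⟨x, u⟩) (f := fun t : ℝ => t • (show E from a))
      (by
        rw [zero_smul]
        exact MDifferentiableAt.comp (I' := I.tangent) (0 : E) hf hfib)
      (hl.differentiableAt.mdifferentiableAt)
    rw [zero_smul] at h1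
    refine (DFunLike.congr_fun h1 (1 : ℝ)).trans ?_
    rw [ContinuousLinearMap.comp_apply, hl']
    rfl
  have h1 : MDifferentiableAt I.tangent I (fun v => (R v).1) ⟨x, 0⟩ :=
    MDifferentiableAt.comp (I' := I.prod I) (⟨x, 0⟩ : TangentBundle I M) mdifferentiableAt_fst hR
  have h2 : MDifferentiableAt I.tangent I (fun v => (R v).2) ⟨x, 0⟩ :=
    MDifferentiableAt.comp (I' := I.prod I) (⟨x, 0⟩ : TangentBundle I M) mdifferentiableAt_snd hR
  have hpt : (⟨x, (0 : ℝ) • a⟩ : TangentBundle I M) = ⟨x, 0⟩ := by rw [zero_smul]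
  set y : E × E := mfderivCoord I.tangent (I.prod I) R ⟨x, 0⟩ (verticalLift I E x a) with hy
  have hyval : y = (fibreDeriv I (fun v => (R v).1) x a, fibreDeriv I (fun v => (R v).2) x a) := by
    have e1 := mfderivCoord_comp 𝓘(ℝ, ℝ) I.tangent (I.prod I) (x := (0 : ℝ)) (g := R)
      (f := fun t : ℝ => (⟨x, t • a⟩ : TangentBundle I M)) (hpt ▸ hR) hline
    rw [hpt] at e1
    refine (DFunLike.congr_fun e1 (1 : ℝ)).symm.trans ?_
    have e2 := mfderivCoord_prodMk 𝓘(ℝ, ℝ) I I (x := (0 : ℝ))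
      (f := fun t : ℝ => (R ⟨x, t • a⟩).1) (g := fun t : ℝ => (R ⟨x, t • a⟩).2)
      (MDifferentiableAt.comp (I' := I.tangent) (0 : ℝ)
        (g := fun v : TangentBundle I M => (R v).1) (hpt ▸ h1) hline)
      (MDifferentiableAt.comp (I' := I.tangent) (0 : ℝ)
        (g := fun v : TangentBundle I M => (R v).2) (hpt ▸ h2) hline)
    refine (DFunLike.congr_fun e2 (1 : ℝ)).trans ?_
    rw [ContinuousLinearMap.prod_apply, hcomp h1, hcomp h2]
  have hunit : mfderivCoord I (I.prod I) (pairGroupoid M).unit x =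
      (ContinuousLinearMap.id ℝ E).prod (ContinuousLinearMap.id ℝ E) := by
    rw [← mfderivCoord_id (I := I) x]
    exact mfderivCoord_prodMk I I I mdifferentiableAt_id mdifferentiableAt_id
  have hsrc : mfderivCoord (I.prod I) I (pairGroupoid M).src (x, x) =
      ContinuousLinearMap.fst ℝ E E := mfderivCoord_fst I I (x, x)
  have hd := DFunLike.congr_fun (h.deriv_zero x) (show E from a)
  have hgoal : y = ((0, a) : E × E) + mfderivCoord I (I.prod I) (pairGroupoid M).unit x
      (mfderivCoord (I.prod I) I (pairGroupoid M).src (x, x) y) := by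
    rw [hunit, hsrc, hyval]
    refine Prod.ext ?_ ?_
    · simp
    · have hd' : fibreDeriv I (fun v => (R v).2) x a - fibreDeriv I (fun v => (R v).1) x a =
        (show E from a) := hd
      exact sub_eq_iff_eq_add.1 hd'
  exact hgoal

end PairGroupoid

/-! ### The cotangent groupoid of the pair groupoid -/

section CotangentGroupoid

variable {E : Type*} [NormedAddCommGroup E] [NormedSpace ℝ E]
  {H : Type*} [TopologicalSpace H] {I : ModelWithCorners ℝ E H}
  {Q : Type*} [TopologicalSpace Q] [ChartedSpace H Q] [IsManifold I ∞ Q] [I.Boundaryless]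

variable (I Q) in
/-- `Φ*` is an isomorphism of Lie groupoids from `T*(Q × Q)` to the pair groupoid of `T*Q`. -/
theorem isLieGroupoidIso_phiStar :
    IsLieGroupoidIso (cotModel (I.prod I)) ((cotModel I).prod (cotModel I))
      (cotangentPairGroupoid I Q) (pairGroupoid (CotangentBundle I Q)) (phiStar I) where
  diffeo := ⟨phiStarDiffeomorph I Q, rfl⟩
  src_map _ := rfl
  tgt_map _ := rfl
  unit_map p := phiStar_phiStarInv (p, p)
  inv_map P := by
    refine Eq.trans ?_ (phiStar_phiStarInv ((phiStar I P).2, (phiStar I P).1))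
    rfl
  mul_map P P' _ := by
    refine Eq.trans ?_ (phiStar_phiStarInv ((phiStar I P).1, (phiStar I P').2))
    refine congrArg (phiStar I) (congrArg (TotalSpace.mk (P.proj.1, P'.proj.2)) ?_)
    change ((covec P).comp (ContinuousLinearMap.inl ℝ E E)).coprod _ =
      (- -((covec P).comp (ContinuousLinearMap.inl ℝ E E))).coprod _
    rw [neg_neg]
    rfl

variable [FiniteDimensional ℝ E]

lemma phiStarModel_modelFlat_symm (w : E × (E →L[ℝ] ℝ) →L[ℝ] ℝ) :
    phiStarModel E ((modelFlat (E × E)).symm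
      (w.comp ((ContinuousLinearMap.snd ℝ (E × (E →L[ℝ] ℝ)) (E × (E →L[ℝ] ℝ))).comp
        (phiStarModel E)))) = (0, (modelFlat E).symm w) := by
  obtain ⟨⟨a, b⟩, rfl⟩ := (modelFlat E).surjective w
  have h : (modelFlat (E × E)).symm
      ((modelFlat E (a, b)).comp ((ContinuousLinearMap.snd ℝ (E × (E →L[ℝ] ℝ))
        (E × (E →L[ℝ] ℝ))).comp (phiStarModel E))) =
      ((0, a), b.comp (ContinuousLinearMap.snd ℝ E E)) := by
    rw [ContinuousLinearEquiv.symm_apply_eq]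
    refine ContinuousLinearMap.ext fun ⟨⟨y, y'⟩, η⟩ => ?_
    rw [modelFlat_apply, modelFlat_apply, modelSymplectic_apply, ContinuousLinearMap.comp_apply,
      ContinuousLinearMap.comp_apply, phiStarModel_apply, ContinuousLinearMap.coe_snd',
      modelSymplectic_apply]
    rfl
  rw [h, phiStarModel_apply, (modelFlat E).symm_apply_apply]
  refine Prod.ext (Prod.ext rfl ?_) (Prod.ext rfl ?_)
  · refine ContinuousLinearMap.ext fun v => ?_
    simp
  · refine ContinuousLinearMap.ext fun v => ?_
    simp

omit [FiniteDimensional ℝ E] in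
lemma mfderivCoord_phiStar (P : CotangentBundle (I.prod I) (Q × Q)) :
    mfderivCoord (cotModel (I.prod I)) ((cotModel I).prod (cotModel I)) (phiStar I) P =
      phiStarModel E := (hasMFDerivAt_phiStar P).mfderiv

omit [FiniteDimensional ℝ E] in
lemma mfderivCoord_cotangentPairGroupoid_tgt (P : CotangentBundle (I.prod I) (Q × Q)) :
    mfderivCoord (cotModel (I.prod I)) (cotModel I) (cotangentPairGroupoid I Q).tgt P =
      (ContinuousLinearMap.snd ℝ (E × (E →L[ℝ] ℝ)) (E × (E →L[ℝ] ℝ))).comp (phiStarModel E) := by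
  have h : (cotangentPairGroupoid I Q).tgt = Prod.snd ∘ phiStar I := rfl
  rw [h, mfderivCoord_comp _ ((cotModel I).prod (cotModel I)) _ mdifferentiableAt_snd
    (contMDiff_phiStar.mdifferentiable (by simp) _), mfderivCoord_phiStar, mfderivCoord_snd]

/-- The map `Ψ` in the preferred charts. -/
def cotangentAlgebroidAt (p : CotangentBundle I Q) :
    (E × (E →L[ℝ] ℝ) →L[ℝ] ℝ) →L[ℝ] (E × E) × (E × E →L[ℝ] ℝ) :=
  cotangentAlgebroid I p

lemma cotangentAlgebroidAt_apply (p : CotangentBundle I Q) (w : E × (E →L[ℝ] ℝ) →L[ℝ] ℝ) :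
    cotangentAlgebroidAt p w = sharpAt ((cotangentPairGroupoid I Q).unit p)
      (w.comp (mfderivCoord (cotModel (I.prod I)) (cotModel I) (cotangentPairGroupoid I Q).tgt
          ((cotangentPairGroupoid I Q).unit p))) := rfl

/-- `Λ♯` is the isomorphism of Lie algebroids induced by `Φ*`. -/
theorem mfderivCoord_phiStar_cotangentAlgebroidAt (p : CotangentBundle I Q)
    (w : E × (E →L[ℝ] ℝ) →L[ℝ] ℝ) :
    mfderivCoord (cotModel (I.prod I)) ((cotModel I).prod (cotModel I)) (phiStar I)
      ((cotangentPairGroupoid I Q).unit p) (cotangentAlgebroidAt p w) =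
      (0, sharpAt p w) := by
  rw [mfderivCoord_phiStar, cotangentAlgebroidAt_apply, sharpAt_apply,
    mfderivCoord_cotangentPairGroupoid_tgt, phiStarModel_modelFlat_symm, sharpAt_apply]

omit [FiniteDimensional ℝ E] in
lemma IsLeftInvariantField.mdifferentiable_pairGroupoid_cotangent
    (X : ∀ p : CotangentBundle I Q, TangentSpace (cotModel I) p)
    (V : ∀ g : CotangentBundle I Q × CotangentBundle I Q,
      TangentSpace ((cotModel I).prod (cotModel I)) g)
    (hX : ContMDiff (cotModel I) (cotModel I).tangent ∞ fun p =>
      (⟨p, X p⟩ : TangentBundle (cotModel I) (CotangentBundle I Q)))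
    (hV : IsLeftInvariantField ((cotModel I).prod (cotModel I))
      (pairGroupoid (CotangentBundle I Q)) (pairAlgebroid (cotModel I)) X V) :
    MDifferentiable ((cotModel I).prod (cotModel I)) ((cotModel I).prod (cotModel I)).tangent
      fun g => (⟨g, V g⟩ : TangentBundle ((cotModel I).prod (cotModel I))
        (CotangentBundle I Q × CotangentBundle I Q)) :=
  (hV.contMDiff_pairGroupoid hX).mdifferentiable (by simp)

variable (I Q) in
/-- `Λ♯ : T*T*Q → TT*Q` is an isomorphism of Lie algebroids. -/
theorem isLieAlgebroidIso_poissonSharp :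
    IsLieAlgebroidIso (cotModel I) (cotModel (I.prod I)) (E × (E →L[ℝ] ℝ) →L[ℝ] ℝ)
      ((cotModel I).prod (cotModel I)) (E × (E →L[ℝ] ℝ))
      (cotangentPairGroupoid I Q) (cotangentAlgebroid I)
      (pairGroupoid (CotangentBundle I Q)) (pairAlgebroid (cotModel I)) (poissonSharp I) :=
  (isLieGroupoidIso_phiStar I Q).isLieAlgebroidIso isLieGroupoid_pairGroupoid
    (sharpDiffeomorph I Q) (fun _ => rfl)
    (fun p w => mfderivCoord_phiStar_cotangentAlgebroidAt p w)
    IsLeftInvariantField.mdifferentiable_pairGroupoid_cotangent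

variable (I) in
/-- `R̃` is isomorphic to `R^{T*}` via `Φ*` and `Λ♯`. -/
theorem isIsomorphicVia_phiStar (U : Set (TangentBundle I Q)) (R : TangentBundle I Q → Q × Q) :
    IsIsomorphicVia (cotModel I) (cotModel (I.prod I)) ((cotModel I).prod (cotModel I))
      (cotangentPairGroupoid I Q) (cotangentAlgebroid I)
      (groupoidCotangentLiftDomain I U R) (groupoidCotangentLift I R)
      (pairGroupoid (CotangentBundle I Q)) (pairAlgebroid (cotModel I))
      (pairCotangentLiftDomain I U R) (pairCotangentLift I R)
      (phiStar I) (poissonSharp I) where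
  groupoidIso := isLieGroupoidIso_phiStar I Q
  algebroidIso := isLieAlgebroidIso_poissonSharp I Q
  induced p w := mfderivCoord_phiStar_cotangentAlgebroidAt p w
  domain w := by
    change canonicalI I w ∈ cotangentLiftDomain I.tangent (I.prod I) R U ↔
      (tulczyjew I).symm (sharpMap w) ∈ cotangentLiftDomain I.tangent (I.prod I) R U
    rw [canonicalI_eq]
  commutes w _ := by
    change phiStar I (cotangentLift I.tangent (I.prod I) R ((tulczyjew I).symm (sharpMap w))) = _
    rw [← canonicalI_eq]
    rfl

end CotangentGroupoid

/-! ### Smoothness of the cotangent lift -/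

section CotangentLift

variable {E : Type*} [NormedAddCommGroup E] [NormedSpace ℝ E]
  {H : Type*} [TopologicalSpace H] {I : ModelWithCorners ℝ E H}
  {M : Type*} [TopologicalSpace M] [ChartedSpace H M] [IsManifold I ∞ M]
  {E' : Type*} [NormedAddCommGroup E'] [NormedSpace ℝ E']
  {H' : Type*} [TopologicalSpace H'] {J : ModelWithCorners ℝ E' H'}
  {N : Type*} [TopologicalSpace N] [ChartedSpace H' N] [IsManifold J ∞ N]

/-- The change of tangent coordinates as an isomorphism. -/
def tangentCoordChangeEquiv {x y z : M} (hx : z ∈ (chartAt H x).source)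
    (hy : z ∈ (chartAt H y).source) : E ≃L[ℝ] E :=
  ContinuousLinearEquiv.equivOfInverse (tangentCoordChange I x y z) (tangentCoordChange I y x z)
    (fun v => DFunLike.congr_fun (tangentCoordChange_comp_inv hy hx) v)
    (fun v => DFunLike.congr_fun (tangentCoordChange_comp_inv hx hy) v)

lemma coe_tangentCoordChangeEquiv {x y z : M} (hx : z ∈ (chartAt H x).source)
    (hy : z ∈ (chartAt H y).source) :
    (tangentCoordChangeEquiv (I := I) hx hy : E →L[ℝ] E) = tangentCoordChange I x y z := rfl

lemma coe_tangentCoordChangeEquiv_symm {x y z : M} (hx : z ∈ (chartAt H x).source)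
    (hy : z ∈ (chartAt H y).source) :
    ((tangentCoordChangeEquiv (I := I) hx hy).symm : E →L[ℝ] E) = tangentCoordChange I y x z := rfl

variable (I J) in
/-- The tangent map of `f` near `x₀`, read in the preferred charts at `x₀` and `f x₀`. -/
def mfderivIn (f : M → N) (x₀ x : M) : E →L[ℝ] E' :=
  (tangentCoordChange J (f x) (f x₀) (f x)).comp
    ((mfderivCoord I J f x).comp (tangentCoordChange I x₀ x x))

lemma contMDiffAt_mfderivIn {f : M → N} {x₀ : M} (hf : ContMDiffAt I J ∞ f x₀) :
    ContMDiffAt I 𝓘(ℝ, E →L[ℝ] E') ∞ (mfderivIn I J f x₀) x₀ := by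
  have h1 : ContMDiffAt I 𝓘(ℝ, E →L[ℝ] E') ∞
      (inTangentCoordinates I J id f (mfderivCoord I J f) x₀) x₀ :=
    ContMDiffAt.mfderiv_const (n := ∞) hf (by simp)
  refine h1.congr_of_eventuallyEq ?_
  filter_upwards [(chartAt H x₀).open_source.mem_nhds (mem_chart_source H x₀),
    hf.continuousAt.preimage_mem_nhds
      ((chartAt H' (f x₀)).open_source.mem_nhds (mem_chart_source H' (f x₀)))] with x hx hfx
  exact (inTangentCoordinates_eq (I := I) (I' := J) id f (mfderivCoord I J f) hx hfx).symm

lemma isInvertible_mfderivIn_iff {f : M → N} {x₀ x : M} (hx : x ∈ (chartAt H x₀).source)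
    (hfx : f x ∈ (chartAt H' (f x₀)).source) :
    (mfderivIn I J f x₀ x).IsInvertible ↔ (mfderivCoord I J f x).IsInvertible := by
  rw [mfderivIn, ← coe_tangentCoordChangeEquiv (mem_chart_source H' (f x)) hfx,
    ← coe_tangentCoordChangeEquiv hx (mem_chart_source H x),
    ContinuousLinearMap.isInvertible_equiv_comp, ContinuousLinearMap.isInvertible_comp_equiv]

lemma inverse_mfderivIn {f : M → N} {x₀ x : M} (hx : x ∈ (chartAt H x₀).source)
    (hfx : f x ∈ (chartAt H' (f x₀)).source) :
    (mfderivIn I J f x₀ x).inverse = (tangentCoordChange I x x₀ x).comp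
      ((mfderivCoord I J f x).inverse.comp (tangentCoordChange J (f x₀) (f x) (f x))) := by
  rw [mfderivIn, ← coe_tangentCoordChangeEquiv (mem_chart_source H' (f x)) hfx,
    ← coe_tangentCoordChangeEquiv hx (mem_chart_source H x),
    ContinuousLinearMap.inverse_equiv_comp, ContinuousLinearMap.inverse_comp_equiv,
    coe_tangentCoordChangeEquiv_symm, coe_tangentCoordChangeEquiv_symm]
  rfl

lemma trivializationAt_cotangentLift_snd {f : M → N} {x₀ : M} {ζ : CotangentBundle I M}
    (hx : ζ.proj ∈ (chartAt H x₀).source) (hfx : f ζ.proj ∈ (chartAt H' (f x₀)).source) :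
    (trivializationAt (E' →L[ℝ] ℝ) (fun y : N => TangentSpace J y →L[ℝ] ℝ) (f x₀)
      (cotangentLift I J f ζ)).2 =
    (trivializationAt (E →L[ℝ] ℝ) (fun x : M => TangentSpace I x →L[ℝ] ℝ) x₀ ζ).2.comp
      (mfderivIn I J f x₀ ζ.proj).inverse := by
  refine (trivializationAt_cotangent_snd (f x₀) (cotangentLift I J f ζ) hfx).trans ?_
  rw [trivializationAt_cotangent_snd x₀ ζ hx, inverse_mfderivIn hx hfx,
    ContinuousLinearMap.comp_assoc,
    ← ContinuousLinearMap.comp_assoc (tangentCoordChange I x₀ ζ.proj ζ.proj),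
    tangentCoordChange_comp_inv hx (mem_chart_source H ζ.proj), ContinuousLinearMap.id_comp]
  rfl

lemma continuousAt_cotangent_proj (ζ₀ : CotangentBundle I M) :
    ContinuousAt (fun ζ : CotangentBundle I M => ζ.proj) ζ₀ :=
  (FiberBundle.continuous_proj (E →L[ℝ] ℝ) (fun x : M => TangentSpace I x →L[ℝ] ℝ)).continuousAt

lemma eventually_mem_chartAt_cotangentLift {f : M → N} {ζ₀ : CotangentBundle I M}
    (hf : ContinuousAt f ζ₀.proj) : ∀ᶠ ζ in nhds ζ₀,
      ζ.proj ∈ (chartAt H ζ₀.proj).source ∧ f ζ.proj ∈ (chartAt H' (f ζ₀.proj)).source :=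
  (continuousAt_cotangent_proj ζ₀).eventually (Filter.inter_mem
    ((chartAt H ζ₀.proj).open_source.mem_nhds (mem_chart_source H ζ₀.proj))
    (hf.preimage_mem_nhds ((chartAt H' (f ζ₀.proj)).open_source.mem_nhds
      (mem_chart_source H' (f ζ₀.proj)))))

variable [CompleteSpace E]

lemma contMDiffAt_cotangentLift {f : M → N} {ζ₀ : CotangentBundle I M}
    (hf : ContMDiffAt I J ∞ f ζ₀.proj) (h : (mfderivCoord I J f ζ₀.proj).IsInvertible) :
    ContMDiffAt (cotModel I) (cotModel J) ∞ (cotangentLift I J f) ζ₀ := by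
  have hproj : ContMDiffAt (cotModel I) I ∞ (fun ζ : CotangentBundle I M => ζ.proj) ζ₀ :=
    (contMDiff_proj (fun x : M => TangentSpace I x →L[ℝ] ℝ)).contMDiffAt
  refine contMDiffAt_totalSpace.2 ⟨hf.comp ζ₀ hproj, ?_⟩
  have hinv : ContDiffAt ℝ ∞ ContinuousLinearMap.inverse (mfderivIn I J f ζ₀.proj ζ₀.proj) :=
    ((isInvertible_mfderivIn_iff (I := I) (J := J) (f := f) (mem_chart_source H ζ₀.proj) (mem_chart_source H' (f ζ₀.proj))).2
      h).contDiffAt_map_inverse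
  have h1 : ContMDiffAt (cotModel I) 𝓘(ℝ, E' →L[ℝ] E) ∞
      (fun ζ : CotangentBundle I M => (mfderivIn I J f ζ₀.proj ζ.proj).inverse) ζ₀ :=
    hinv.contMDiffAt.comp ζ₀ (ContMDiffAt.comp ζ₀ (contMDiffAt_mfderivIn hf) hproj)
  have h2 := (contMDiffAt_totalSpace.1 (contMDiffAt_id (I := cotModel I) (n := ∞) (x := ζ₀))).2
  refine (ContMDiffAt.clm_comp h2 h1).congr_of_eventuallyEq ?_
  filter_upwards [eventually_mem_chartAt_cotangentLift (H' := H') hf.continuousAt] with ζ hζ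
  exact trivializationAt_cotangentLift_snd hζ.1 hζ.2

/-- The cotangent lift is smooth on its domain. -/
theorem contMDiffOn_cotangentLift {f : M → N} {U : Set M} (hU : IsOpen U)
    (hf : ContMDiffOn I J ∞ f U) :
    ContMDiffOn (cotModel I) (cotModel J) ∞ (cotangentLift I J f) (cotangentLiftDomain I J f U) :=
  fun _ hζ => (contMDiffAt_cotangentLift (hf.contMDiffAt (hU.mem_nhds hζ.1))
    hζ.2).contMDiffWithinAt

/-- The domain of the cotangent lift is open. -/
theorem isOpen_cotangentLiftDomain {f : M → N} {U : Set M} (hU : IsOpen U)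
    (hf : ContMDiffOn I J ∞ f U) : IsOpen (cotangentLiftDomain I J f U) := by
  refine isOpen_iff_mem_nhds.2 fun ζ₀ hζ₀ => ?_
  have hf₀ := hf.contMDiffAt (hU.mem_nhds hζ₀.1)
  have hinv : (mfderivIn I J f ζ₀.proj ζ₀.proj).IsInvertible :=
    (isInvertible_mfderivIn_iff (I := I) (J := J) (f := f) (mem_chart_source H ζ₀.proj) (mem_chart_source H' (f ζ₀.proj))).2 hζ₀.2
  have hev : ∀ᶠ x in nhds ζ₀.proj, (mfderivIn I J f ζ₀.proj x).IsInvertible :=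
    (contMDiffAt_mfderivIn hf₀).continuousAt.eventually
      (ContinuousLinearEquiv.isOpen.mem_nhds hinv)
  filter_upwards [eventually_mem_chartAt_cotangentLift (H' := H') hf₀.continuousAt,
    (continuousAt_cotangent_proj ζ₀).eventually hev,
    (continuousAt_cotangent_proj ζ₀).eventually (hU.mem_nhds hζ₀.1)] with ζ h1 h2 h3
  exact ⟨h3, (isInvertible_mfderivIn_iff (I := I) (J := J) h1.1 h1.2).1 h2⟩

end CotangentLift

/-! ### Discretization maps in coordinates -/

section LocalDiscretization

variable {E : Type*} [NormedAddCommGroup E] [NormedSpace ℝ E]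

/-- `r` is a discretization map near the zero vector at `x₀`, in coordinates. -/
structure IsLocalDiscretizationMap (r : E × E → E × E) (x₀ : E) : Prop where
  contDiffAt : ContDiffAt ℝ ∞ r (x₀, 0)
  map_zero : ∀ᶠ x in nhds x₀, r (x, 0) = (x, x)
  deriv_zero : ∀ᶠ x in nhds x₀, ∀ a : E,
    (fderiv ℝ r (x, 0) (0, a)).2 - (fderiv ℝ r (x, 0) (0, a)).1 = a

namespace IsLocalDiscretizationMap

variable {r : E × E → E × E} {x₀ : E} (h : IsLocalDiscretizationMap r x₀)

include h

lemma hasFDerivAt : HasFDerivAt r (fderiv ℝ r (x₀, 0)) (x₀, 0) :=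
  (h.contDiffAt.differentiableAt (by simp)).hasFDerivAt

lemma fderiv_horizontal (y : E) : fderiv ℝ r (x₀, 0) (y, 0) = (y, y) := by
  have h1 : HasFDerivAt (fun x : E => r (x, 0))
      ((fderiv ℝ r (x₀, 0)).comp (ContinuousLinearMap.inl ℝ E E)) x₀ :=
    HasFDerivAt.comp x₀ h.hasFDerivAt (hasFDerivAt_prodMk_left x₀ (0 : E))
  have h2 : HasFDerivAt (fun x : E => r (x, 0))
      ((ContinuousLinearMap.id ℝ E).prod (ContinuousLinearMap.id ℝ E)) x₀ :=
    ((hasFDerivAt_id x₀).prodMk (hasFDerivAt_id x₀)).congr_of_eventuallyEq h.map_zero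
  exact DFunLike.congr_fun (h1.unique h2) y

lemma fderiv_apply (y v : E) : fderiv ℝ r (x₀, 0) (y, v) =
    (y + (fderiv ℝ r (x₀, 0) (0, v)).1, y + (fderiv ℝ r (x₀, 0) (0, v)).1 + v) := by
  have h1 : ((y, v) : E × E) = (y, 0) + (0, v) := by simp
  rw [h1, map_add, h.fderiv_horizontal]
  refine Prod.ext rfl ?_
  have h2 := h.deriv_zero.self_of_nhds v
  rw [sub_eq_iff_eq_add'] at h2
  rw [Prod.snd_add, h2, ← add_assoc]

lemma fderiv_snd_sub_fst (z : E × E) :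
    (fderiv ℝ r (x₀, 0) z).2 - (fderiv ℝ r (x₀, 0) z).1 = z.2 := by
  rw [← Prod.mk.eta (p := z), h.fderiv_apply]
  simp

lemma isInvertible_fderiv : (fderiv ℝ r (x₀, 0)).IsInvertible := by
  obtain ⟨A, hA⟩ : ∃ A : E →L[ℝ] E, ∀ v, (fderiv ℝ r (x₀, 0) (0, v)).1 = A v :=
    ⟨(ContinuousLinearMap.fst ℝ E E).comp ((fderiv ℝ r (x₀, 0)).comp
      (ContinuousLinearMap.inr ℝ E E)), fun _ => rfl⟩
  let δ : E × E →L[ℝ] E := ContinuousLinearMap.snd ℝ E E - ContinuousLinearMap.fst ℝ E E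
  refine ⟨ContinuousLinearEquiv.equivOfInverse (fderiv ℝ r (x₀, 0))
    ((ContinuousLinearMap.fst ℝ E E - A.comp δ).prod δ) (fun z => ?_) (fun z => ?_), rfl⟩
  · obtain ⟨y, v⟩ := z
    rw [h.fderiv_apply, hA]
    refine Prod.ext ?_ ?_
    · simp [δ]
    · simp [δ]
  · obtain ⟨s, t⟩ := z
    rw [ContinuousLinearMap.prod_apply, h.fderiv_apply, hA]
    refine Prod.ext ?_ ?_
    · simp [δ]
    · simp [δ]

lemma inverse_fderiv_snd (z : E × E) : ((fderiv ℝ r (x₀, 0)).inverse z).2 = z.2 - z.1 := by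
  rw [← h.fderiv_snd_sub_fst, h.isInvertible_fderiv.self_apply_inverse]

lemma hasFDerivAt_fderiv :
    HasFDerivAt (fderiv ℝ r) (fderiv ℝ (fderiv ℝ r) (x₀, 0)) (x₀, 0) :=
  ((h.contDiffAt.fderiv_right (m := ∞) (by simp)).differentiableAt (by simp)).hasFDerivAt

/-- The mixed second derivatives of the two components of `r` agree on the zero section. -/
lemma fderiv_fderiv_snd_sub_fst (a y : E) :
    (fderiv ℝ (fderiv ℝ r) (x₀, 0) (0, a) (y, 0)).2 -
      (fderiv ℝ (fderiv ℝ r) (x₀, 0) (0, a) (y, 0)).1 = 0 := by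
  rw [h.contDiffAt.isSymmSndFDerivAt
    (by rw [minSmoothness_of_isRCLikeNormedField]; exact ENat.LEInfty.out) (0, a) (y, 0)]
  let δ : E × E →L[ℝ] E := ContinuousLinearMap.snd ℝ E E - ContinuousLinearMap.fst ℝ E E
  have h1 : HasFDerivAt (fun x : E => fderiv ℝ r (x, 0))
      ((fderiv ℝ (fderiv ℝ r) (x₀, 0)).comp (ContinuousLinearMap.inl ℝ E E)) x₀ :=
    HasFDerivAt.comp x₀ h.hasFDerivAt_fderiv (hasFDerivAt_prodMk_left x₀ (0 : E))
  have h2 := δ.hasFDerivAt.comp x₀ (h1.clm_apply (hasFDerivAt_const ((0, a) : E × E) x₀))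
  have h3 : HasFDerivAt (δ ∘ fun x : E => fderiv ℝ r (x, 0) (0, a)) (0 : E →L[ℝ] E) x₀ :=
    (hasFDerivAt_const a x₀).congr_of_eventuallyEq (h.deriv_zero.mono fun x hx => hx a)
  have h4 := DFunLike.congr_fun (h2.unique h3) y
  simpa [δ] using h4

variable [CompleteSpace E]

lemma exists_hasFDerivAt_inverse_fderiv : ∃ W : E →L[ℝ] (E × E →L[ℝ] E × E),
    HasFDerivAt (fun a : E => (fderiv ℝ r (x₀, a)).inverse) W 0 ∧
      ∀ a y : E, (W a (y, y)).2 = 0 := by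
  have h1 : HasFDerivAt (fun a : E => fderiv ℝ r (x₀, a))
      ((fderiv ℝ (fderiv ℝ r) (x₀, 0)).comp (ContinuousLinearMap.inr ℝ E E)) 0 :=
    HasFDerivAt.comp (0 : E) h.hasFDerivAt_fderiv (hasFDerivAt_prodMk_right x₀ (0 : E))
  have hinv : DifferentiableAt ℝ ContinuousLinearMap.inverse (fderiv ℝ r (x₀, 0)) :=
    (h.isInvertible_fderiv.contDiffAt_map_inverse (n := ∞)).differentiableAt (by simp)
  have hW := (HasFDerivAt.comp (0 : E) hinv.hasFDerivAt h1)
  refine ⟨_, hW, fun a y => ?_⟩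
  set W := (fderiv ℝ ContinuousLinearMap.inverse (fderiv ℝ r (x₀, 0))).comp
    ((fderiv ℝ (fderiv ℝ r) (x₀, 0)).comp (ContinuousLinearMap.inr ℝ E E))
  have h2 : HasFDerivAt (fun a : E => (fderiv ℝ r (x₀, a)).comp (fderiv ℝ r (x₀, a)).inverse)
      _ 0 := h1.clm_comp hW
  have hev : ∀ᶠ a in nhds (0 : E), (fderiv ℝ r (x₀, a)).IsInvertible :=
    h1.continuousAt.eventually (ContinuousLinearEquiv.isOpen.mem_nhds h.isInvertible_fderiv)
  have h3 : HasFDerivAt (fun a : E => (fderiv ℝ r (x₀, a)).comp (fderiv ℝ r (x₀, a)).inverse)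
      (0 : E →L[ℝ] (E × E →L[ℝ] E × E)) 0 :=
    (hasFDerivAt_const (ContinuousLinearMap.id ℝ (E × E)) (0 : E)).congr_of_eventuallyEq
      (hev.mono fun a ha => ha.self_comp_inverse)
  have h4 := DFunLike.congr_fun (DFunLike.congr_fun (h2.unique h3) a) (y, y)
  have h5 : (fderiv ℝ r (x₀, 0)).inverse (y, y) = (y, 0) := by
    rw [← h.fderiv_horizontal, h.isInvertible_fderiv.inverse_apply_self]
  have h6 : fderiv ℝ r (x₀, 0) (W a (y, y)) =
      -fderiv ℝ (fderiv ℝ r) (x₀, 0) (0, a) (y, 0) := by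
    rw [eq_neg_iff_add_eq_zero, ← h5]
    exact h4
  rw [← h.fderiv_snd_sub_fst, h6, Prod.snd_neg, Prod.fst_neg, neg_sub_neg, ← neg_sub,
    h.fderiv_fderiv_snd_sub_fst, neg_zero]

/-- The cotangent lift of a discretization map satisfies the derivative condition. -/
theorem exists_hasFDerivAt_cotangentLift (p : E →L[ℝ] ℝ) :
    ∃ D₁ D₂ : (E × (E →L[ℝ] ℝ)) →L[ℝ] E × (E →L[ℝ] ℝ),
      HasFDerivAt (fun x : E × (E →L[ℝ] ℝ) => ((r (x₀, x.1)).1,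
        -(((x.2.coprod p).comp (fderiv ℝ r (x₀, x.1)).inverse).comp
          (ContinuousLinearMap.inl ℝ E E)))) D₁ 0 ∧
      HasFDerivAt (fun x : E × (E →L[ℝ] ℝ) => ((r (x₀, x.1)).2,
        ((x.2.coprod p).comp (fderiv ℝ r (x₀, x.1)).inverse).comp
          (ContinuousLinearMap.inr ℝ E E))) D₂ 0 ∧
      D₂ - D₁ = ContinuousLinearMap.id ℝ (E × (E →L[ℝ] ℝ)) := by
  obtain ⟨W, hW, hW0⟩ := h.exists_hasFDerivAt_inverse_fderiv
  set L := fderiv ℝ r (x₀, 0)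
  let fstE : E × (E →L[ℝ] ℝ) →L[ℝ] E := ContinuousLinearMap.fst ℝ E (E →L[ℝ] ℝ)
  have hr : HasFDerivAt (fun x : E × (E →L[ℝ] ℝ) => r (x₀, x.1))
      ((L.comp (ContinuousLinearMap.inr ℝ E E)).comp fstE) 0 :=
    HasFDerivAt.comp (g := fun a : E => r (x₀, a)) (0 : E × (E →L[ℝ] ℝ))
      (HasFDerivAt.comp (0 : E) h.hasFDerivAt (hasFDerivAt_prodMk_right x₀ (0 : E)))
      fstE.hasFDerivAt
  have hW' : HasFDerivAt (fun x : E × (E →L[ℝ] ℝ) => (fderiv ℝ r (x₀, x.1)).inverse)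
      (W.comp fstE) 0 :=
    HasFDerivAt.comp (g := fun a : E => (fderiv ℝ r (x₀, a)).inverse) (0 : E × (E →L[ℝ] ℝ)) hW
      fstE.hasFDerivAt
  let C : E × (E →L[ℝ] ℝ) →L[ℝ] (E × E →L[ℝ] ℝ) :=
    (ContinuousLinearMap.precomp ℝ (ContinuousLinearMap.fst ℝ E E)).comp
      (ContinuousLinearMap.snd ℝ E (E →L[ℝ] ℝ))
  have hz : HasFDerivAt (fun x : E × (E →L[ℝ] ℝ) => x.2.coprod p) C 0 := by
    have h1 := C.hasFDerivAt (x := 0).add_const (p.comp (ContinuousLinearMap.snd ℝ E E))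
    refine h1.congr_of_eventuallyEq (Filter.Eventually.of_forall fun x => ?_)
    exact ContinuousLinearMap.ext fun v => by simp [C]
  obtain ⟨D, hG, hD⟩ : ∃ D : E × (E →L[ℝ] ℝ) →L[ℝ] (E × E →L[ℝ] ℝ),
      HasFDerivAt (fun x : E × (E →L[ℝ] ℝ) =>
        (x.2.coprod p).comp (fderiv ℝ r (x₀, x.1)).inverse) D 0 ∧
      ∀ (x : E × (E →L[ℝ] ℝ)) (y : E), D x (y, y) = x.2 y := by
    refine ⟨_, hz.clm_comp hW', fun x y => ?_⟩
    change ((0 : E →L[ℝ] ℝ).coprod p) (W x.1 (y, y)) + x.2 (L.inverse (y, y)).1 = x.2 y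
    have h1 : L.inverse (y, y) = (y, 0) := by
      rw [← h.fderiv_horizontal, h.isInvertible_fderiv.inverse_apply_self]
    rw [h1, ContinuousLinearMap.coprod_apply, hW0]
    simp
  let P₁ : (E × E →L[ℝ] ℝ) →L[ℝ] E →L[ℝ] ℝ :=
    ContinuousLinearMap.precomp ℝ (ContinuousLinearMap.inl ℝ E E)
  let P₂ : (E × E →L[ℝ] ℝ) →L[ℝ] E →L[ℝ] ℝ :=
    ContinuousLinearMap.precomp ℝ (ContinuousLinearMap.inr ℝ E E)
  refine ⟨_, _, hr.fst.prodMk ((P₁.hasFDerivAt.comp (0 : E × (E →L[ℝ] ℝ)) hG).neg),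
    hr.snd.prodMk (P₂.hasFDerivAt.comp (0 : E × (E →L[ℝ] ℝ)) hG), ?_⟩
  refine ContinuousLinearMap.ext fun x => Prod.ext ?_ (ContinuousLinearMap.ext fun y => ?_)
  · exact h.fderiv_snd_sub_fst (0, x.1)
  · change D x (0, y) - -(D x (y, 0)) = x.2 y
    rw [← hD, sub_neg_eq_add, ← map_add]
    simp

end IsLocalDiscretizationMap

end LocalDiscretization

/-! ### Discretization maps in charts -/

section InCharts

variable {E : Type*} [NormedAddCommGroup E] [NormedSpace ℝ E]
  {H : Type*} [TopologicalSpace H] {I : ModelWithCorners ℝ E H}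
  {M : Type*} [TopologicalSpace M] [ChartedSpace H M] [IsManifold I ∞ M] [I.Boundaryless]
  {E' : Type*} [NormedAddCommGroup E'] [NormedSpace ℝ E']
  {H' : Type*} [TopologicalSpace H'] {J : ModelWithCorners ℝ E' H'}
  {N : Type*} [TopologicalSpace N] [ChartedSpace H' N] [IsManifold J ∞ N] [J.Boundaryless]

lemma hasMFDerivAt_extChartAt_tangentCoordChange {x z : M} (h : z ∈ (chartAt H x).source) :
    HasMFDerivAt I 𝓘(ℝ, E) (extChartAt I x) z (tangentCoordChange I z x z : E →L[ℝ] E) := by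
  refine ⟨continuousAt_extChartAt' (by rwa [extChartAt_source]), ?_⟩
  exact (hasFDerivAt_transition (I := I) (mem_chart_source H z) h).hasFDerivWithinAt

lemma mfderivCoord_extChartAt_symm {x z : M} (h : z ∈ (chartAt H x).source) :
    mfderivCoord 𝓘(ℝ, E) I (extChartAt I x).symm (extChartAt I x z) = tangentCoordChange I x z z :=
  mfderiv_extChartAt_symm h

lemma mfderivCoord_extChartAt {x z : M} (h : z ∈ (chartAt H x).source) :
    mfderivCoord I 𝓘(ℝ, E) (extChartAt I x) z = tangentCoordChange I z x z :=
  (hasMFDerivAt_extChartAt_tangentCoordChange h).mfderiv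

lemma fderiv_writtenInExtChartAt {f : M → N} {x₀ x : M} (hx : x ∈ (chartAt H x₀).source)
    (hfx : f x ∈ (chartAt H' (f x₀)).source) (hf : MDifferentiableAt I J f x) :
    fderiv ℝ (writtenInExtChartAt I J x₀ f) (extChartAt I x₀ x) = mfderivIn I J f x₀ x := by
  have hx' : (extChartAt I x₀).symm (extChartAt I x₀ x) = x :=
    (extChartAt I x₀).left_inv (by rwa [extChartAt_source])
  have hs : MDifferentiableAt 𝓘(ℝ, E) I (extChartAt I x₀).symm (extChartAt I x₀ x) :=
    (hasMFDerivAt_extChartAt_symm hx).mdifferentiableAt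
  have h1 := mfderivCoord_comp 𝓘(ℝ, E) I J (f := (extChartAt I x₀).symm) (g := f)
    (by rw [hx']; exact hf) hs
  have h2 := mfderivCoord_comp 𝓘(ℝ, E) J 𝓘(ℝ, E') (f := f ∘ (extChartAt I x₀).symm)
    (g := extChartAt J (f x₀)) (x := extChartAt I x₀ x)
    (by
      rw [Function.comp_apply, hx']
      exact (hasMFDerivAt_extChartAt_tangentCoordChange hfx).mdifferentiableAt)
    (MDifferentiableAt.comp (I' := I) _ (by rw [hx']; exact hf) hs)
  rw [h1, mfderivCoord_extChartAt_symm hx, Function.comp_apply, hx',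
    mfderivCoord_extChartAt hfx] at h2
  have h3 : fderiv ℝ (writtenInExtChartAt I J x₀ f) (extChartAt I x₀ x) =
      mfderivCoord 𝓘(ℝ, E) 𝓘(ℝ, E') (extChartAt J (f x₀) ∘ (f ∘ (extChartAt I x₀).symm))
        (extChartAt I x₀ x) := by
    rw [mfderivCoord, mfderiv_eq_fderiv]; rfl
  exact h3.trans h2

omit [I.Boundaryless] in
lemma hasMFDerivAt_tangent_mk (x : M) :
    HasMFDerivAt 𝓘(ℝ, E) I.tangent (fun u : E => (⟨x, u⟩ : TangentBundle I M)) 0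
      (ContinuousLinearMap.inr ℝ E E) := by
  have hcont : ContMDiffAt 𝓘(ℝ, E) I.tangent ∞ (fun u : E => (⟨x, u⟩ : TangentBundle I M)) 0 := by
    refine contMDiffAt_totalSpace.2 ⟨contMDiffAt_const, ?_⟩
    exact (tangentCoordChange I x x x).contDiff.contMDiff.contMDiffAt
  refine ⟨hcont.continuousAt, ?_⟩
  have h1 : HasFDerivAt (fun u : E => (extChartAt I x x, u)) (ContinuousLinearMap.inr ℝ E E) 0 :=
    hasFDerivAt_prodMk_right _ _
  refine (h1.congr_of_eventuallyEq (Filter.Eventually.of_forall fun u => ?_)).hasFDerivWithinAt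
  refine (extChartAt_tangent (⟨x, 0⟩ : TangentBundle I M) ⟨x, u⟩).trans ?_
  rw [tangentCoordChange_self_eq (mem_chart_source H x)]
  rfl

omit [I.Boundaryless] in
lemma mfderivCoord_vertical {f : TangentBundle I M → M} {x : M}
    (hf : MDifferentiableAt I.tangent I f ⟨x, 0⟩) (a : E) :
    mfderivCoord I.tangent I f ⟨x, 0⟩ ((0, a) : E × E) = fibreDeriv I f x a := by
  have h := mfderivCoord_comp 𝓘(ℝ, E) I.tangent I (x := (0 : E)) (g := f)
    (f := fun u : E => (⟨x, u⟩ : TangentBundle I M)) hf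
    (hasMFDerivAt_tangent_mk x).mdifferentiableAt
  have h' : mfderivCoord 𝓘(ℝ, E) I.tangent (fun u : E => (⟨x, u⟩ : TangentBundle I M)) 0 =
    ContinuousLinearMap.inr ℝ E E := (hasMFDerivAt_tangent_mk x).mfderiv
  rw [h'] at h
  exact (DFunLike.congr_fun h a).symm

namespace IsDiscretizationMap

variable {U : Set (TangentBundle I M)} {R : TangentBundle I M → M × M}
  (h : IsDiscretizationMap I U R)

include h

omit [I.Boundaryless] in
lemma contMDiffAt {v : TangentBundle I M} (hv : v ∈ U) :
    ContMDiffAt I.tangent (I.prod I) ∞ R v := h.smooth.contMDiffAt (h.isOpen.mem_nhds hv)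

omit [I.Boundaryless] in
lemma mdifferentiableAt {v : TangentBundle I M} (hv : v ∈ U) :
    MDifferentiableAt I.tangent (I.prod I) R v := (h.contMDiffAt hv).mdifferentiableAt (by simp)

omit [I.Boundaryless] in
lemma mfderivCoord_vertical_eq (x : M) (a : E) :
    mfderivCoord I.tangent (I.prod I) R ⟨x, 0⟩ ((0, a) : E × E) =
      (fibreDeriv I (fun v => (R v).1) x a, fibreDeriv I (fun v => (R v).2) x a) := by
  have hR := h.mdifferentiableAt (h.zero_mem x)
  have h1 : MDifferentiableAt I.tangent I (fun v => (R v).1) ⟨x, 0⟩ :=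
    MDifferentiableAt.comp (I' := I.prod I) (⟨x, 0⟩ : TangentBundle I M) mdifferentiableAt_fst hR
  have h2 : MDifferentiableAt I.tangent I (fun v => (R v).2) ⟨x, 0⟩ :=
    MDifferentiableAt.comp (I' := I.prod I) (⟨x, 0⟩ : TangentBundle I M) mdifferentiableAt_snd hR
  rw [← mfderivCoord_vertical h1, ← mfderivCoord_vertical h2]
  exact DFunLike.congr_fun (mfderivCoord_prodMk I.tangent I I h1 h2) ((0, a) : E × E)

omit [I.Boundaryless] in
lemma mfderivCoord_vertical_sub (x : M) (a : E) :
    (mfderivCoord I.tangent (I.prod I) R ⟨x, 0⟩ ((0, a) : E × E)).2 -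
      (mfderivCoord I.tangent (I.prod I) R ⟨x, 0⟩ ((0, a) : E × E)).1 = a := by
  rw [h.mfderivCoord_vertical_eq]
  exact DFunLike.congr_fun (h.deriv_zero x) a

/-- A discretization map is a discretization map in the preferred charts. -/
theorem isLocalDiscretizationMap (q : M) :
    IsLocalDiscretizationMap (writtenInExtChartAt I.tangent (I.prod I) ⟨q, 0⟩ R)
      (extChartAt I q q) := by
  set v₀ : TangentBundle I M := ⟨q, 0⟩
  have hchart (z : M) : extChartAt I.tangent v₀ (⟨z, 0⟩ : TangentBundle I M) =
      (extChartAt I q z, 0) := by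
    rw [extChartAt_tangent]
    exact Prod.ext rfl (_root_.map_zero _)
  have hmem {z : M} (hz : z ∈ (chartAt H q).source) :
      (⟨z, 0⟩ : TangentBundle I M) ∈ (chartAt (ModelProd H E) v₀).source :=
    (mem_chartAt_tangent ..).2 hz
  have hRmem {z : M} (hz : z ∈ (chartAt H q).source) :
      R ⟨z, 0⟩ ∈ (chartAt (ModelProd H H) (R v₀)).source := by
    rw [h.map_zero, h.map_zero, prodChartedSpace_chartAt]
    exact ⟨hz, hz⟩
  have hq := mem_chart_source H q
  refine ⟨?_, ?_, ?_⟩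
  · have h1 := (contMDiffAt_iff.1 (h.contMDiffAt (h.zero_mem q))).2
    rw [I.tangent.range_eq_univ, contDiffWithinAt_univ, hchart] at h1
    exact h1
  · refine (eventually_extChartAt (I := I) hq (P := fun _ u =>
      writtenInExtChartAt I.tangent (I.prod I) v₀ R (u, 0) = (u, u)) ?_).mono fun _ hu => hu
    filter_upwards [eventually_mem_chartAt hq] with z hz
    have h1 : (extChartAt I.tangent v₀).symm (extChartAt I q z, 0) = ⟨z, 0⟩ := by
      rw [← hchart]
      exact (extChartAt I.tangent v₀).left_inv (by rw [extChartAt_source]; exact hmem hz)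
    rw [writtenInExtChartAt, Function.comp_apply, Function.comp_apply, h1, h.map_zero, h.map_zero]
    rfl
  · refine (eventually_extChartAt (I := I) hq (P := fun _ u => ∀ a : E,
      (fderiv ℝ (writtenInExtChartAt I.tangent (I.prod I) v₀ R) (u, 0) (0, a)).2 -
      (fderiv ℝ (writtenInExtChartAt I.tangent (I.prod I) v₀ R) (u, 0) (0, a)).1 = a)
      ?_).mono fun _ hu => hu
    filter_upwards [eventually_mem_chartAt hq] with z hz a
    have h1 := fderiv_writtenInExtChartAt (hmem hz) (hRmem hz)
      (h.mdifferentiableAt (h.zero_mem z))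
    rw [hchart] at h1
    have h2 : tangentCoordChange I.tangent v₀ ⟨z, 0⟩ ⟨z, 0⟩ ((0, a) : E × E) =
        ((0, tangentCoordChange I q z z a) : E × E) := by
      rw [tangentCoordChange_tangent (ξ₀ := v₀) (ξ := ⟨z, 0⟩) (η := ⟨z, 0⟩) hz
        (mem_chart_source H z)]
      simp [v₀]
    have h3 : tangentCoordChange (I.prod I) (R ⟨z, 0⟩) (R v₀) (R ⟨z, 0⟩) =
        (tangentCoordChange I z q z).prodMap (tangentCoordChange I z q z) := by
      rw [h.map_zero, h.map_zero]
      exact tangentCoordChange_prod (mem_chart_source (ModelProd H H) (z, z))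
        (by rw [prodChartedSpace_chartAt]; exact ⟨hz, hz⟩)
    rw [h1, mfderivIn, h3, ContinuousLinearMap.comp_apply, ContinuousLinearMap.comp_apply, h2]
    change tangentCoordChange I z q z _ - tangentCoordChange I z q z _ = a
    rw [← map_sub]
    refine (congrArg (tangentCoordChange I z q z) (h.mfderivCoord_vertical_sub z _)).trans ?_
    exact DFunLike.congr_fun (tangentCoordChange_comp_inv (mem_chart_source H z) hz) a

end IsDiscretizationMap

end InCharts

/-! ### The cotangent lift of a discretization map -/

section PairCotangentLift

variable {E : Type*} [NormedAddCommGroup E] [NormedSpace ℝ E]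
  {H : Type*} [TopologicalSpace H] {I : ModelWithCorners ℝ E H}
  {Q : Type*} [TopologicalSpace Q] [ChartedSpace H Q] [IsManifold I ∞ Q] [I.Boundaryless]
  {U : Set (TangentBundle I Q)} {R : TangentBundle I Q → Q × Q}

namespace IsDiscretizationMap

variable (h : IsDiscretizationMap I U R)

include h

lemma mfderivIn_zero (q : Q) : mfderivIn I.tangent (I.prod I) R ⟨q, 0⟩ ⟨q, 0⟩ =
    fderiv ℝ (writtenInExtChartAt I.tangent (I.prod I) ⟨q, 0⟩ R) (extChartAt I q q, 0) := by
  have h1 := fderiv_writtenInExtChartAt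
    (mem_chart_source (ModelProd H E) (⟨q, 0⟩ : TangentBundle I Q))
    (mem_chart_source (ModelProd H H) (R ⟨q, 0⟩)) (h.mdifferentiableAt (h.zero_mem q))
  rw [← h1, extChartAt_tangent]
  exact congrArg (fun u : E => fderiv ℝ
    (writtenInExtChartAt I.tangent (I.prod I) ⟨q, 0⟩ R) (extChartAt I q q, u))
    (_root_.map_zero (tangentCoordChange I q q q))

lemma mfderivCoord_zero (q : Q) : mfderivCoord I.tangent (I.prod I) R ⟨q, 0⟩ =
    fderiv ℝ (writtenInExtChartAt I.tangent (I.prod I) ⟨q, 0⟩ R) (extChartAt I q q, 0) := by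
  rw [← h.mfderivIn_zero, mfderivIn,
    tangentCoordChange_self_eq (mem_chart_source (ModelProd H H) (R ⟨q, 0⟩)),
    tangentCoordChange_self_eq (mem_chart_source (ModelProd H E) (⟨q, 0⟩ : TangentBundle I Q))]
  rfl

lemma isInvertible_mfderivCoord_zero (q : Q) :
    (mfderivCoord I.tangent (I.prod I) R ⟨q, 0⟩).IsInvertible := by
  rw [h.mfderivCoord_zero]
  exact (h.isLocalDiscretizationMap q).isInvertible_fderiv

lemma pairCotangentLift_zero (p : CotangentBundle I Q) :
    pairCotangentLift I R ⟨p, 0⟩ = (p, p) := by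
  have key : ∀ (x y : Q × Q) (z w : E × E →L[ℝ] ℝ), x = y → z = w →
      (⟨x, z⟩ : CotangentBundle (I.prod I) (Q × Q)) = ⟨y, w⟩ := by rintro x _ z _ rfl rfl; rfl
  have h1 : cotangentLift I.tangent (I.prod I) R ((tulczyjew I).symm ⟨p, 0⟩) =
      phiStarInv I (p, p) := by
    refine key _ _ _ _ (h.map_zero p.proj) ?_
    change (((0 : E →L[ℝ] ℝ).coprod (covec p)).comp
      (mfderivCoord I.tangent (I.prod I) R ⟨p.proj, 0⟩).inverse) =
        (-covec p).coprod (covec p)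
    refine ContinuousLinearMap.ext fun z => ?_
    rw [h.mfderivCoord_zero, ContinuousLinearMap.comp_apply, ContinuousLinearMap.coprod_apply,
      (h.isLocalDiscretizationMap p.proj).inverse_fderiv_snd, ContinuousLinearMap.coprod_apply,
      map_sub]
    simp [sub_eq_neg_add]
  exact (congrArg (phiStar I) h1).trans (phiStar_phiStarInv (p, p))

/-- The map `T*R ∘ α⁻¹` on `T_p T*Q`, in the preferred charts. -/
lemma trivializationAt_pairCotangentLift_snd (p : CotangentBundle I Q) {x : E × (E →L[ℝ] ℝ)}
    (hU : (⟨p.proj, x.1⟩ : TangentBundle I Q) ∈ U)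
    (hx : R ⟨p.proj, x.1⟩ ∈ (chartAt (ModelProd H H) (R ⟨p.proj, 0⟩)).source) :
    (trivializationAt (E × E →L[ℝ] ℝ) (fun y : Q × Q => TangentSpace (I.prod I) y →L[ℝ] ℝ)
      (p.proj, p.proj)
      (cotangentLift I.tangent (I.prod I) R ((tulczyjew I).symm ⟨p, x⟩))).2 =
    (x.2.coprod (covec p)).comp (fderiv ℝ (writtenInExtChartAt I.tangent (I.prod I) ⟨p.proj, 0⟩ R)
      (extChartAt I p.proj p.proj, x.1)).inverse := by
  set v₀ : TangentBundle I Q := ⟨p.proj, 0⟩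
  set v : TangentBundle I Q := ⟨p.proj, x.1⟩
  set ζ := (tulczyjew I).symm ⟨p, x⟩
  have hv : v ∈ (chartAt (ModelProd H E) v₀).source :=
    (mem_chartAt_tangent ..).2 (mem_chart_source H p.proj)
  have h1 := trivializationAt_cotangentLift_snd (I := I.tangent) (J := I.prod I) (f := R)
    (x₀ := v₀) (ζ := ζ) hv hx
  have h2 : tangentCoordChange I.tangent v₀ v v = ContinuousLinearMap.id ℝ (E × E) := by
    have : tangentCoordChange I.tangent v₀ v v = tangentCoordChange I.tangent v v v := by
      rw [tangentCoordChange_eq_fderiv, tangentCoordChange_eq_fderiv]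
      rfl
    rw [this, tangentCoordChange_self_eq (mem_chart_source (ModelProd H E) v)]
  have h3 : fderiv ℝ (writtenInExtChartAt I.tangent (I.prod I) v₀ R)
      (extChartAt I p.proj p.proj, x.1) = mfderivIn I.tangent (I.prod I) R v₀ v := by
    rw [← fderiv_writtenInExtChartAt hv hx (h.mdifferentiableAt hU), extChartAt_tangent,
      tangentCoordChange_self_eq (mem_chart_source H p.proj)]
    rfl
  have h4 := trivializationAt_cotangent_snd (I := I.tangent) v₀ ζ hv
  have h5 : (covec ζ).comp (tangentCoordChange I.tangent v₀ ζ.proj ζ.proj) =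
      x.2.coprod (covec p) :=
    (congrArg (covec ζ).comp h2).trans (ContinuousLinearMap.comp_id _)
  rw [h4, h5] at h1
  rw [h3]
  have key : ∀ y, R v₀ = y → (trivializationAt (E × E →L[ℝ] ℝ)
      (fun y : Q × Q => TangentSpace (I.prod I) y →L[ℝ] ℝ) y
      (cotangentLift I.tangent (I.prod I) R ζ)).2 =
      (x.2.coprod (covec p)).comp (mfderivIn I.tangent (I.prod I) R v₀ v).inverse := by
    rintro _ rfl
    exact h1
  exact key _ (h.map_zero p.proj)

omit [I.Boundaryless] in
lemma eventually_pairCotangentLift (p : CotangentBundle I Q) :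
    ∀ᶠ x : E × (E →L[ℝ] ℝ) in nhds 0, (⟨p.proj, x.1⟩ : TangentBundle I Q) ∈ U ∧
      R ⟨p.proj, x.1⟩ ∈ (chartAt (ModelProd H H) (R ⟨p.proj, 0⟩)).source := by
  have h1 : ContinuousAt (fun u : E => (⟨p.proj, u⟩ : TangentBundle I Q)) 0 :=
    (hasMFDerivAt_tangent_mk p.proj).continuousAt
  have h2 : ContinuousAt (fun x : E × (E →L[ℝ] ℝ) => (⟨p.proj, x.1⟩ : TangentBundle I Q)) 0 :=
    ContinuousAt.comp (f := Prod.fst) (x := (0 : E × (E →L[ℝ] ℝ))) h1 continuousAt_fst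
  refine (h2.eventually (h.isOpen.mem_nhds (h.zero_mem p.proj))).and
    (h2.eventually ((h.contMDiffAt (h.zero_mem p.proj)).continuousAt.preimage_mem_nhds
      ((chartAt (ModelProd H H) (R ⟨p.proj, 0⟩)).open_source.mem_nhds
        (mem_chart_source (ModelProd H H) (R ⟨p.proj, 0⟩)))))

lemma extChartAt_pairCotangentLift (p : CotangentBundle I Q) {x : E × (E →L[ℝ] ℝ)}
    (hU : (⟨p.proj, x.1⟩ : TangentBundle I Q) ∈ U)
    (hx : R ⟨p.proj, x.1⟩ ∈ (chartAt (ModelProd H H) (R ⟨p.proj, 0⟩)).source) :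
    let r := writtenInExtChartAt I.tangent (I.prod I) ⟨p.proj, 0⟩ R
    let x₀ := extChartAt I p.proj p.proj
    extChartAt (cotModel I) p (pairCotangentLift I R ⟨p, x⟩).1 = ((r (x₀, x.1)).1,
        -(((x.2.coprod (covec p)).comp (fderiv ℝ r (x₀, x.1)).inverse).comp
          (ContinuousLinearMap.inl ℝ E E))) ∧
      extChartAt (cotModel I) p (pairCotangentLift I R ⟨p, x⟩).2 = ((r (x₀, x.1)).2,
        ((x.2.coprod (covec p)).comp (fderiv ℝ r (x₀, x.1)).inverse).comp
          (ContinuousLinearMap.inr ℝ E E)) := by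
  intro r x₀
  set v₀ : TangentBundle I Q := ⟨p.proj, 0⟩ with hv₀
  set v : TangentBundle I Q := ⟨p.proj, x.1⟩ with hv
  set P := cotangentLift I.tangent (I.prod I) R ((tulczyjew I).symm ⟨p, x⟩) with hP
  have hPx : P.proj = R v := rfl
  have hPmem : P.proj ∈ (chartAt (ModelProd H H) (p.proj, p.proj)).source := by
    rw [hPx, ← h.map_zero]; exact hx
  have hPmem' := hPmem
  rw [prodChartedSpace_chartAt] at hPmem'
  have h1 := h.trivializationAt_pairCotangentLift_snd p hU hx
  have h2 := trivializationAt_cotangent_prod_snd (p.proj, p.proj) P hPmem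
  have h3 := h2.symm.trans h1
  have hsymm : (extChartAt I.tangent v₀).symm (x₀, x.1) = v := by
    have e : extChartAt I.tangent v₀ v = (x₀, x.1) := by
      rw [extChartAt_tangent]
      refine Prod.ext rfl ?_
      change tangentCoordChange I p.proj p.proj p.proj x.1 = x.1
      rw [tangentCoordChange_self_eq (mem_chart_source H p.proj)]
      rfl
    rw [← e]
    refine (extChartAt I.tangent v₀).left_inv ?_
    rw [extChartAt_source]
    exact (mem_chartAt_tangent ..).2 (mem_chart_source H p.proj)
  have hr : r (x₀, x.1) = extChartAt (I.prod I) (p.proj, p.proj) (R v) := by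
    change extChartAt (I.prod I) (R v₀) (R ((extChartAt I.tangent v₀).symm (x₀, x.1))) = _
    rw [hsymm, hv₀, h.map_zero]
  constructor
  · refine (extChartAt_cotangent p (phiStar I P).1 hPmem'.1).trans ?_
    rw [covec_phiStar_fst]
    refine Prod.ext (congrArg Prod.fst hr).symm ?_
    refine (ContinuousLinearMap.neg_comp _ _).trans (congrArg Neg.neg ?_)
    rw [← h3, ContinuousLinearMap.coprod_comp_inl]
    rfl
  · refine (extChartAt_cotangent p (phiStar I P).2 hPmem'.2).trans ?_
    rw [covec_phiStar_snd]
    refine Prod.ext (congrArg Prod.snd hr).symm ?_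
    rw [← h3, ContinuousLinearMap.coprod_comp_inr]
    rfl

variable [CompleteSpace E]

/-- The cotangent lift of a discretization map on `Q` is a discretization map on `T*Q`. -/
theorem pairCotangentLift : IsDiscretizationMap (cotModel I) (pairCotangentLiftDomain I U R)
    (CotangentLift.pairCotangentLift I R) := by
  have hopen : IsOpen (pairCotangentLiftDomain I U R) :=
    (isOpen_cotangentLiftDomain h.isOpen h.smooth).preimage contMDiff_tulczyjew_symm.continuous
  have hzero (p : CotangentBundle I Q) :
      (⟨p, 0⟩ : TangentBundle (cotModel I) (CotangentBundle I Q)) ∈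
        pairCotangentLiftDomain I U R :=
    ⟨h.zero_mem p.proj, h.isInvertible_mfderivCoord_zero p.proj⟩
  have hsmooth : ContMDiffOn (cotModel I).tangent ((cotModel I).prod (cotModel I)) ∞
      (CotangentLift.pairCotangentLift I R) (pairCotangentLiftDomain I U R) :=
    contMDiff_phiStar.comp_contMDiffOn
      ((contMDiffOn_cotangentLift h.isOpen h.smooth).comp contMDiff_tulczyjew_symm.contMDiffOn
        fun _ hξ => hξ)
  refine ⟨hopen, hzero, hsmooth, h.pairCotangentLift_zero, fun p => ?_⟩
  obtain ⟨D₁, D₂, hD₁, hD₂, hD⟩ :=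
    (h.isLocalDiscretizationMap p.proj).exists_hasFDerivAt_cotangentLift (covec p)
  have hcont : ContinuousAt (fun x : E × (E →L[ℝ] ℝ) => CotangentLift.pairCotangentLift I R
      (⟨p, x⟩ : TangentBundle (cotModel I) (CotangentBundle I Q))) 0 :=
    ContinuousAt.comp (f := fun x : E × (E →L[ℝ] ℝ) =>
      (⟨p, x⟩ : TangentBundle (cotModel I) (CotangentBundle I Q))) (x := (0 : E × (E →L[ℝ] ℝ)))
      (hsmooth.contMDiffAt (hopen.mem_nhds (hzero p))).continuousAt
      (hasMFDerivAt_tangent_mk (I := cotModel I) p).continuousAt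
  have h₁ : HasMFDerivAt 𝓘(ℝ, E × (E →L[ℝ] ℝ)) (cotModel I) (fun x : E × (E →L[ℝ] ℝ) =>
      (CotangentLift.pairCotangentLift I R
        (⟨p, x⟩ : TangentBundle (cotModel I) (CotangentBundle I Q))).1) 0 D₁ := by
    refine ⟨continuousAt_fst.comp hcont, (hD₁.congr_of_eventuallyEq ?_).hasFDerivWithinAt⟩
    filter_upwards [h.eventually_pairCotangentLift p] with x hx
    refine Eq.trans ?_ (h.extChartAt_pairCotangentLift p hx.1 hx.2).1
    exact congrArg (fun η : CotangentBundle I Q => extChartAt (cotModel I) η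
      (CotangentLift.pairCotangentLift I R ⟨p, x⟩).1)
      (congrArg Prod.fst (h.pairCotangentLift_zero p))
  have h₂ : HasMFDerivAt 𝓘(ℝ, E × (E →L[ℝ] ℝ)) (cotModel I) (fun x : E × (E →L[ℝ] ℝ) =>
      (CotangentLift.pairCotangentLift I R
        (⟨p, x⟩ : TangentBundle (cotModel I) (CotangentBundle I Q))).2) 0 D₂ := by
    refine ⟨continuousAt_snd.comp hcont, (hD₂.congr_of_eventuallyEq ?_).hasFDerivWithinAt⟩
    filter_upwards [h.eventually_pairCotangentLift p] with x hx
    refine Eq.trans ?_ (h.extChartAt_pairCotangentLift p hx.1 hx.2).2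
    exact congrArg (fun η : CotangentBundle I Q => extChartAt (cotModel I) η
      (CotangentLift.pairCotangentLift I R ⟨p, x⟩).2)
      (congrArg Prod.snd (h.pairCotangentLift_zero p))
  have e₁ : fibreDeriv (cotModel I)
      (fun ξ => (CotangentLift.pairCotangentLift I R ξ).1) p = D₁ := h₁.mfderiv
  have e₂ : fibreDeriv (cotModel I)
      (fun ξ => (CotangentLift.pairCotangentLift I R ξ).2) p = D₂ := h₂.mfderiv
  rw [e₁, e₂]
  exact hD

end IsDiscretizationMap

end PairCotangentLift

end CotangentLift

end

theorem mainTheorem11 {E : Type*} [NormedAddCommGroup E] [NormedSpace ℝ E]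
    [FiniteDimensional ℝ E] {Q : Type*} [TopologicalSpace Q] [ChartedSpace E Q]
    [IsManifold 𝓘(ℝ, E) ∞ Q]
    (U : Set (TangentBundle 𝓘(ℝ, E) Q)) (R : TangentBundle 𝓘(ℝ, E) Q → Q × Q)
    (hR : IsDiscretizationMap 𝓘(ℝ, E) U R) :
    IsGeneralizedDiscretizationMap (cotModel 𝓘(ℝ, E)) (cotModel (𝓘(ℝ, E).prod 𝓘(ℝ, E)))
      (cotangentPairGroupoid 𝓘(ℝ, E) Q) (cotangentAlgebroid 𝓘(ℝ, E))
      (groupoidCotangentLiftDomain 𝓘(ℝ, E) U R) (groupoidCotangentLift 𝓘(ℝ, E) R) ∧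
    IsDiscretizationMap (cotModel 𝓘(ℝ, E))
      (pairCotangentLiftDomain 𝓘(ℝ, E) U R) (pairCotangentLift 𝓘(ℝ, E) R) ∧
    IsGeneralizedDiscretizationMap (cotModel 𝓘(ℝ, E))
      ((cotModel 𝓘(ℝ, E)).prod (cotModel 𝓘(ℝ, E)))
      (pairGroupoid (CotangentBundle 𝓘(ℝ, E) Q)) (pairAlgebroid (cotModel 𝓘(ℝ, E)))
      (pairCotangentLiftDomain 𝓘(ℝ, E) U R) (pairCotangentLift 𝓘(ℝ, E) R) ∧
    IsIsomorphicVia (cotModel 𝓘(ℝ, E)) (cotModel (𝓘(ℝ, E).prod 𝓘(ℝ, E)))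
      ((cotModel 𝓘(ℝ, E)).prod (cotModel 𝓘(ℝ, E)))
      (cotangentPairGroupoid 𝓘(ℝ, E) Q) (cotangentAlgebroid 𝓘(ℝ, E))
      (groupoidCotangentLiftDomain 𝓘(ℝ, E) U R) (groupoidCotangentLift 𝓘(ℝ, E) R)
      (pairGroupoid (CotangentBundle 𝓘(ℝ, E) Q)) (pairAlgebroid (cotModel 𝓘(ℝ, E)))
      (pairCotangentLiftDomain 𝓘(ℝ, E) U R) (pairCotangentLift 𝓘(ℝ, E) R)
      (phiStar 𝓘(ℝ, E)) (poissonSharp 𝓘(ℝ, E)) := by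
  have : CompleteSpace E := FiniteDimensional.complete ℝ E
  have hpair := hR.pairCotangentLift
  have hgen := hpair.isGeneralizedDiscretizationMap
  have hiso := isIsomorphicVia_phiStar 𝓘(ℝ, E) U R
  exact ⟨hiso.isGeneralizedDiscretizationMap hgen, hpair, hgen, hiso⟩
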